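/- Let $K$ transmitters communicate over a memoryless interference channel: in each channel use, inputs $x_1,\dots,x_K$ (user $i$'s input lying in a standard Borel space $\mathcal X_i$) produce outputs $Y_1,\dots,Y_K$ at the $K$ legitimate receivers and $Y_0=Z$ at an external eavesdropper (standard Borel output spaces), with joint law $P(\,\cdot\mid x_1,\dots,x_K)$, independently over time given the inputs. Input $i$ is subject to an average cost constraint $\mathbb E[c_i(X_i)]\le P_i$, with $c_i\ge 0$ measurable. The Gaussian channel $Y_i=\sum_k h_{ki}X_k+N_i$, $Z=\sum_k g_kX_k+N_Z$ with independent standard Gaussian noises and power constraints $\mathbb E[X_i^2]\le P$ is a special case. A code of block length $n\ge1$ consists of independent messages $W_i$, uniform on finite sets $\mathcal W_i$, stochastic encoders $W_i\mapsto \mathbf X_i=(X_{i,1},\dots,X_{i,n})$ acting independently at the different transmitters, and decoders $\mathbf Y_i\mapsto\hat W_i$. A tuple $(R_1,\dots,R_K)$ is called achievable if for every $\epsilon>0$ there are an $n\ge 1$ and a code of block length $n$ with, for all $i=1,\dots,K$, \[ \tfrac1n\log|\mathcal W_i|\ge R_i-\epsilon,\qquad \tfrac1n\sum_{t=1}^n\mathbb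 E[c_i(X_{i,t})]\le P_i,\qquad \Pr[\hat W_i\ne W_i]\le\epsilon, \] \[ H\big((W_k)_{k\ne i}\mid\mathbf Y_i\big)\ge H\big((W_k)_{k\ne i}\big)-n\epsilon,\qquad\text{and}\qquad H(W_1,\dots,W_K\mid\mathbf Z)\ge H(W_1,\dots,W_K)-n\epsilon . \] Theorem. Let $V_1,\dots,V_K$ be auxiliary random variables with values in standard Borel spaces and $X_1,\dots,X_K$ channel inputs such that the pairs $(V_1,X_1),\dots,(V_K,X_K)$ are mutually independent and $\mathbb E[c_i(X_i)]\le P_i$ for all $i$; let $(Y_0,Y_1,\dots,Y_K)$ be the outputs of one channel use with inputs $X_1,\dots,X_K$, so that $(V_1,\dots,V_K)\to(X_1,\dots,X_K)\to(Y_0,\dots,Y_K)$ is a Markov chain. Write $V_{-i}=(V_k)_{k\ne i}$. Then every tuple of real numbers $(R_1,\dots,R_K)$ with \[ R_i\le I(V_i;Y_i)-\max_{j\in\{0,1,\dots,K\},\,j\ne i} I(V_i;Y_j\mid V_{-i}),\qquad i=1,\dots,K, \] is achievable. All logarithms are taken to the same base; an infinite subtracted term makes the right-hand side $-\infty$. 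-/

import Mathlib

open MeasureTheory ProbabilityTheory
open scoped ENNReal NNReal

namespace InterferenceSecrecy

/-! ### Information measures (in nats) -/

/-- The mutual information `I(A; B)`: the Kullback-Leibler divergence of the joint law of `(A, B)`
from the product of the marginal laws. -/
noncomputable def mutualInfo {Ω α β : Type*} [MeasurableSpace Ω] [MeasurableSpace α]
    [MeasurableSpace β] (A : Ω → α) (B : Ω → β) (μ : Measure Ω) : ℝ≥0∞ :=
  InformationTheory.klDiv (μ.map fun ω => (A ω, B ω)) ((μ.map A).prod (μ.map B))

/-- The conditional mutual information `I(A; B | C)`: the Kullback-Leibler divergence of the law of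
`(C, (A, B))` from the law under which `C` keeps its law and, given `C`, `A` and `B` are
independent with their own regular conditional laws given `C`. -/
noncomputable def condMutualInfo {Ω α β γ : Type*} [MeasurableSpace Ω]
    [MeasurableSpace α] [StandardBorelSpace α] [Nonempty α]
    [MeasurableSpace β] [StandardBorelSpace β] [Nonempty β] [MeasurableSpace γ]
    (A : Ω → α) (B : Ω → β) (C : Ω → γ) (μ : Measure Ω) [IsFiniteMeasure μ] : ℝ≥0∞ :=
  InformationTheory.klDiv (μ.map fun ω => (C ω, (A ω, B ω)))
    ((μ.map C) ⊗ₘ ((condDistrib A C μ) ×ₖ (condDistrib B C μ)))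

/-- The entropy `H(A)` of a random variable with finitely many values. -/
noncomputable def entropy {Ω α : Type*} [MeasurableSpace Ω] [MeasurableSpace α] [Fintype α]
    (A : Ω → α) (μ : Measure Ω) : ℝ :=
  ∑ a, Real.negMulLog ((μ.map A).real {a})

/-- The conditional entropy `H(A | B)` of a random variable `A` with finitely many values given an
arbitrary random variable `B`: the average over `B` of the entropy of the conditional law of `A`
given `B`. -/
noncomputable def condEntropy {Ω α β : Type*} [MeasurableSpace Ω] [MeasurableSpace α]
    [StandardBorelSpace α] [Nonempty α] [Fintype α] [MeasurableSpace β]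
    (A : Ω → α) (B : Ω → β) (μ : Measure Ω) [IsFiniteMeasure μ] : ℝ :=
  ∫ b, ∑ a, Real.negMulLog ((condDistrib A B μ b).real {a}) ∂(μ.map B)

/-! ### Finite products of Markov kernels -/

/-- The finite product of Markov kernels: given `a`, the coordinates are independent and
coordinate `i` has law `κ i a`. -/
noncomputable def prodKernel {ι α : Type*} [Fintype ι] {β : ι → Type*} [MeasurableSpace α]
    [∀ i, MeasurableSpace (β i)] (κ : ∀ i, Kernel α (β i)) [∀ i, IsMarkovKernel (κ i)] :
    Kernel α (∀ i, β i) where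
  toFun a := Measure.pi fun i => κ i a
  measurable' := by
    refine Measurable.measure_of_isPiSystem_of_isProbabilityMeasure
      generateFrom_pi.symm isPiSystem_pi ?_
    rintro s ⟨t, ht, rfl⟩
    simp only [Measure.pi_pi]
    exact Finset.measurable_prod _ fun i _ => (κ i).measurable_coe (ht i (Set.mem_univ i))

instance {ι α : Type*} [Fintype ι] {β : ι → Type*} [MeasurableSpace α]
    [∀ i, MeasurableSpace (β i)] (κ : ∀ i, Kernel α (β i)) [∀ i, IsMarkovKernel (κ i)] :
    IsMarkovKernel (prodKernel κ) :=
  ⟨fun a => inferInstanceAs (IsProbabilityMeasure (Measure.pi fun i => κ i a))⟩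

/-! ### The channel

Transmitters and legitimate receivers are indexed by `Fin K`. Outputs are indexed by
`Option (Fin K)`: `some i` is receiver `i`, and `none` is the external eavesdropper. A channel is a
Markov kernel from the input letters `(x₁, …, x_K)` to the output letters `(z, y₁, …, y_K)`. -/

/-- `n` uses of the memoryless channel `W`: given the input blocks, the output letters at different
times are independent, and those at time `t` have law `W (x₁(t), …, x_K(t))`. -/
noncomputable def blockChannel {K : ℕ} {𝒳 : Fin K → Type*} [∀ i, MeasurableSpace (𝒳 i)]
    {𝒴 : Option (Fin K) → Type*} [∀ j, MeasurableSpace (𝒴 j)]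
    (W : Kernel (∀ i, 𝒳 i) (∀ j, 𝒴 j)) [IsMarkovKernel W] (n : ℕ) :
    Kernel (∀ i, Fin n → 𝒳 i) (Fin n → ∀ j, 𝒴 j) :=
  prodKernel fun t : Fin n =>
    W.comap (fun (x : ∀ i, Fin n → 𝒳 i) (i : Fin K) => x i t) (by fun_prop)

instance {K : ℕ} {𝒳 : Fin K → Type*} [∀ i, MeasurableSpace (𝒳 i)]
    {𝒴 : Option (Fin K) → Type*} [∀ j, MeasurableSpace (𝒴 j)]
    (W : Kernel (∀ i, 𝒳 i) (∀ j, 𝒴 j)) [IsMarkovKernel W] (n : ℕ) :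
    IsMarkovKernel (blockChannel W n) := by
  unfold blockChannel
  infer_instance

/-- The kernel from `x` to the Gaussian law with mean `∑ k, a k * x k` and unit variance. -/
noncomputable def gaussianOutput {K : ℕ} (a : Fin K → ℝ) : Kernel (Fin K → ℝ) ℝ where
  toFun x := gaussianReal (∑ k, a k * x k) 1
  measurable' := by fun_prop

instance {K : ℕ} (a : Fin K → ℝ) : IsMarkovKernel (gaussianOutput a) :=
  ⟨fun x => inferInstanceAs (IsProbabilityMeasure (gaussianReal (∑ k, a k * x k) 1))⟩

/-- The real Gaussian interference channel with an external eavesdropper, as an instance of the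
above: `Y i = ∑ k, h k i * x k + N i` and `Z = ∑ k, g k * x k + N_Z` with independent standard
Gaussian noises, where `h k i` is the gain from transmitter `k` to receiver `i`. Its power
constraint is the cost constraint with cost `x ^ 2`. -/
noncomputable def gaussianChannel {K : ℕ} (h : Fin K → Fin K → ℝ) (g : Fin K → ℝ) :
    Kernel (Fin K → ℝ) (Option (Fin K) → ℝ) :=
  prodKernel fun j : Option (Fin K) => gaussianOutput fun k => j.elim (g k) (h k)

instance {K : ℕ} (h : Fin K → Fin K → ℝ) (g : Fin K → ℝ) :
    IsMarkovKernel (gaussianChannel h g) := by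
  unfold gaussianChannel
  infer_instance

/-! ### Codes -/

/-- A joint code of block length `n`: message sets of sizes `M i ≥ 1`, stochastic encoders `enc i`
and decoders `dec i`. -/
structure Code {K : ℕ} (𝒳 : Fin K → Type*) [∀ i, MeasurableSpace (𝒳 i)]
    (𝒴 : Option (Fin K) → Type*) [∀ j, MeasurableSpace (𝒴 j)] (n : ℕ) where
  /-- the number of messages of each transmitter -/
  M : Fin K → ℕ
  M_ne_zero : ∀ i, NeZero (M i)
  /-- the stochastic encoder of transmitter `i` -/
  enc : ∀ i, Kernel (Fin (M i)) (Fin n → 𝒳 i)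
  isMarkovKernel_enc : ∀ i, IsMarkovKernel (enc i)
  /-- the decoder of receiver `i` -/
  dec : ∀ i, (Fin n → 𝒴 (some i)) → Fin (M i)
  measurable_dec : ∀ i, Measurable (dec i)

attribute [instance] Code.M_ne_zero Code.isMarkovKernel_enc

namespace Code

/-- The sample space of a block transmission: messages, input blocks, and output letters. -/
abbrev Space {K : ℕ} {𝒳 : Fin K → Type*} [∀ i, MeasurableSpace (𝒳 i)]
    {𝒴 : Option (Fin K) → Type*} [∀ j, MeasurableSpace (𝒴 j)] {n : ℕ} (C : Code 𝒳 𝒴 n) : Type _ :=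
  ((∀ i, Fin (C.M i)) × (∀ i, Fin n → 𝒳 i)) × (Fin n → ∀ j, 𝒴 j)

section

variable {K : ℕ} {𝒳 : Fin K → Type*} [∀ i, MeasurableSpace (𝒳 i)]
  {𝒴 : Option (Fin K) → Type*} [∀ j, MeasurableSpace (𝒴 j)] {n : ℕ} (C : Code 𝒳 𝒴 n)

/-- The message `W i` of transmitter `i`. -/
def msg (i : Fin K) (ω : C.Space) : Fin (C.M i) := ω.1.1 i

/-- The tuple of all messages. -/
def msgAll (ω : C.Space) (i : Fin K) : Fin (C.M i) := C.msg i ω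

/-- The tuple of all messages except that of transmitter `i`. -/
def msgExcept (i : Fin K) (ω : C.Space) (k : {k : Fin K // k ≠ i}) : Fin (C.M k) := C.msg k ω

/-- The input letter of transmitter `i` at time `t`. -/
def input (i : Fin K) (t : Fin n) (ω : C.Space) : 𝒳 i := ω.1.2 i t

/-- The output block of receiver `j` (of the external eavesdropper if `j = none`). -/
def output (j : Option (Fin K)) (ω : C.Space) (t : Fin n) : 𝒴 j := ω.2 t j

/-- The rate `log (M i) / n`, in nats per channel use. -/
noncomputable def rate (i : Fin K) : ℝ := Real.log (C.M i) / n

/-- The law of messages, input blocks and output letters: the messages are independent and uniform;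
given the messages, each transmitter encodes its own message independently of the others; the
outputs depend on the messages through the input blocks, by `n` uses of the memoryless channel. -/
noncomputable def law (W : Kernel (∀ i, 𝒳 i) (∀ j, 𝒴 j)) [IsMarkovKernel W] : Measure C.Space :=
  ((Measure.pi fun i => uniformOn (Set.univ : Set (Fin (C.M i)))) ⊗ₘ
      (prodKernel fun i => (C.enc i).comap (fun w : ∀ i, Fin (C.M i) => w i)
        (measurable_pi_apply i))) ⊗ₘ
    ((blockChannel W n).prodMkLeft (∀ i, Fin (C.M i)))

instance (W : Kernel (∀ i, 𝒳 i) (∀ j, 𝒴 j)) [IsMarkovKernel W] :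
    IsProbabilityMeasure (C.law W) := by
  have (i : Fin K) : IsProbabilityMeasure (uniformOn (Set.univ : Set (Fin (C.M i)))) :=
    isProbabilityMeasure_uniformOn Set.finite_univ Set.univ_nonempty
  have (i : Fin K) : IsMarkovKernel ((C.enc i).comap (fun w : ∀ i, Fin (C.M i) => w i)
      (measurable_pi_apply i)) := inferInstance
  unfold law
  infer_instance

end

end Code

/-- Achievability of a rate tuple for the interference channel with confidential messages and one
external eavesdropper, with average input cost constraints `E[cost i (X i)] ≤ P i`: for every
`ε > 0` there is a joint code of some length `n` whose rates are at least `R i - ε`, which meets the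
cost constraints, whose probability of decoding error is at most `ε` at every receiver, and for
which all unintended messages are secret from each legitimate receiver and all messages are secret
from the external eavesdropper. -/
def Achievable {K : ℕ} {𝒳 : Fin K → Type*} [∀ i, MeasurableSpace (𝒳 i)]
    {𝒴 : Option (Fin K) → Type*} [∀ j, MeasurableSpace (𝒴 j)]
    (W : Kernel (∀ i, 𝒳 i) (∀ j, 𝒴 j)) [IsMarkovKernel W]
    (cost : ∀ i, 𝒳 i → ℝ≥0) (P : Fin K → ℝ≥0) (R : Fin K → ℝ) : Prop :=
  ∀ ε : ℝ, 0 < ε → ∃ n : ℕ, 0 < n ∧ ∃ C : Code 𝒳 𝒴 n,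
    (∀ i, R i - ε ≤ C.rate i) ∧
    (∀ i, ∑ t, ∫⁻ ω, cost i (C.input i t ω) ∂(C.law W) ≤ n * P i) ∧
    (∀ i, (C.law W).real {ω | C.dec i (C.output (some i) ω) ≠ C.msg i ω} ≤ ε) ∧
    (∀ i, entropy (C.msgExcept i) (C.law W) - n * ε ≤
      condEntropy (C.msgExcept i) (C.output (some i)) (C.law W)) ∧
    entropy C.msgAll (C.law W) - n * ε ≤ condEntropy C.msgAll (C.output none) (C.law W)

end InterferenceSecrecy

namespace InterferenceSecrecy

/-! ### Finite product measures -/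

/-! The proof is wiretap coding with random codebooks. User `i` has `M i * L i` codewords with
independent letters distributed as `V i`. The message selects `L i` of them, one of these is drawn
uniformly, and its letters pass through the conditional law of the input given `V i`. With `n` coded
letters, `L i` is about `exp (n * s i)`, where `s i` is the subtracted maximum, and `M i` is about
`exp (n * r i)`, where `r i` is slightly below the target rate and cut off at zero.

Reliability. Either `r i = 0` and there is one message, or `r i + s i < I(V i; Y i)`. In the latter
case a bounded approximation of the log-likelihood ratio (`exists_bounded_test`) serves as the score
of a threshold decoder: the sent codeword scores high by the law of large numbers, and the others
are excluded by a Chernoff and union bound (`exists_decoder_of_lt`).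

Secrecy. By submodularity of entropy, the leakage about a set of messages is at most the sum over
its users `k` of the information about message `k` given the message and local randomness of every
other user (`sum_mul_log_fiberMass_le`). Each term is a soft covering problem. The true output law
is compared with a reference law, the conditional law of the output given the other users' letters;
this can only increase the information (`sum_integral_log_postRatio_le`). The mean over the `L k`
codewords of the likelihood ratio `f` then enters through `log (1 + x + y) ≤ log (1 + x) + y`. The
sent codeword gives `x`, controlled by the law of large numbers for `log f`; the others give `y`,
whose mean is at most one. As the law of large numbers is used in mean, the leakage is `o(n)`
already when the rate of local randomness equals the conditional mutual information
(`exists_leakage_bound`).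

Cost. A short run of padding letters of low cost absorbs the excess of the random codewords over the
budget (`exists_codebook_cost`).

All the requirements are normalised so that the sum of their expectations tends to zero; some
codebook then meets all of them at once (`exists_code`). -/

lemma lintegral_pi_prod {ι : Type*} [Fintype ι] {X : ι → Type*} [∀ i, MeasurableSpace (X i)]
    (μ : ∀ i, Measure (X i)) [∀ i, IsProbabilityMeasure (μ i)] {f : ∀ i, X i → ℝ≥0∞}
    (hf : ∀ i, Measurable (f i)) :
    ∫⁻ x, ∏ i, f i (x i) ∂Measure.pi μ = ∏ i, ∫⁻ x, f i x ∂μ i := by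
  have h := lintegral_prod_eq_prod_lintegral_of_indepFun Finset.univ
    (fun i (x : ∀ i, X i) => f i (x i))
    (iIndepFun_pi (μ := μ) (X := f) fun i => (hf i).aemeasurable)
    (fun i => (hf i).comp (measurable_pi_apply i))
  rw [h]
  refine Finset.prod_congr rfl fun i _ => ?_
  conv_rhs => rw [← (measurePreserving_eval μ i).map_eq]
  rw [lintegral_map (hf i) (measurable_pi_apply i)]

lemma pi_map_comp_injective {ι ι' : Type*} [Fintype ι] [Fintype ι'] {X : ι → Type*}
    [∀ i, MeasurableSpace (X i)] (μ : ∀ i, Measure (X i)) [∀ i, IsProbabilityMeasure (μ i)]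
    {e : ι' → ι} (he : Function.Injective e) :
    (Measure.pi μ).map (fun x i' => x (e i')) = Measure.pi fun i' => μ (e i') := by
  have h : iIndepFun (fun i (x : ∀ i, X i) => x i) (Measure.pi μ) :=
    iIndepFun_pi (X := fun i => (id : X i → X i)) fun i => aemeasurable_id
  have h2 := h.precomp he
  rw [iIndepFun_iff_map_fun_eq_pi_map
    (fun i => (measurable_pi_apply (e i)).aemeasurable)] at h2
  rw [h2]
  congr 1
  ext1 i
  exact (measurePreserving_eval μ (e i)).map_eq

lemma pi_withDensity {ι : Type*} [Fintype ι] {X : ι → Type*} [∀ i, MeasurableSpace (X i)]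
    (μ : ∀ i, Measure (X i)) [∀ i, IsProbabilityMeasure (μ i)] {f : ∀ i, X i → ℝ≥0∞}
    (hf : ∀ i, Measurable (f i)) [∀ i, SigmaFinite ((μ i).withDensity (f i))] :
    Measure.pi (fun i => (μ i).withDensity (f i)) =
      (Measure.pi μ).withDensity fun x => ∏ i, f i (x i) := by
  refine Measure.pi_eq fun s hs => ?_
  have hm : MeasurableSet (Set.univ.pi s) := .univ_pi hs
  rw [withDensity_apply _ hm, ← lintegral_indicator hm]
  have : ∀ x : ∀ i, X i, (Set.univ.pi s).indicator (fun x => ∏ i, f i (x i)) x =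
      ∏ i, (s i).indicator (f i) (x i) := by
    intro x
    by_cases hx : x ∈ Set.univ.pi s
    · rw [Set.indicator_of_mem hx]
      exact Finset.prod_congr rfl fun i _ => (Set.indicator_of_mem (hx i trivial) _).symm
    · rw [Set.indicator_of_notMem hx]
      simp only [Set.mem_pi, Set.mem_univ, true_implies, not_forall] at hx
      obtain ⟨i, hi⟩ := hx
      exact (Finset.prod_eq_zero (Finset.mem_univ i) (Set.indicator_of_notMem hi _)).symm
  simp_rw [this]
  rw [lintegral_pi_prod μ fun i => (hf i).indicator (hs i)]
  refine Finset.prod_congr rfl fun i _ => ?_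
  rw [lintegral_indicator (hs i), withDensity_apply _ (hs i)]

lemma prodKernel_apply {ι α : Type*} [Fintype ι] {β : ι → Type*} [MeasurableSpace α]
    [∀ i, MeasurableSpace (β i)] (κ : ∀ i, Kernel α (β i)) [∀ i, IsMarkovKernel (κ i)] (a : α) :
    prodKernel κ a = Measure.pi fun i => κ i a := rfl

/-- The coordinatewise product of Markov kernels. -/
noncomputable def piKernel {ι : Type*} [Fintype ι] {α β : ι → Type*}
    [∀ i, MeasurableSpace (α i)] [∀ i, MeasurableSpace (β i)] (κ : ∀ i, Kernel (α i) (β i))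
    [∀ i, IsMarkovKernel (κ i)] : Kernel (∀ i, α i) (∀ i, β i) :=
  prodKernel fun i => (κ i).comap (fun x : ∀ i, α i => x i) (measurable_pi_apply i)

instance {ι : Type*} [Fintype ι] {α β : ι → Type*}
    [∀ i, MeasurableSpace (α i)] [∀ i, MeasurableSpace (β i)] (κ : ∀ i, Kernel (α i) (β i))
    [∀ i, IsMarkovKernel (κ i)] : IsMarkovKernel (piKernel κ) := by
  unfold piKernel; infer_instance

lemma piKernel_apply {ι : Type*} [Fintype ι] {α β : ι → Type*}
    [∀ i, MeasurableSpace (α i)] [∀ i, MeasurableSpace (β i)] (κ : ∀ i, Kernel (α i) (β i))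
    [∀ i, IsMarkovKernel (κ i)] (x : ∀ i, α i) :
    piKernel κ x = Measure.pi fun i => κ i (x i) := rfl

lemma pi_compProd_piKernel {ι : Type*} [Fintype ι] {α β : ι → Type*}
    [∀ i, MeasurableSpace (α i)] [∀ i, MeasurableSpace (β i)] (μ : ∀ i, Measure (α i))
    [∀ i, IsProbabilityMeasure (μ i)] (κ : ∀ i, Kernel (α i) (β i)) [∀ i, IsMarkovKernel (κ i)] :
    ((Measure.pi μ) ⊗ₘ piKernel κ).map (fun p i => (p.1 i, p.2 i)) =
      Measure.pi fun i => μ i ⊗ₘ κ i := by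
  refine (Measure.pi_eq fun s hs => ?_).symm
  have hm : Measurable fun (p : (∀ i, α i) × (∀ i, β i)) i => (p.1 i, p.2 i) := by fun_prop
  rw [Measure.map_apply hm (.univ_pi hs), Measure.compProd_apply (hm (.univ_pi hs))]
  have : ∀ x : ∀ i, α i, piKernel κ x (Prod.mk x ⁻¹'
      ((fun (p : (∀ i, α i) × (∀ i, β i)) i => (p.1 i, p.2 i)) ⁻¹' Set.univ.pi s)) =
      ∏ i, κ i (x i) (Prod.mk (x i) ⁻¹' s i) := by
    intro x
    rw [piKernel_apply, ← Measure.pi_pi]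
    congr 1
  simp_rw [this]
  rw [lintegral_pi_prod μ fun i => Kernel.measurable_kernel_prodMk_left (hs i)]
  refine Finset.prod_congr rfl fun i _ => ?_
  rw [Measure.compProd_apply (hs i)]

/-- Both iterated products are curried forms of a product over pairs, and swapping the entries of a
pair is an injective reindexing. This exchanges users and times. -/
lemma pi_map_flip {ι κ : Type*} [Fintype ι] [Fintype κ] {X : ι → Type*}
    [∀ i, MeasurableSpace (X i)] (μ : ∀ i, κ → Measure (X i))
    [∀ i j, IsProbabilityMeasure (μ i j)] :
    (Measure.pi fun i => Measure.pi (μ i)).map (fun (x : ∀ i, κ → X i) j i => x i j) =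
      Measure.pi fun j => Measure.pi fun i => μ i j := by
  have h1 : (Measure.pi fun p : (_ : ι) × κ => μ p.1 p.2).map
      (MeasurableEquiv.piCurry fun i (_ : κ) => X i) = Measure.pi fun i => Measure.pi (μ i) := by
    have := Measure.infinitePi_map_piCurry (X := fun i (_ : κ) => X i) μ
    simpa only [Measure.infinitePi_eq_pi] using this
  have h2 : (Measure.pi fun p : (_ : κ) × ι => μ p.2 p.1).map
      (MeasurableEquiv.piCurry fun (_ : κ) i => X i) =
        Measure.pi fun j => Measure.pi fun i => μ i j := by
    have := Measure.infinitePi_map_piCurry (X := fun (_ : κ) i => X i) fun j i => μ i j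
    simpa only [Measure.infinitePi_eq_pi] using this
  have h3 := pi_map_comp_injective (fun p : (_ : ι) × κ => μ p.1 p.2)
    (e := fun p : (_ : κ) × ι => (⟨p.2, p.1⟩ : (_ : ι) × κ)) (by
      rintro ⟨a, b⟩ ⟨c, d⟩ h
      simp only [Sigma.mk.injEq, heq_eq_eq] at h ⊢
      exact ⟨h.2, h.1⟩)
  rw [← h1, ← h2, ← h3, Measure.map_map (by fun_prop) (by fun_prop),
    Measure.map_map (by fun_prop) (by fun_prop)]
  rfl

/-! ### The law of large numbers in mean -/

/-- The rate depends only on the number of letters in `S`, not on the block length or on the laws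
outside `S`, so padding letters do not disturb it. Decoding, leakage and cost all rest on this
bound. -/
lemma exists_l1_rate {Z : Type*} [MeasurableSpace Z] (P : Measure Z) [IsProbabilityMeasure P]
    {h : Z → ℝ} (hm : Measurable h) (hint : Integrable h P) :
    ∃ η : ℕ → ℝ≥0∞, Filter.Tendsto η Filter.atTop (nhds 0) ∧
      ∀ (N : ℕ) (S : Finset (Fin N)) (P' : Fin N → Measure Z) [∀ t, IsProbabilityMeasure (P' t)],
        (∀ t ∈ S, P' t = P) →
        ∫⁻ z, ENNReal.ofReal |∑ t ∈ S, h (z t) - S.card * ∫ x, h x ∂P| ∂Measure.pi P' ≤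
          S.card * η S.card := by
  let Pinf := Measure.infinitePi fun _ : ℕ => P
  let X : ℕ → (ℕ → Z) → ℝ := fun i z => h (z i)
  have hev : ∀ i, MeasurePreserving (fun z : ℕ → Z => z i) Pinf P :=
    fun i => ⟨measurable_pi_apply i, Measure.infinitePi_map_eval _ i⟩
  have hE : Pinf[X 0] = ∫ x, h x ∂P := by
    rw [← (hev 0).map_eq, integral_map (measurable_pi_apply 0).aemeasurable
      hm.aestronglyMeasurable]
  have hint0 : Integrable (X 0) Pinf := (hev 0).integrable_comp_of_integrable hint
  have hind : iIndepFun X Pinf := iIndepFun_infinitePi (X := fun _ => h) fun _ => hm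
  have hid : ∀ i, IdentDistrib (X i) (X 0) Pinf Pinf := by
    intro i
    refine ⟨(hm.comp (measurable_pi_apply i)).aemeasurable,
      (hm.comp (measurable_pi_apply 0)).aemeasurable, ?_⟩
    change Pinf.map (h ∘ fun z => z i) = Pinf.map (h ∘ fun z => z 0)
    rw [← Measure.map_map hm (measurable_pi_apply i), ← Measure.map_map hm (measurable_pi_apply 0),
      (hev i).map_eq, (hev 0).map_eq]
  have hlim := strong_law_Lp (μ := Pinf) le_rfl ENNReal.one_ne_top X
    (memLp_one_iff_integrable.2 hint0) (fun i j hij => hind.indepFun hij) hid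
  -- The witness is the `L¹` distance between the average of `n` independent copies and the mean.
  refine ⟨_, hlim, fun N S P' _ hP' => ?_⟩
  rcases S.eq_empty_or_nonempty with rfl | hne
  · simp
  let n := S.card
  have hn : 0 < n := hne.card_pos
  let e : Fin n → Fin N := S.orderEmbOfFin rfl
  have heS : ∀ i, e i ∈ S := fun i => S.orderEmbOfFin_mem rfl i
  let g : (Fin n → Z) → ℝ≥0∞ := fun z =>
    ENNReal.ofReal |∑ i, h (z i) - n * ∫ x, h x ∂P|
  have hg : Measurable g := by fun_prop
  have h1 : ∫⁻ z, ENNReal.ofReal |∑ t ∈ S, h (z t) - S.card * ∫ x, h x ∂P| ∂Measure.pi P' =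
      ∫⁻ z, g z ∂Measure.pi fun _ => P := by
    have hmap := pi_map_comp_injective P' (e := e) (S.orderEmbOfFin rfl).injective
    have : (fun i => P' (e i)) = fun _ => P := funext fun i => hP' _ (heS i)
    rw [this] at hmap
    rw [← hmap, lintegral_map hg (by fun_prop)]
    refine lintegral_congr fun z => ?_
    have hsum : ∑ t ∈ S, h (z t) = ∑ i, h (z (e i)) := by
      rw [← Finset.sum_coe_sort S, ← (S.orderIsoOfFin rfl).toEquiv.sum_comp]
      rfl
    rw [hsum]
  have h2 : ∫⁻ z, g z ∂(Measure.pi fun _ => P) =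
      ∫⁻ z, ENNReal.ofReal |∑ i ∈ Finset.range n, X i z - n * Pinf[X 0]| ∂Pinf := by
    have hmap : Pinf.map (fun z (i : Fin n) => z i) = Measure.pi fun _ => P := by
      have h0 : iIndepFun (fun (i : ℕ) (z : ℕ → Z) => z i) Pinf :=
        iIndepFun_infinitePi (X := fun _ => id) fun _ => measurable_id
      have h3 := h0.precomp (Fin.val_injective (n := n))
      rw [iIndepFun_iff_map_fun_eq_pi_map
        (fun i => (measurable_pi_apply _).aemeasurable)] at h3
      rw [h3]
      congr 1
      ext1 i
      exact (hev i).map_eq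
    rw [← hmap, lintegral_map hg (by fun_prop), hE]
    refine lintegral_congr fun z => ?_
    simp only [g, X, Finset.sum_range]
  rw [h1, h2, eLpNorm_one_eq_lintegral_enorm, ← lintegral_const_mul' _ _ (by simp)]
  refine lintegral_mono fun z => ?_
  rw [Real.enorm_eq_ofReal_abs, ← ENNReal.ofReal_natCast,
    ← ENNReal.ofReal_mul (by positivity)]
  refine ENNReal.ofReal_le_ofReal (le_of_eq ?_)
  have : (n : ℝ) ≠ 0 := by positivity
  change _ = (n : ℝ) * |(n : ℝ)⁻¹ • (∑ i ∈ Finset.range n, X i z) - Pinf[X 0]|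
  rw [← abs_of_pos (show (0 : ℝ) < n by positivity), ← abs_mul,
    abs_of_pos (show (0 : ℝ) < n by positivity)]
  congr 1
  simp only [smul_eq_mul]
  field_simp

/-! ### Entropy inequalities on finite sets -/

open Classical in
/-- The `p`-mass of the fibre of `f` through `a`. -/
noncomputable def fiberMass {A α : Type*} [Fintype A] (p : A → ℝ) (f : A → α) (a : A) : ℝ :=
  ∑ b, if f b = f a then p b else 0

section fiberMass

variable {A α β γ : Type*} [Fintype A] {p : A → ℝ}

lemma fiberMass_eq_sum_ite (f : A → α) (a : A) [∀ b, Decidable (f b = f a)] :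
    fiberMass p f a = ∑ b, if f b = f a then p b else 0 := by
  unfold fiberMass
  congr!

lemma fiberMass_eq_sum_filter (f : A → α) (a : A) [DecidablePred fun b => f b = f a] :
    fiberMass p f a = ∑ b with f b = f a, p b := by
  rw [fiberMass_eq_sum_ite, Finset.sum_filter]

lemma fiberMass_congr {f : A → α} {g : A → β} (h : ∀ a b, f b = f a ↔ g b = g a) :
    fiberMass p f = fiberMass p g := by
  classical
  ext a
  simp only [fiberMass_eq_sum_ite, h a]

lemma fiberMass_eq_of_eq {f : A → α} {a b : A} (h : f a = f b) :
    fiberMass p f a = fiberMass p f b := by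
  classical
  simp only [fiberMass_eq_sum_ite, h]

lemma le_fiberMass (hp : ∀ a, 0 ≤ p a) (f : A → α) (a : A) : p a ≤ fiberMass p f a := by
  classical
  have := Finset.single_le_sum (f := fun b => if f b = f a then p b else 0)
    (fun b _ => by split_ifs <;> simp [hp b]) (Finset.mem_univ a)
  simpa [fiberMass] using this

lemma fiberMass_nonneg (hp : ∀ a, 0 ≤ p a) (f : A → α) (a : A) : 0 ≤ fiberMass p f a :=
  (hp a).trans (le_fiberMass hp f a)

/-- As `Y` determines `Z`, the ratio is `p(x | z) / p(x | y)`. Its mean is computed by writing the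
two masses in the numerator as sums over `b` and `c` and summing over `a` before them. Only an
inequality results, because masses may vanish and the inverse of zero is zero. -/
lemma sum_mul_fiberMass_ratio_le (hp : ∀ a, 0 ≤ p a) (X : A → α) (Y : A → β) (Z : A → γ)
    (hYZ : ∀ a b, Y a = Y b → Z a = Z b) :
    ∑ a, p a * (fiberMass p (fun a => (X a, Z a)) a * fiberMass p Y a /
      (fiberMass p (fun a => (X a, Y a)) a * fiberMass p Z a)) ≤ ∑ a, p a := by
  classical
  have hinner : ∀ b c, ∑ a, (if (X b, Z b) = (X a, Z a) then (1 : ℝ) else 0) *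
      (if Y c = Y a then 1 else 0) *
        (p a / (fiberMass p (fun a => (X a, Y a)) a * fiberMass p Z a)) ≤
      (if Z b = Z c then 1 else 0) * (fiberMass p Z c)⁻¹ := by
    intro b c
    by_cases hex : ∃ a0, X b = X a0 ∧ Y c = Y a0 ∧ Z b = Z c
    · obtain ⟨a0, hX0, hY0, hZ⟩ := hex
      rw [if_pos hZ, one_mul]
      have : ∀ a, (if (X b, Z b) = (X a, Z a) then (1 : ℝ) else 0) *
          (if Y c = Y a then 1 else 0) *
            (p a / (fiberMass p (fun a => (X a, Y a)) a * fiberMass p Z a)) =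
          (if (X a, Y a) = (X a0, Y a0) then p a else 0) *
            ((fiberMass p (fun a => (X a, Y a)) a0)⁻¹ * (fiberMass p Z c)⁻¹) := by
        intro a
        by_cases h : (X a, Y a) = (X a0, Y a0)
        · have hXa : X a = X a0 := congrArg Prod.fst h
          have hYa : Y a = Y a0 := congrArg Prod.snd h
          have hZa : Z c = Z a := hYZ _ _ (hY0.trans hYa.symm)
          rw [if_pos h, if_pos (Prod.ext (hX0.trans hXa.symm) (hZ.trans hZa)),
            if_pos (hY0.trans hYa.symm),
            fiberMass_eq_of_eq (f := fun a => (X a, Y a)) h, fiberMass_eq_of_eq hZa]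
          field_simp
        · rw [if_neg h, zero_mul]
          by_cases h1 : Y c = Y a
          · have : (X b, Z b) ≠ (X a, Z a) := fun h2 =>
              h (Prod.ext ((congrArg Prod.fst h2).symm.trans hX0) (h1.symm.trans hY0))
            rw [if_neg this]; ring
          · rw [if_neg h1]; ring
      simp_rw [this]
      rw [← Finset.sum_mul]
      rw [← fiberMass_eq_sum_ite (fun a => (X a, Y a)) a0, ← mul_assoc]
      exact mul_le_of_le_one_left (inv_nonneg.2 (fiberMass_nonneg hp _ _)) mul_inv_le_one
    · refine (le_of_eq (Finset.sum_eq_zero fun a _ => ?_)).trans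
        (mul_nonneg (by split_ifs <;> simp) (inv_nonneg.2 (fiberMass_nonneg hp _ _)))
      by_cases h1 : (X b, Z b) = (X a, Z a)
      · by_cases h2 : Y c = Y a
        · exact absurd ⟨a, congrArg Prod.fst h1, h2,
            (congrArg Prod.snd h1).trans (hYZ _ _ h2).symm⟩ hex
        · rw [if_neg h2]; ring
      · rw [if_neg h1]; ring
  calc _ = ∑ a, ∑ b, ∑ c, p b * p c * ((if (X b, Z b) = (X a, Z a) then (1 : ℝ) else 0) *
      (if Y c = Y a then 1 else 0) *
        (p a / (fiberMass p (fun a => (X a, Y a)) a * fiberMass p Z a))) := by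
        refine Finset.sum_congr rfl fun a _ => ?_
        rw [fiberMass_eq_sum_ite (fun a => (X a, Z a)) a, fiberMass_eq_sum_ite Y a,
          Finset.sum_mul_sum, Finset.sum_div, Finset.mul_sum]
        refine Finset.sum_congr rfl fun b _ => ?_
        rw [Finset.sum_div, Finset.mul_sum]
        refine Finset.sum_congr rfl fun c _ => ?_
        split_ifs <;> ring
    _ = ∑ c, ∑ b, p b * p c * ∑ a, ((if (X b, Z b) = (X a, Z a) then (1 : ℝ) else 0) *
      (if Y c = Y a then 1 else 0) *
        (p a / (fiberMass p (fun a => (X a, Y a)) a * fiberMass p Z a))) := by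
        simp_rw [Finset.mul_sum]
        exact Finset.sum_comm.trans
          ((Finset.sum_congr rfl fun b _ => Finset.sum_comm).trans Finset.sum_comm)
    _ ≤ ∑ c, ∑ b, p b * p c * ((if Z b = Z c then 1 else 0) * (fiberMass p Z c)⁻¹) :=
        Finset.sum_le_sum fun c _ => Finset.sum_le_sum fun b _ =>
          mul_le_mul_of_nonneg_left (hinner b c) (mul_nonneg (hp b) (hp c))
    _ = ∑ c, p c * (fiberMass p Z c * (fiberMass p Z c)⁻¹) := by
        refine Finset.sum_congr rfl fun c _ => ?_
        rw [← mul_assoc]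
        conv_rhs => enter [1]; rw [fiberMass_eq_sum_ite Z c]
        rw [Finset.mul_sum, Finset.sum_mul]
        refine Finset.sum_congr rfl fun b _ => ?_
        split_ifs <;> ring
    _ ≤ ∑ c, p c := Finset.sum_le_sum fun c _ => mul_le_of_le_one_right (hp c) mul_inv_le_one

/-- This is `H(X | Y) ≤ H(X | Z)` for `Z` a function of `Y`: apply `log t ≤ t - 1` to the ratio of
the preceding lemma. -/
lemma sum_mul_log_fiberMass_submodular (hp : ∀ a, 0 ≤ p a) (X : A → α) (Y : A → β) (Z : A → γ)
    (hYZ : ∀ a b, Y a = Y b → Z a = Z b) :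
    ∑ a, p a * (Real.log (fiberMass p (fun a => (X a, Z a)) a) - Real.log (fiberMass p Z a)) ≤
      ∑ a, p a * (Real.log (fiberMass p (fun a => (X a, Y a)) a) -
        Real.log (fiberMass p Y a)) := by
  rw [← sub_nonpos, ← Finset.sum_sub_distrib]
  have h := sum_mul_fiberMass_ratio_le hp X Y Z hYZ
  rw [← sub_nonpos, ← Finset.sum_sub_distrib] at h
  refine (Finset.sum_le_sum fun a _ => ?_).trans h
  rcases (hp a).eq_or_lt with h0 | hpos
  · simp [← h0]
  have h1' : 0 < fiberMass p (fun a => (X a, Z a)) a := hpos.trans_le (le_fiberMass hp _ a)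
  have h2 : 0 < fiberMass p Y a := hpos.trans_le (le_fiberMass hp _ a)
  have h3 : 0 < fiberMass p (fun a => (X a, Y a)) a := hpos.trans_le (le_fiberMass hp _ a)
  have h4 : 0 < fiberMass p Z a := hpos.trans_le (le_fiberMass hp _ a)
  have hl := Real.log_le_sub_one_of_pos
    (div_pos (mul_pos h1' h2) (mul_pos h3 h4))
  rw [Real.log_div (mul_pos h1' h2).ne' (mul_pos h3 h4).ne', Real.log_mul h1'.ne' h2.ne',
    Real.log_mul h3.ne' h4.ne'] at hl
  nlinarith

end fiberMass

/-! ### Chain rule over the users, and sums over the index of one user -/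

section messages

variable {ι : Type*} [Fintype ι] [DecidableEq ι] {α β : ι → Type*} [∀ k, Fintype (α k)]
  [∀ k, Fintype (β k)]

/-- In `a k` the first entry is a message and the second is local randomness. Users are added one at
a time, and each new term of the chain rule is weakened by conditioning on the full pairs of all
other users. This decouples the users: the leakage about one message can be studied with all other
codewords known. -/
lemma sum_mul_log_fiberMass_le {p : (∀ k, α k × β k) → ℝ} (hp : ∀ a, 0 ≤ p a)
    (hp1 : ∑ a, p a = 1) (S : Finset ι) :
    ∑ a, p a * Real.log (fiberMass p (fun a (k : S) => (a k).1) a) ≤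
      ∑ k ∈ S, ∑ a, p a * (Real.log (fiberMass p
        (fun a => ((a k).1, fun j : {j // j ≠ k} => a j)) a) -
          Real.log (fiberMass p (fun a (j : {j // j ≠ k}) => a j) a)) := by
  induction S using Finset.induction_on with
  | empty =>
    simp only [Finset.sum_empty]
    refine le_of_eq (Finset.sum_eq_zero fun a _ => ?_)
    have : fiberMass p (fun (a : ∀ k, α k × β k) (k : (∅ : Finset ι)) => (a k).1) a = 1 := by
      classical
      rw [fiberMass_eq_sum_ite, ← hp1]
      refine Finset.sum_congr rfl fun b _ => if_pos (funext fun k => ?_)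
      exact absurd k.2 (Finset.notMem_empty _)
    rw [this, Real.log_one, mul_zero]
  | insert k S hk ih =>
    rw [Finset.sum_insert hk]
    have h := sum_mul_log_fiberMass_submodular hp (fun a => (a k).1)
      (fun a (j : {j // j ≠ k}) => a j) (fun a (k : S) => (a k).1) (by
        intro a b hab
        ext1 j
        have := congrFun hab ⟨j, fun h => hk (h ▸ j.2)⟩
        exact congrArg Prod.fst this)
    have h2 : fiberMass p (fun a => ((a k).1, fun k : S => (a k).1)) =
        fiberMass p (fun a (k : (insert k S : Finset ι)) => (a k).1) := by
      refine fiberMass_congr fun a b => ⟨fun hab => funext fun j => ?_, fun hab => Prod.ext ?_ ?_⟩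
      · rcases Finset.mem_insert.1 j.2 with hj | hj
        · obtain ⟨j, hj'⟩ := j
          simp only at hj
          subst hj
          exact (Prod.mk.inj hab).1
        · exact congrFun (congrArg Prod.snd hab) ⟨j, hj⟩
      · exact congrFun hab ⟨k, Finset.mem_insert_self k S⟩
      · exact funext fun j => congrFun hab ⟨j, Finset.mem_insert_of_mem j.2⟩
    rw [h2] at h
    simp_rw [mul_sub, Finset.sum_sub_distrib] at h ih ⊢
    linarith

lemma sum_negMulLog_fiber {A B : Type*} [Fintype A] [Fintype B] [DecidableEq B] (p : A → ℝ)
    (G : A → B) :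
    ∑ b, Real.negMulLog (∑ a, if G a = b then p a else 0) =
      - ∑ a, p a * Real.log (fiberMass p G a) := by
  have : ∀ b, Real.negMulLog (∑ a, if G a = b then p a else 0) =
      - ∑ a, if G a = b then p a * Real.log (fiberMass p G a) else 0 := by
    intro b
    rw [Real.negMulLog, neg_mul, Finset.sum_mul]
    congr 1
    refine Finset.sum_congr rfl fun a _ => ?_
    split_ifs with h
    · subst h
      rw [fiberMass_eq_sum_ite]
    · rw [zero_mul]
  simp_rw [this]
  rw [Finset.sum_neg_distrib, Finset.sum_comm]
  simp

lemma fiberMass_eq_sum_update (p : (∀ k, α k × β k) → ℝ) (k : ι) (a : ∀ k, α k × β k) :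
    fiberMass p (fun a (j : {j // j ≠ k}) => a j) a = ∑ b, p (Function.update a k b) := by
  classical
  rw [fiberMass_eq_sum_filter]
  refine Finset.sum_bij' (fun b _ => b k) (fun b _ => Function.update a k b) ?_ ?_ ?_ ?_ ?_
  · simp
  · intro b _
    simp only [Finset.mem_filter, Finset.mem_univ, true_and]
    ext1 j
    simp [j.2]
  · intro b hb
    simp only [Finset.mem_filter, Finset.mem_univ, true_and] at hb
    ext1 j
    by_cases hj : j = k
    · subst hj; simp
    · rw [Function.update_of_ne hj]
      exact (congrFun hb ⟨j, hj⟩).symm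
  · simp
  · intro b hb
    simp only [Finset.mem_filter, Finset.mem_univ, true_and] at hb
    congr 1
    ext1 j
    by_cases hj : j = k
    · subst hj; simp
    · rw [Function.update_of_ne hj]
      exact congrFun hb ⟨j, hj⟩

lemma fiberMass_eq_sum_update_snd (p : (∀ k, α k × β k) → ℝ) (k : ι) (a : ∀ k, α k × β k) :
    fiberMass p (fun a => ((a k).1, fun j : {j // j ≠ k} => a j)) a =
      ∑ l, p (Function.update a k ((a k).1, l)) := by
  classical
  rw [fiberMass_eq_sum_filter]
  refine Finset.sum_bij' (fun b _ => (b k).2) (fun l _ => Function.update a k ((a k).1, l))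
    ?_ ?_ ?_ ?_ ?_
  · simp
  · intro b _
    simp only [Finset.mem_filter, Finset.mem_univ, true_and]
    refine Prod.ext (by simp) (funext fun j => by simp [j.2])
  · intro b hb
    simp only [Finset.mem_filter, Finset.mem_univ, true_and] at hb
    ext1 j
    by_cases hj : j = k
    · subst hj
      rw [Function.update_self]
      exact Prod.ext (congrArg Prod.fst hb).symm rfl
    · rw [Function.update_of_ne hj]
      exact (congrFun (congrArg Prod.snd hb) ⟨j, hj⟩).symm
  · simp
  · intro b hb
    simp only [Finset.mem_filter, Finset.mem_univ, true_and] at hb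
    congr 1
    ext1 j
    by_cases hj : j = k
    · subst hj
      rw [Function.update_self]
      exact Prod.ext (Prod.mk.inj hb).1 rfl
    · rw [Function.update_of_ne hj]
      exact congrFun (congrArg Prod.snd hb) ⟨j, hj⟩

lemma sum_sum_update {k : ι} {E : Type*} [AddCommMonoid E] (g : (∀ k, α k × β k) → E) :
    ∑ a : ∀ k, α k × β k, ∑ b, g (Function.update a k b) =
      Fintype.card (α k × β k) • ∑ a, g a := by
  classical
  have : Fintype.card (α k × β k) • ∑ a, g a = ∑ a, ∑ _b : α k × β k, g a := by
    simp [Finset.sum_const, Finset.smul_sum]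
  rw [this, ← Fintype.sum_prod_type', ← Fintype.sum_prod_type']
  -- Exchanging the `k`-th coordinate with the fresh value is an involution of the pairs.
  refine Fintype.sum_equiv
    ⟨fun x => (Function.update x.1 k x.2, x.1 k), fun x => (Function.update x.1 k x.2, x.1 k),
      fun x => ?_, fun x => ?_⟩ _ _ fun x => rfl
  · simp
  · simp

end messages

/-! ### Leakage bounds for uniformly distributed messages -/

section leakage

set_option linter.unusedSectionVars false

variable {ι : Type*} [Fintype ι] [DecidableEq ι] {α β : ι → Type*} [∀ k, Fintype (α k)]
  [∀ k, Fintype (β k)]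

/-- If `φ a` is proportional to a probability of `a`, the ratio of the conditional probability of
the message `(a k).1` given all coordinates of `a` but `k` to its uniform probability. -/
noncomputable def postRatio (φ : (∀ k, α k × β k) → ℝ) (k : ι) (a : ∀ k, α k × β k) : ℝ :=
  Fintype.card (α k) * (∑ l, φ (Function.update a k ((a k).1, l))) /
    ∑ b, φ (Function.update a k b)

/-- At a fixed output, `φ` divided by the number of tuples is the posterior of the index tuple, and
the left side is the divergence of the posterior of the messages in `S` from the uniform law. The
logarithm of the cardinality splits over `S` and turns each conditional probability of the chain
rule into a `postRatio`. -/
lemma log_card_sub_entropy_le [∀ k, Nonempty (α k)] [∀ k, Nonempty (β k)]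
    {φ : (∀ k, α k × β k) → ℝ} (hφ : ∀ a, 0 ≤ φ a)
    (hsum : ∑ a, φ a = Fintype.card (∀ k, α k × β k)) {U : Type*} [Fintype U] [DecidableEq U]
    (G : (∀ k, α k) → U) (S : Finset ι) (hG : ∀ w w', G w = G w' ↔ ∀ k ∈ S, w k = w' k)
    (hcard : Fintype.card U = ∏ k ∈ S, Fintype.card (α k)) :
    Real.log (Fintype.card U) - ∑ u, Real.negMulLog (∑ a : ∀ k, α k × β k,
        if G (fun k => (a k).1) = u then φ a / Fintype.card (∀ k, α k × β k) else 0) ≤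
      ∑ k ∈ S, ∑ a, φ a * Real.log (postRatio φ k a) / Fintype.card (∀ k, α k × β k) := by
  set c : ℝ := (Fintype.card (∀ k, α k × β k) : ℝ) with hc
  have hcpos : 0 < c := by rw [hc]; exact_mod_cast Fintype.card_pos
  have hp : ∀ a, 0 ≤ φ a / c := fun a => div_nonneg (hφ a) hcpos.le
  have hp1 : ∑ a, φ a / c = 1 := by rw [← Finset.sum_div, hsum, div_self hcpos.ne']
  have h := sum_mul_log_fiberMass_le hp hp1 S
  rw [sum_negMulLog_fiber (fun a => φ a / c) (fun a => G fun k => (a k).1)]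
  have h1 : fiberMass (fun a => φ a / c) (fun a => G fun k => (a k).1) =
      fiberMass (fun a => φ a / c) (fun a (k : S) => (a k).1) := by
    refine fiberMass_congr fun a b => ?_
    rw [hG]
    exact ⟨fun h => funext fun k => h k k.2, fun h k hk => congrFun h ⟨k, hk⟩⟩
  have h2 : Real.log (Fintype.card U) = ∑ k ∈ S, ∑ a, φ a / c * Real.log (Fintype.card (α k)) := by
    simp_rw [← Finset.sum_mul, hp1, one_mul]
    rw [hcard]
    push_cast
    exact Real.log_prod fun k _ => by positivity
  rw [h1, h2, sub_neg_eq_add]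
  refine (add_le_add_right h _).trans (le_of_eq ?_)
  rw [← Finset.sum_add_distrib]
  refine Finset.sum_congr rfl fun k _ => ?_
  rw [← Finset.sum_add_distrib]
  refine Finset.sum_congr rfl fun a _ => ?_
  rcases (hφ a).eq_or_lt with h0 | hpos
  · simp [← h0]
  have h3 : 0 < fiberMass (fun a => φ a / c)
      (fun a => ((a k).1, fun j : {j // j ≠ k} => a j)) a :=
    (div_pos hpos hcpos).trans_le (le_fiberMass hp _ a)
  have h4 : 0 < fiberMass (fun a => φ a / c) (fun a (j : {j // j ≠ k}) => a j) a :=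
    (div_pos hpos hcpos).trans_le (le_fiberMass hp _ a)
  have hcα : (0 : ℝ) < Fintype.card (α k) := by exact_mod_cast Fintype.card_pos
  rw [← mul_add, mul_div_right_comm, ← Real.log_div h3.ne' h4.ne',
    ← Real.log_mul hcα.ne' (div_pos h3 h4).ne']
  congr 2
  rw [fiberMass_eq_sum_update_snd, fiberMass_eq_sum_update, postRatio, ← Finset.sum_div,
    ← Finset.sum_div, div_div_div_cancel_right₀ hcpos.ne', mul_div_assoc]

lemma sum_snd_le_sum {φ : (∀ k, α k × β k) → ℝ} (hφ : ∀ a, 0 ≤ φ a) (k : ι)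
    (a : ∀ k, α k × β k) :
    ∑ l, φ (Function.update a k ((a k).1, l)) ≤ ∑ b, φ (Function.update a k b) := by
  rw [Fintype.sum_prod_type]
  exact Finset.single_le_sum (f := fun w => ∑ l, φ (Function.update a k (w, l)))
    (fun w _ => Finset.sum_nonneg fun _ _ => hφ _) (Finset.mem_univ _)

lemma le_sum_snd {φ : (∀ k, α k × β k) → ℝ} (hφ : ∀ a, 0 ≤ φ a) (k : ι)
    (a : ∀ k, α k × β k) :
    φ a ≤ ∑ l, φ (Function.update a k ((a k).1, l)) := by
  have := Finset.single_le_sum (f := fun l => φ (Function.update a k ((a k).1, l)))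
    (fun w _ => hφ _) (Finset.mem_univ (a k).2)
  simpa using this

/-- The dominating function is a finite sum of densities, which makes the integrand integrable. Both
signs follow from `log t ≤ t - 1`, applied to the ratio and to its inverse. -/
lemma abs_mul_log_postRatio_le {φ : (∀ k, α k × β k) → ℝ} (hφ : ∀ a, 0 ≤ φ a) (k : ι)
    (a : ∀ k, α k × β k) :
    |φ a * Real.log (postRatio φ k a)| ≤
      Fintype.card (α k) * ∑ b, φ (Function.update a k b) := by
  rcases (hφ a).eq_or_lt with h0 | hpos
  · rw [← h0, zero_mul, abs_zero]
    exact mul_nonneg (Nat.cast_nonneg _) (Finset.sum_nonneg fun _ _ => hφ _)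
  have hu := le_sum_snd hφ k a
  have huv := sum_snd_le_sum hφ k a
  set u := ∑ l, φ (Function.update a k ((a k).1, l)) with hu'
  set v := ∑ b, φ (Function.update a k b) with hv'
  have hupos : 0 < u := hpos.trans_le hu
  have hvpos : 0 < v := hupos.trans_le huv
  have : Nonempty (α k) := ⟨(a k).1⟩
  have hc : (1 : ℝ) ≤ Fintype.card (α k) := by exact_mod_cast Fintype.card_pos
  have hr : 0 < postRatio φ k a := div_pos (mul_pos (by linarith) hupos) hvpos
  rw [abs_le]
  constructor
  · have h1 := Real.log_le_sub_one_of_pos (inv_pos.2 hr)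
    rw [Real.log_inv] at h1
    have h2 : (postRatio φ k a)⁻¹ ≤ v / u := by
      rw [postRatio, ← hu', ← hv', inv_div]
      exact div_le_div_of_nonneg_left hvpos.le hupos (le_mul_of_one_le_left hupos.le hc)
    have h3 : φ a * (v / u) ≤ v := by
      rw [mul_div_assoc', div_le_iff₀ hupos, mul_comm]
      exact mul_le_mul_of_nonneg_left hu hvpos.le
    have h4 : φ a * (postRatio φ k a)⁻¹ ≤ φ a * (v / u) := mul_le_mul_of_nonneg_left h2 (hφ a)
    have h5 : v ≤ Fintype.card (α k) * v := le_mul_of_one_le_left hvpos.le hc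
    have h6 : φ a * -Real.log (postRatio φ k a) ≤ φ a * ((postRatio φ k a)⁻¹ - 1) :=
      mul_le_mul_of_nonneg_left h1 (hφ a)
    linarith [mul_sub (φ a) (postRatio φ k a)⁻¹ 1]
  · have h1 := Real.log_le_sub_one_of_pos hr
    have h2 : postRatio φ k a ≤ Fintype.card (α k) := by
      rw [postRatio, ← hu', ← hv', div_le_iff₀ hvpos]
      exact mul_le_mul_of_nonneg_left huv (by linarith)
    calc φ a * Real.log (postRatio φ k a) ≤ φ a * Fintype.card (α k) :=
          mul_le_mul_of_nonneg_left (by linarith) (hφ a)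
      _ ≤ _ := by rw [mul_comm]; exact mul_le_mul_of_nonneg_left (hu.trans huv) (by linarith)

/-! ### Densities relative to a reference output law -/

lemma withDensity_finset_sum {B : Type*} [MeasurableSpace B] {I : Type*} (s : Finset I)
    (ν : Measure B) {f : I → B → ℝ≥0} (hf : ∀ i, Measurable (f i)) :
    ν.withDensity (fun y => ((∑ i ∈ s, f i y : ℝ≥0) : ℝ≥0∞)) =
      ∑ i ∈ s, ν.withDensity fun y => (f i y : ℝ≥0∞) := by
  classical
  induction s using Finset.induction_on with
  | empty => simp
  | insert i s hi ih =>
    simp_rw [Finset.sum_insert hi, ENNReal.coe_add]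
    rw [← ih]
    exact withDensity_add_left (hf i).coe_nnreal_ennreal _

/-- Each quotient is the derivative of the smaller measure with respect to the larger one, so it
does not depend on the base measure. Posteriors may thus be computed from densities relative to `q`
instead of the true output law. -/
lemma withDensity_ratio_ae_eq {B : Type*} [MeasurableSpace B] {ν q : Measure B}
    {h₁ h₂ k₁ k₂ : B → ℝ≥0} (mh₁ : Measurable h₁) (mh₂ : Measurable h₂) (mk₁ : Measurable k₁)
    (mk₂ : Measurable k₂) (hh : ∀ y, h₁ y ≤ h₂ y) (hk : ∀ y, k₁ y ≤ k₂ y)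
    (e₁ : ν.withDensity (fun y => (h₁ y : ℝ≥0∞)) = q.withDensity fun y => (k₁ y : ℝ≥0∞))
    (e₂ : ν.withDensity (fun y => (h₂ y : ℝ≥0∞)) = q.withDensity fun y => (k₂ y : ℝ≥0∞))
    [IsFiniteMeasure (ν.withDensity fun y => (h₂ y : ℝ≥0∞))] :
    ∀ᵐ y ∂ν.withDensity (fun y => (h₂ y : ℝ≥0∞)), h₁ y / h₂ y = k₁ y / k₂ y := by
  have key : ∀ {ν : Measure B} {h₁ h₂ : B → ℝ≥0}, Measurable h₁ → Measurable h₂ →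
      (∀ y, h₁ y ≤ h₂ y) → (ν.withDensity fun y => (h₂ y : ℝ≥0∞)).withDensity
        (fun y => ((h₁ y / h₂ y : ℝ≥0) : ℝ≥0∞)) = ν.withDensity fun y => (h₁ y : ℝ≥0∞) := by
    intro ν h₁ h₂ m₁ m₂ hle
    have hd : Measurable fun y => ((h₁ y / h₂ y : ℝ≥0) : ℝ≥0∞) :=
      (m₁.div m₂).coe_nnreal_ennreal
    rw [← withDensity_mul _ m₂.coe_nnreal_ennreal hd]
    congr 1
    ext y
    simp only [Pi.mul_apply, ← ENNReal.coe_mul]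
    congr 1
    by_cases h0 : h₂ y = 0
    · have : h₁ y = 0 := le_antisymm (h0 ▸ hle y) zero_le
      simp [h0, this]
    · rw [mul_div_cancel₀ _ h0]
  have h1 := key (ν := ν) mh₁ mh₂ hh
  have h2 := key (ν := q) mk₁ mk₂ hk
  rw [← e₂, ← e₁, ← h1] at h2
  have h3 := (withDensity_eq_iff (mh₁.div mh₂).coe_nnreal_ennreal.aemeasurable
    (mk₁.div mk₂).coe_nnreal_ennreal.aemeasurable (by
      refine ne_top_of_le_ne_top (measure_ne_top
        (ν.withDensity fun y => (h₂ y : ℝ≥0∞)) Set.univ) ?_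
      rw [← lintegral_one]
      refine lintegral_mono fun y => ?_
      exact ENNReal.coe_le_one_iff.2 (div_le_one_of_le₀ (hh y) zero_le))).1 h2.symm
  filter_upwards [h3] with y hy
  exact_mod_cast hy

variable {B : Type*} [MeasurableSpace B]

/-- The mean of the densities `F` over the local randomness `l` of user `k`. -/
noncomputable def avgDensity (F : (∀ k, α k × β k) → B → ℝ≥0) (k : ι) (a : ∀ k, α k × β k)
    (y : B) : ℝ≥0 :=
  (∑ l, F (Function.update a k ((a k).1, l)) y) / Fintype.card (β k)

lemma measurable_postRatio {φ : (∀ k, α k × β k) → B → ℝ≥0} (hφm : ∀ a, Measurable (φ a))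
    (k : ι) (a : ∀ k, α k × β k) :
    Measurable fun y => postRatio (fun a => (φ a y : ℝ)) k a := by
  unfold postRatio
  fun_prop

lemma measurable_avgDensity {F : (∀ k, α k × β k) → B → ℝ≥0} (hF : ∀ a, Measurable (F a))
    (k : ι) (a : ∀ k, α k × β k) : Measurable (avgDensity F k a) := by
  unfold avgDensity
  fun_prop

lemma integrable_coe_density {lam ν : Measure B} [IsFiniteMeasure lam] {φ : B → ℝ≥0}
    (hφm : Measurable φ) (hφ : lam = ν.withDensity fun y => (φ y : ℝ≥0∞)) :
    Integrable (fun y => (φ y : ℝ)) ν := by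
  refine ⟨hφm.coe_nnreal_real.aestronglyMeasurable, ?_⟩
  rw [hasFiniteIntegral_iff_ofReal (.of_forall fun y => NNReal.coe_nonneg _)]
  have : ∫⁻ y, (φ y : ℝ≥0∞) ∂ν = lam Set.univ := by
    rw [hφ, withDensity_apply _ .univ, setLIntegral_univ]
  simp only [ENNReal.ofReal_coe_nnreal, this]
  exact measure_lt_top _ _

lemma integrable_mul_log_postRatio {lam : (∀ k, α k × β k) → Measure B}
    [∀ a, IsProbabilityMeasure (lam a)] {ν : Measure B} {φ : (∀ k, α k × β k) → B → ℝ≥0}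
    (hφm : ∀ a, Measurable (φ a)) (hφ : ∀ a, lam a = ν.withDensity fun y => (φ a y : ℝ≥0∞))
    (k : ι) (a : ∀ k, α k × β k) :
    Integrable (fun y => (φ a y : ℝ) * Real.log (postRatio (fun a => (φ a y : ℝ)) k a)) ν := by
  have hb : Integrable (fun y => (Fintype.card (α k) : ℝ) *
      ∑ b, (φ (Function.update a k b) y : ℝ)) ν :=
    (integrable_finsetSum _ fun b _ => integrable_coe_density (hφm _) (hφ _)).const_mul _
  refine hb.mono' ((hφm a).coe_nnreal_real.mul
    (Real.measurable_log.comp (measurable_postRatio hφm k a))).aestronglyMeasurable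
    (.of_forall fun y => ?_)
  rw [Real.norm_eq_abs]
  exact abs_mul_log_postRatio_le (φ := fun a => (φ a y : ℝ)) (fun _ => NNReal.coe_nonneg _) k a

/-- Information is at most the mean divergence from any reference output law, here one that ignores
the index of user `k`. The ratio `postRatio` factors as the mean of `F` over the local randomness
times `xinv`, and `log t ≤ t - 1` removes the second factor in the mean. The `1 +` keeps the
remaining integrand nonnegative, so that it can be handled in `ℝ≥0∞`. -/
lemma sum_integral_log_postRatio_le [∀ k, Nonempty (α k)] [∀ k, Nonempty (β k)]
    {lam q : (∀ k, α k × β k) → Measure B} [∀ a, IsProbabilityMeasure (lam a)]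
    [∀ a, IsProbabilityMeasure (q a)] {ν : Measure B} {φ F : (∀ k, α k × β k) → B → ℝ≥0}
    (hφm : ∀ a, Measurable (φ a)) (hFm : ∀ a, Measurable (F a))
    (hφ : ∀ a, lam a = ν.withDensity fun y => (φ a y : ℝ≥0∞)) (k : ι)
    (hF : ∀ a, lam a = (q a).withDensity fun y => (F a y : ℝ≥0∞))
    (hq : ∀ a b, q (Function.update a k b) = q a)
    (hfin : ∑ a, ∫⁻ y, ENNReal.ofReal (Real.log (1 + avgDensity F k a y)) ∂lam a ≠ ∞) :
    ∑ a, ∫ y, Real.log (postRatio (fun a => (φ a y : ℝ)) k a) ∂lam a ≤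
      (∑ a, ∫⁻ y, ENNReal.ofReal (Real.log (1 + avgDensity F k a y)) ∂lam a).toReal := by
  let xinv : (∀ k, α k × β k) → B → ℝ≥0 := fun a y =>
    Fintype.card (α k × β k) / ∑ b, F (Function.update a k b) y
  have hxm : ∀ a, Measurable (xinv a) := fun a => by fun_prop
  have hfin' : ∀ a, ∫⁻ y, ENNReal.ofReal (Real.log (1 + avgDensity F k a y)) ∂lam a ≠ ∞ :=
    fun a => ((ENNReal.sum_ne_top).1 hfin) a (Finset.mem_univ a)
  have hlognn : ∀ a y, 0 ≤ Real.log (1 + avgDensity F k a y) := fun a y =>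
    Real.log_nonneg (by simp)
  have hlogm : ∀ a, Measurable fun y => Real.log (1 + avgDensity F k a y) := fun a =>
    Real.measurable_log.comp (measurable_const.add (measurable_avgDensity hFm k a).coe_nnreal_real)
  have hlogi : ∀ a, Integrable (fun y => Real.log (1 + avgDensity F k a y)) (lam a) := by
    intro a
    refine ⟨(hlogm a).aestronglyMeasurable, ?_⟩
    rw [hasFiniteIntegral_iff_ofReal (.of_forall (hlognn a))]
    exact (hfin' a).lt_top
  -- Averaging over the `k`-th coordinate turns `lam` into an average whose density cancels `xinv`,
  -- leaving the mass of `q a` where some `F` is nonzero.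
  have hsumx : ∑ a, ∫⁻ y, (xinv a y : ℝ≥0∞) ∂lam a ≤ Fintype.card (∀ k, α k × β k) := by
    have hcI : (Fintype.card (α k × β k) : ℝ≥0∞) ≠ 0 := by
      exact_mod_cast Fintype.card_ne_zero
    have h1 := sum_sum_update (k := k) fun a => ∫⁻ y, (xinv a y : ℝ≥0∞) ∂lam a
    have h2 : ∀ a, ∑ b, ∫⁻ y, (xinv (Function.update a k b) y : ℝ≥0∞)
        ∂lam (Function.update a k b) ≤ Fintype.card (α k × β k) := by
      intro a
      have : ∀ b y, xinv (Function.update a k b) y = xinv a y := by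
        intro b y
        simp only [xinv, Function.update_idem]
      simp_rw [this]
      have h3 : ∀ b, ∫⁻ y, (xinv a y : ℝ≥0∞) ∂lam (Function.update a k b) =
          ∫⁻ y, (F (Function.update a k b) y : ℝ≥0∞) * (xinv a y : ℝ≥0∞) ∂q a := by
        intro b
        rw [hF, hq, lintegral_withDensity_eq_lintegral_mul _ (hFm _).coe_nnreal_ennreal
          (hxm a).coe_nnreal_ennreal]
        rfl
      simp_rw [h3]
      rw [← lintegral_finsetSum _ fun b _ => by fun_prop]
      calc _ ≤ ∫⁻ _, (Fintype.card (α k × β k) : ℝ≥0∞) ∂q a := by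
            refine lintegral_mono fun y => ?_
            simp only
            rw [← Finset.sum_mul]
            norm_cast
            simp only [xinv]
            by_cases h0 : ∑ b, F (Function.update a k b) y = 0
            · rw [h0]; simp
            · rw [mul_div_cancel₀ _ h0]
        _ = _ := by simp
    have h4 := (Finset.sum_le_sum fun a (_ : a ∈ Finset.univ) => h2 a)
    rw [h1, Finset.sum_const, Finset.card_univ, nsmul_eq_mul, nsmul_eq_mul, mul_comm] at h4
    exact (ENNReal.mul_le_mul_iff_left hcI (ENNReal.natCast_ne_top _)).1 h4
  have hxfin : ∀ a, ∫⁻ y, (xinv a y : ℝ≥0∞) ∂lam a ≠ ∞ := fun a =>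
    ((ENNReal.sum_ne_top).1 (ne_top_of_le_ne_top (ENNReal.natCast_ne_top _) hsumx)) a
      (Finset.mem_univ a)
  have hxi : ∀ a, Integrable (fun y => (xinv a y : ℝ)) (lam a) := by
    intro a
    refine ⟨(hxm a).coe_nnreal_real.aestronglyMeasurable, ?_⟩
    rw [hasFiniteIntegral_iff_ofReal (.of_forall fun y => NNReal.coe_nonneg _)]
    simpa using (hxfin a).lt_top
  have hpt : ∀ a, ∀ᵐ y ∂lam a, Real.log (postRatio (fun a => (φ a y : ℝ)) k a) ≤
      Real.log (1 + avgDensity F k a y) + ((xinv a y : ℝ) - 1) := by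
    intro a
    have hle : ∀ (F : (∀ k, α k × β k) → B → ℝ≥0) y,
        ∑ l, F (Function.update a k ((a k).1, l)) y ≤ ∑ b, F (Function.update a k b) y := by
      intro F y
      have := sum_snd_le_sum (φ := fun a => (F a y : ℝ)) (fun _ => NNReal.coe_nonneg _) k a
      exact_mod_cast this
    have hle' : ∀ (F : (∀ k, α k × β k) → B → ℝ≥0) y,
        F a y ≤ ∑ l, F (Function.update a k ((a k).1, l)) y := by
      intro F y
      have := le_sum_snd (φ := fun a => (F a y : ℝ)) (fun _ => NNReal.coe_nonneg _) k a
      exact_mod_cast this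
    have e₁ : ν.withDensity (fun y => ((∑ l, φ (Function.update a k ((a k).1, l)) y : ℝ≥0) : ℝ≥0∞))
        = (q a).withDensity
          fun y => ((∑ l, F (Function.update a k ((a k).1, l)) y : ℝ≥0) : ℝ≥0∞) := by
      rw [withDensity_finset_sum _ _ fun _ => hφm _, withDensity_finset_sum _ _ fun _ => hFm _]
      refine Finset.sum_congr rfl fun l _ => ?_
      rw [← hφ, hF, hq]
    have e₂ : ν.withDensity (fun y => ((∑ b, φ (Function.update a k b) y : ℝ≥0) : ℝ≥0∞))
        = (q a).withDensity fun y => ((∑ b, F (Function.update a k b) y : ℝ≥0) : ℝ≥0∞) := by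
      rw [withDensity_finset_sum _ _ fun _ => hφm _, withDensity_finset_sum _ _ fun _ => hFm _]
      refine Finset.sum_congr rfl fun l _ => ?_
      rw [← hφ, hF, hq]
    have e₃ : ν.withDensity (fun y => ((∑ b, φ (Function.update a k b) y : ℝ≥0) : ℝ≥0∞)) =
        ∑ b, lam (Function.update a k b) := by
      rw [withDensity_finset_sum _ _ fun _ => hφm _]
      exact Finset.sum_congr rfl fun b _ => (hφ _).symm
    have : IsFiniteMeasure (ν.withDensity
        fun y => ((∑ b, φ (Function.update a k b) y : ℝ≥0) : ℝ≥0∞)) := by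
      rw [e₃]; infer_instance
    have hr := withDensity_ratio_ae_eq (by fun_prop) (by fun_prop) (by fun_prop) (by fun_prop)
      (hle φ) (hle F) e₁ e₂
    rw [e₃] at hr
    have hac : lam a ≪ ∑ b, lam (Function.update a k b) := by
      refine Measure.absolutelyContinuous_of_le ?_
      conv_lhs => rw [← Function.update_eq_self k a]
      exact Finset.single_le_sum (f := fun b => lam (Function.update a k b))
        (fun _ _ => Measure.zero_le _) (Finset.mem_univ (a k))
    have hr' := hac.ae_le hr
    -- The logarithm of the product splits only where the densities are positive, which holds almost
    -- surely under `lam a`.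
    have hF0 : ∀ᵐ y ∂lam a, F a y ≠ 0 := by
      rw [hF a, ae_withDensity_iff (hFm a).coe_nnreal_ennreal]
      exact .of_forall fun y hy => by exact_mod_cast hy
    filter_upwards [hr', hF0] with y hy hFy
    have hpos : 0 < F a y := pos_iff_ne_zero.2 hFy
    have hupos := hpos.trans_le (hle' F y)
    have hvpos := hupos.trans_le (hle F y)
    set u := ∑ l, F (Function.update a k ((a k).1, l)) y with hu
    set v := ∑ b, F (Function.update a k b) y with hv
    have hα : (0 : ℝ) < Fintype.card (α k) := by exact_mod_cast Fintype.card_pos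
    have hβ : (0 : ℝ) < Fintype.card (β k) := by exact_mod_cast Fintype.card_pos
    have hu0 : (0 : ℝ) < u := by exact_mod_cast hupos
    have hv0 : (0 : ℝ) < v := by exact_mod_cast hvpos
    have hrat : postRatio (fun a => (φ a y : ℝ)) k a = (u / Fintype.card (β k) : ℝ) * xinv a y := by
      have := congrArg (fun x : ℝ≥0 => (x : ℝ)) hy
      push_cast at this
      rw [postRatio, mul_div_assoc, this]
      simp only [xinv, ← hv, Fintype.card_prod]
      push_cast
      rw [hu]
      push_cast
      field_simp
    have hx0 : (0 : ℝ) < xinv a y := by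
      simp only [xinv, ← hv, Fintype.card_prod]
      push_cast
      positivity
    rw [hrat, Real.log_mul (div_pos hu0 hβ).ne' hx0.ne']
    refine add_le_add (Real.log_le_log (div_pos hu0 hβ) ?_) (Real.log_le_sub_one_of_pos hx0)
    simp only [avgDensity, ← hu]
    push_cast
    linarith
  have hrhs : ∀ a, Integrable (fun y => Real.log (1 + avgDensity F k a y) +
      ((xinv a y : ℝ) - 1)) (lam a) := fun a =>
    (hlogi a).add ((hxi a).sub (integrable_const 1))
  have hlog_int : ∀ a, Integrable
      (fun y => Real.log (postRatio (fun a => (φ a y : ℝ)) k a)) (lam a) := by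
    intro a
    rw [hφ a, integrable_withDensity_iff_integrable_smul (hφm a)]
    exact integrable_mul_log_postRatio hφm hφ k a
  calc _ ≤ ∑ a, ∫ y, (Real.log (1 + avgDensity F k a y) + ((xinv a y : ℝ) - 1)) ∂lam a :=
        Finset.sum_le_sum fun a _ => integral_mono_ae (hlog_int a) (hrhs a) (hpt a)
    _ = ∑ a, ∫ y, Real.log (1 + avgDensity F k a y) ∂lam a +
          (∑ a, ∫ y, (xinv a y : ℝ) ∂lam a - Fintype.card (∀ k, α k × β k)) := by
        rw [show (Fintype.card (∀ k, α k × β k) : ℝ) = ∑ _a : ∀ k, α k × β k, (1 : ℝ) by simp,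
          ← Finset.sum_sub_distrib, ← Finset.sum_add_distrib]
        refine Finset.sum_congr rfl fun a _ => ?_
        have h1 : Integrable (fun y => (xinv a y : ℝ) - 1) (lam a) :=
          (hxi a).sub (integrable_const 1)
        rw [integral_add (hlogi a) h1, integral_sub (hxi a) (integrable_const 1)]
        simp
    _ ≤ ∑ a, ∫ y, Real.log (1 + avgDensity F k a y) ∂lam a := by
        have : ∑ a, ∫ y, (xinv a y : ℝ) ∂lam a ≤ Fintype.card (∀ k, α k × β k) := by
          have h1 : ∀ a, ∫ y, (xinv a y : ℝ) ∂lam a = (∫⁻ y, (xinv a y : ℝ≥0∞) ∂lam a).toReal := by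
            intro a
            rw [integral_eq_lintegral_of_nonneg_ae (.of_forall fun y => NNReal.coe_nonneg _)
              (hxm a).coe_nnreal_real.aestronglyMeasurable]
            simp
          simp_rw [h1]
          rw [← ENNReal.toReal_sum fun a _ => hxfin a]
          exact (ENNReal.toReal_mono (ENNReal.natCast_ne_top _) hsumx).trans (by simp)
        linarith
    _ = _ := by
        rw [ENNReal.toReal_sum fun a _ => hfin' a]
        refine Finset.sum_congr rfl fun a _ => ?_
        rw [integral_eq_lintegral_of_nonneg_ae (.of_forall fun y => hlognn a y)
          (hlogm a).aestronglyMeasurable]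

lemma sum_negMulLog_le_log_card {U : Type*} [Fintype U] [Nonempty U] {p : U → ℝ}
    (hp : ∀ u, 0 ≤ p u) (hp1 : ∑ u, p u = 1) :
    ∑ u, Real.negMulLog (p u) ≤ Real.log (Fintype.card U) := by
  set n : ℝ := (Fintype.card U : ℝ) with hn
  have hn0 : 0 < n := by rw [hn]; exact_mod_cast Fintype.card_pos
  have h : ∀ u, Real.negMulLog (p u) ≤ p u * Real.log n + (n⁻¹ - p u) := by
    intro u
    rcases (hp u).eq_or_lt with h0 | hpos
    · rw [← h0]; simp [hn0.le]
    have h1 := Real.log_le_sub_one_of_pos (inv_pos.2 (mul_pos hn0 hpos))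
    rw [Real.log_inv, Real.log_mul hn0.ne' hpos.ne'] at h1
    have h2 := mul_le_mul_of_nonneg_left h1 hpos.le
    have h3 : p u * ((n * p u)⁻¹ - 1) = n⁻¹ - p u := by field_simp
    rw [Real.negMulLog]
    linarith
  refine (Finset.sum_le_sum fun u _ => h u).trans (le_of_eq ?_)
  rw [Finset.sum_add_distrib, Finset.sum_sub_distrib, hp1, ← Finset.sum_mul, hp1]
  simp only [Finset.sum_const, Finset.card_univ, nsmul_eq_mul, ← hn]
  rw [mul_inv_cancel₀ hn0.ne']
  ring

lemma entropy_le_log_card {Ω U : Type*} [MeasurableSpace Ω] [MeasurableSpace U]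
    [MeasurableSingletonClass U] [Fintype U] [Nonempty U] (ρ : Measure Ω) [IsProbabilityMeasure ρ]
    {X : Ω → U} (hX : Measurable X) : entropy X ρ ≤ Real.log (Fintype.card U) := by
  have := Measure.isProbabilityMeasure_map (μ := ρ) hX.aemeasurable
  refine sum_negMulLog_le_log_card (fun u => measureReal_nonneg) ?_
  rw [sum_measureReal_singleton]
  simp

/-- By `hlaw`, the index tuple is uniform, `X` is a function of its messages and `Y` has law `lam a`
given the tuple. The bound at a fixed output is integrated against the output law, and the reference
law is then introduced for each user separately. -/
lemma ofReal_entropy_sub_condEntropy_le [∀ k, Nonempty (α k)] [∀ k, Nonempty (β k)]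
    {lam : (∀ k, α k × β k) → Measure B} [∀ a, IsProbabilityMeasure (lam a)]
    {Ω U : Type*} [MeasurableSpace Ω] (ρ : Measure Ω) [IsProbabilityMeasure ρ]
    [MeasurableSpace U] [MeasurableSingletonClass U] [StandardBorelSpace U]
    [Fintype U] [DecidableEq U] [Nonempty U] {X : Ω → U} (hX : Measurable X) {Y : Ω → B}
    (hY : Measurable Y) (G : (∀ k, α k) → U) (S : Finset ι)
    (hG : ∀ w w', G w = G w' ↔ ∀ k ∈ S, w k = w' k)
    (hcard : Fintype.card U = ∏ k ∈ S, Fintype.card (α k))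
    (hlaw : ∀ u E, MeasurableSet E → ρ (X ⁻¹' {u} ∩ Y ⁻¹' E) =
      (∑ a : ∀ k, α k × β k, if G (fun k => (a k).1) = u then lam a E else 0) /
        Fintype.card (∀ k, α k × β k))
    {q : ι → (∀ k, α k × β k) → Measure B} [∀ k a, IsProbabilityMeasure (q k a)]
    {F : ι → (∀ k, α k × β k) → B → ℝ≥0} (hFm : ∀ k a, Measurable (F k a))
    (hF : ∀ k ∈ S, ∀ a, lam a = (q k a).withDensity fun y => (F k a y : ℝ≥0∞))
    (hq : ∀ k ∈ S, ∀ a b, q k (Function.update a k b) = q k a) :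
    ENNReal.ofReal (entropy X ρ - condEntropy X Y ρ) ≤
      ∑ k ∈ S, (∑ a, ∫⁻ y, ENNReal.ofReal (Real.log (1 + avgDensity (F k) k a y)) ∂lam a) /
        Fintype.card (∀ k, α k × β k) := by
  -- If one term is infinite the bound is trivial; otherwise the real integrals below are
  -- meaningful.
  by_cases htop : ∀ k ∈ S, ∑ a, ∫⁻ y, ENNReal.ofReal
      (Real.log (1 + avgDensity (F k) k a y)) ∂lam a ≠ ∞
  swap
  · push Not at htop
    obtain ⟨k, hk, hk'⟩ := htop
    refine le_top.trans (le_of_eq (Eq.symm ?_))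
    refine ENNReal.sum_eq_top.2 ⟨k, hk, ?_⟩
    rw [hk', ENNReal.top_div_of_ne_top (ENNReal.natCast_ne_top _)]
  set c : ℕ := Fintype.card (∀ k, α k × β k) with hc
  have hcpos : 0 < c := Fintype.card_pos
  have hc0 : (c : ℝ≥0∞) ≠ 0 := by exact_mod_cast hcpos.ne'
  have hct : (c : ℝ≥0∞) ≠ ∞ := ENNReal.natCast_ne_top _
  set ν := ρ.map Y with hν
  have hνp : IsProbabilityMeasure ν := Measure.isProbabilityMeasure_map hY.aemeasurable
  have hνE : ∀ E, MeasurableSet E → (c : ℝ≥0∞) * ν E = ∑ a, lam a E := by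
    intro E hE
    have h1 : ν E = ∑ u, ρ (X ⁻¹' {u} ∩ Y ⁻¹' E) := by
      rw [hν, Measure.map_apply hY hE]
      rw [← measure_biUnion_finset]
      · congr 1
        ext ω
        simp
      · intro u _ v _ huv
        rw [Function.onFun, Set.disjoint_left]
        rintro ω ⟨h1, -⟩ ⟨h2, -⟩
        exact huv (h1.symm.trans h2)
      · exact fun u _ => (hX (measurableSet_singleton u)).inter (hY hE)
    rw [h1]
    simp_rw [hlaw _ E hE, ENNReal.div_eq_inv_mul]
    rw [← Finset.mul_sum, ← mul_assoc, ENNReal.mul_inv_cancel hc0 hct, one_mul, Finset.sum_comm]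
    simp
  have hac : ∀ a, lam a ≪ ν := by
    intro a
    refine Measure.AbsolutelyContinuous.mk fun E hE h0 => ?_
    have h1 := hνE E hE
    rw [h0, mul_zero] at h1
    exact (Finset.sum_eq_zero_iff.1 h1.symm) a (Finset.mem_univ a)
  let φ : (∀ k, α k × β k) → B → ℝ≥0 := fun a y => ((lam a).rnDeriv ν y).toNNReal
  have hφm : ∀ a, Measurable (φ a) := fun a => (Measure.measurable_rnDeriv _ _).ennreal_toNNReal
  have hφ : ∀ a, lam a = ν.withDensity fun y => (φ a y : ℝ≥0∞) := by
    intro a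
    conv_lhs => rw [← Measure.withDensity_rnDeriv_eq _ _ (hac a)]
    refine withDensity_congr_ae ?_
    filter_upwards [Measure.rnDeriv_lt_top (lam a) ν] with y hy
    exact (ENNReal.coe_toNNReal hy.ne).symm
  -- The output law `ν` is the uniform mixture of the `lam a`, so their densities average to one.
  have hsum : ∀ᵐ y ∂ν, ∑ a, φ a y = (c : ℝ≥0) := by
    have h1 : ν.withDensity (fun y => ((∑ a, φ a y : ℝ≥0) : ℝ≥0∞)) =
        ν.withDensity fun _ => ((c : ℝ≥0) : ℝ≥0∞) := by
      rw [withDensity_finset_sum _ _ hφm, withDensity_const]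
      ext E hE
      simp only [Measure.coe_finsetSum, Finset.sum_apply, ← hφ, Measure.smul_apply, smul_eq_mul]
      rw [← hνE E hE]
      simp
    have hm : Measurable fun y => ((∑ a, φ a y : ℝ≥0) : ℝ≥0∞) := by fun_prop
    have h2 := (withDensity_eq_iff hm.aemeasurable aemeasurable_const (by
      rw [← setLIntegral_univ, ← withDensity_apply _ .univ, h1]; simp)).1 h1
    filter_upwards [h2] with y hy
    exact_mod_cast hy
  -- Bayes' rule, obtained by testing the regular conditional law on the sets `E ×ˢ {u}`.
  have hcond : ∀ u, ∀ᵐ y ∂ν, (condDistrib X Y ρ y).real {u} =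
      ∑ a : ∀ k, α k × β k, if G (fun k => (a k).1) = u then (φ a y : ℝ) / c else 0 := by
    intro u
    let g : B → ℝ≥0 := fun y =>
      ∑ a : ∀ k, α k × β k, if G (fun k => (a k).1) = u then φ a y / c else 0
    have hgm : Measurable g := by
      refine Finset.measurable_sum _ fun a _ => ?_
      split_ifs
      · exact (hφm a).div_const _
      · exact measurable_const
    have h1 : (fun y => condDistrib X Y ρ y {u}) =ᵐ[ν] fun y => (g y : ℝ≥0∞) := by
      refine ae_eq_of_forall_setLIntegral_eq_of_sigmaFinite
        (Kernel.measurable_coe _ (measurableSet_singleton u)) hgm.coe_nnreal_ennreal ?_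
      intro E hE _
      have h2 := compProd_map_condDistrib (mβ := inferInstance) (X := Y) (μ := ρ) hX.aemeasurable
      have h3 := congrArg (fun m => m (E ×ˢ {u})) h2
      rw [Measure.compProd_apply_prod hE (measurableSet_singleton u),
        Measure.map_apply (hY.prodMk hX) (hE.prod (measurableSet_singleton u))] at h3
      rw [h3]
      have h4 : (fun ω => (Y ω, X ω)) ⁻¹' E ×ˢ {u} = X ⁻¹' {u} ∩ Y ⁻¹' E := by
        ext ω
        simp [and_comm]
      rw [h4, hlaw u E hE]
      have h5 : ∀ y, (g y : ℝ≥0∞) = (∑ a : ∀ k, α k × β k,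
          if G (fun k => (a k).1) = u then (φ a y : ℝ≥0∞) else 0) * (c : ℝ≥0∞)⁻¹ := by
        intro y
        simp only [g]
        push_cast
        rw [Finset.sum_mul]
        refine Finset.sum_congr rfl fun a _ => ?_
        split_ifs
        · rw [ENNReal.coe_div (by exact_mod_cast hcpos.ne'), ENNReal.div_eq_inv_mul, mul_comm]
          simp
        · simp
      simp_rw [h5]
      have h6 : ∀ a : ∀ k, α k × β k, Measurable fun y =>
          if G (fun k => (a k).1) = u then (φ a y : ℝ≥0∞) else 0 := by
        intro a
        split_ifs
        · exact (hφm a).coe_nnreal_ennreal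
        · exact measurable_const
      rw [lintegral_mul_const _ (Finset.measurable_sum _ fun a _ => h6 a),
        lintegral_finsetSum _ fun a _ => h6 a, ENNReal.div_eq_inv_mul, mul_comm]
      congr 1
      refine Finset.sum_congr rfl fun a _ => ?_
      split_ifs
      · rw [hφ a, withDensity_apply _ hE]
      · simp
    filter_upwards [h1] with y hy
    rw [measureReal_def, hy, ENNReal.coe_toReal]
    simp only [g]
    push_cast
    refine Finset.sum_congr rfl fun a _ => ?_
    split_ifs <;> simp
  have hcond' : ∀ᵐ y ∂ν, ∑ u, Real.negMulLog ((condDistrib X Y ρ y).real {u}) =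
      ∑ u, Real.negMulLog (∑ a : ∀ k, α k × β k,
        if G (fun k => (a k).1) = u then (φ a y : ℝ) / c else 0) := by
    filter_upwards [ae_all_iff.2 hcond] with y hy
    simp_rw [hy]
  have hm : ∀ u, Measurable fun y => (condDistrib X Y ρ y).real {u} := fun u =>
    (Kernel.measurable_coe _ (measurableSet_singleton u)).ennreal_toReal
  have hint : Integrable (fun y => ∑ u, Real.negMulLog ((condDistrib X Y ρ y).real {u})) ν := by
    refine integrable_finsetSum _ fun u _ => ?_
    refine Integrable.of_bound (C := 1)
      (Real.continuous_negMulLog.measurable.comp (hm u)).aestronglyMeasurable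
      (.of_forall fun y => ?_)
    have h0 : 0 ≤ (condDistrib X Y ρ y).real {u} := measureReal_nonneg
    have h1 : (condDistrib X Y ρ y).real {u} ≤ 1 := measureReal_le_one
    rw [Real.norm_of_nonneg (Real.negMulLog_nonneg h0 h1)]
    have h2 := Real.negMulLog_le_one_sub_self h0
    linarith
  have hint2 : ∀ k a, Integrable
      (fun y => (φ a y : ℝ) * Real.log (postRatio (fun a => (φ a y : ℝ)) k a) / c) ν :=
    fun k a => (integrable_mul_log_postRatio hφm hφ k a).div_const _
  have hmain : entropy X ρ - condEntropy X Y ρ ≤ ∑ k ∈ S,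
      (∑ a, ∫ y, Real.log (postRatio (fun a => (φ a y : ℝ)) k a) ∂lam a) / c := by
    have h1 : condEntropy X Y ρ =
        ∫ y, ∑ u, Real.negMulLog ((condDistrib X Y ρ y).real {u}) ∂ν := rfl
    have h2 : ∫ y, (Real.log (Fintype.card U) -
        ∑ u, Real.negMulLog ((condDistrib X Y ρ y).real {u})) ∂ν =
        Real.log (Fintype.card U) - condEntropy X Y ρ := by
      rw [integral_sub (integrable_const _) hint, h1]
      simp
    have h3 : ∫ y, (Real.log (Fintype.card U) -
        ∑ u, Real.negMulLog ((condDistrib X Y ρ y).real {u})) ∂ν ≤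
        ∫ y, ∑ k ∈ S, ∑ a,
          (φ a y : ℝ) * Real.log (postRatio (fun a => (φ a y : ℝ)) k a) / c ∂ν := by
      refine integral_mono_ae ((integrable_const _).sub hint)
        (integrable_finsetSum _ fun k _ => integrable_finsetSum _ fun a _ => hint2 k a) ?_
      filter_upwards [hcond', hsum] with y hy hys
      simp only [hy]
      refine log_card_sub_entropy_le (φ := fun a => (φ a y : ℝ)) (fun a => NNReal.coe_nonneg _)
        ?_ G S hG hcard
      have := congrArg (fun x : ℝ≥0 => (x : ℝ)) hys
      push_cast at this
      rw [this, hc]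
    have h4 : ∫ y, ∑ k ∈ S, ∑ a,
          (φ a y : ℝ) * Real.log (postRatio (fun a => (φ a y : ℝ)) k a) / c ∂ν =
        ∑ k ∈ S, (∑ a, ∫ y, Real.log (postRatio (fun a => (φ a y : ℝ)) k a) ∂lam a) / c := by
      rw [integral_finsetSum _ fun k _ => integrable_finsetSum _ fun a _ => hint2 k a]
      refine Finset.sum_congr rfl fun k _ => ?_
      rw [integral_finsetSum _ fun a _ => hint2 k a, Finset.sum_div]
      refine Finset.sum_congr rfl fun a _ => ?_
      rw [integral_div, hφ a, integral_withDensity_eq_integral_smul (hφm a)]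
      rfl
    -- An upper bound on the entropy suffices, so uniformity of `X` is not needed at this point.
    linarith [entropy_le_log_card ρ hX]
  refine (ENNReal.ofReal_le_ofReal hmain).trans ?_
  refine (ENNReal.ofReal_le_ofReal (Finset.sum_le_sum fun k hk => div_le_div_of_nonneg_right
    (sum_integral_log_postRatio_le hφm (hFm k) hφ k (hF k hk) (hq k hk) (htop k hk))
      (Nat.cast_nonneg c))).trans ?_
  rw [ENNReal.ofReal_sum_of_nonneg fun k _ => by positivity]
  refine Finset.sum_le_sum fun k hk => ?_
  rw [ENNReal.ofReal_div_of_pos (by exact_mod_cast hcpos), ENNReal.ofReal_toReal (htop k hk),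
    ENNReal.ofReal_natCast]

end leakage

/-! ### A bounded test function for the Kullback-Leibler divergence -/

/-- The logarithm clamped to `[-log m, log m]`. -/
noncomputable def clampLog (m x : ℝ) : ℝ := Real.log (max (min x m) m⁻¹)

lemma measurable_clampLog (m : ℝ) : Measurable (clampLog m) := by
  unfold clampLog
  fun_prop

lemma exp_clampLog_le {m x : ℝ} (hm : 1 ≤ m) (hx : 0 ≤ x) : Real.exp (clampLog m x) ≤ x + m⁻¹ := by
  have hm' : 0 < m⁻¹ := by positivity
  rw [clampLog, Real.exp_log (lt_max_of_lt_right hm')]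
  exact max_le ((min_le_left _ _).trans (by linarith)) (by linarith)

lemma abs_clampLog_le {m x : ℝ} (hm : 1 ≤ m) : |clampLog m x| ≤ Real.log m := by
  have hm' : 0 < m⁻¹ := by positivity
  have h1 : m⁻¹ ≤ max (min x m) m⁻¹ := le_max_right _ _
  have h2 : max (min x m) m⁻¹ ≤ m := max_le (min_le_right _ _) ((inv_le_one_of_one_le₀ hm).trans hm)
  rw [abs_le]
  refine ⟨?_, Real.log_le_log (hm'.trans_le h1) h2⟩
  rw [← Real.log_inv]
  exact Real.log_le_log hm' h1

/-- Nonnegativity allows Fatou's lemma for the clamped integrands. The condition `3 ≤ m` ensures `1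
≤ log m`, which covers the range `x > m`. -/
lemma mul_clampLog_add_nonneg {m x : ℝ} (hm : 3 ≤ m) (hx : 0 ≤ x) :
    0 ≤ x * clampLog m x + 1 - x := by
  have hm0 : 0 < m := by linarith
  have hlm : 1 ≤ Real.log m := by
    rw [Real.le_log_iff_exp_le hm0]
    linarith [Real.exp_one_lt_d9]
  rcases le_total x m⁻¹ with h1 | h1
  · have h2 : clampLog m x = -Real.log m := by
      rw [clampLog, max_eq_right ((min_le_left _ _).trans h1), Real.log_inv]
    have h3 : Real.log m ≤ m - 1 := Real.log_le_sub_one_of_pos hm0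
    have h4 : x * m ≤ 1 := by
      rw [← inv_mul_cancel₀ hm0.ne']
      exact mul_le_mul_of_nonneg_right h1 hm0.le
    rw [h2]
    nlinarith
  rcases le_total x m with h2 | h2
  · have hx0 : 0 < x := (inv_pos.2 hm0).trans_le h1
    rw [clampLog, min_eq_left h2, max_eq_left h1]
    have := InformationTheory.klFun_nonneg hx
    rwa [InformationTheory.klFun_apply] at this
  · have hx0 : 0 < x := hm0.trans_le h2
    rw [clampLog, min_eq_right h2, max_eq_left ((inv_le_one_of_one_le₀ (by linarith)).trans
      (by linarith))]
    nlinarith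

lemma mul_clampLog_add_eventually_eq {x : ℝ} (hx : 0 ≤ x) :
    ∀ᶠ m : ℕ in Filter.atTop, x * clampLog m x + 1 - x = InformationTheory.klFun x := by
  rcases hx.eq_or_lt with h0 | hpos
  · exact .of_forall fun m => by rw [← h0]; simp [InformationTheory.klFun_zero]
  obtain ⟨a, ha⟩ := exists_nat_ge x
  obtain ⟨b, hb⟩ := exists_nat_ge x⁻¹
  filter_upwards [Filter.eventually_ge_atTop (max a b)] with m hm
  have h1 : x ≤ m := ha.trans (by exact_mod_cast (le_max_left a b).trans hm)
  have h2 : x⁻¹ ≤ m := hb.trans (by exact_mod_cast (le_max_right a b).trans hm)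
  rw [InformationTheory.klFun_apply, clampLog, min_eq_left h1,
    max_eq_left (inv_le_of_inv_le₀ hpos h2)]

/-- This is the Donsker-Varadhan lower bound with a bounded test function: clamp the log-likelihood
ratio, let the clamp grow and apply Fatou's lemma. Boundedness keeps the law of large numbers
available even when the divergence is infinite. -/
lemma exists_bounded_test {Z : Type*} [MeasurableSpace Z] {P Q : Measure Z}
    [IsProbabilityMeasure P] [IsProbabilityMeasure Q] {r : ℝ}
    (hr : ENNReal.ofReal r < InformationTheory.klDiv P Q) :
    ∃ g : Z → ℝ, Measurable g ∧ (∃ C, ∀ z, |g z| ≤ C) ∧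
      ∫⁻ z, ENNReal.ofReal (Real.exp (g z)) ∂Q ≤ 1 ∧ r < ∫ z, g z ∂P := by
  by_cases hac : P ≪ Q
  swap
  · obtain ⟨s, hs, hQ, hP⟩ : ∃ s, MeasurableSet s ∧ Q s = 0 ∧ P s ≠ 0 := by
      by_contra! h
      exact hac (Measure.AbsolutelyContinuous.mk fun s hs h0 => h s hs h0)
    have hP' : 0 < P.real s := by
      rw [measureReal_def]; exact ENNReal.toReal_pos hP (measure_ne_top _ _)
    let m : ℝ := (|r| + 1) / P.real s
    have hm0 : 0 ≤ m := by positivity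
    -- Without absolute continuity, a large multiple of the indicator of a `Q`-null set works; `m`
    -- is scaled to give `P`-mean `|r| + 1`.
    refine ⟨s.indicator fun _ => m, measurable_const.indicator hs, ⟨m, fun z => ?_⟩, ?_, ?_⟩
    · by_cases hz : z ∈ s <;> simp [hz, hm0, abs_of_nonneg hm0]
    · have : ∀ᵐ z ∂Q, ENNReal.ofReal (Real.exp (s.indicator (fun _ => m) z)) = 1 := by
        have h1 : ∀ᵐ z ∂Q, z ∉ s := measure_eq_zero_iff_ae_notMem.1 hQ
        filter_upwards [h1] with z hz
        simp [hz]
      rw [lintegral_congr_ae this]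
      simp
    · rw [integral_indicator_const _ hs, smul_eq_mul, mul_div_cancel₀ _ hP'.ne']
      linarith [le_abs_self r]
  obtain ⟨r', hr1, hr2⟩ := ENNReal.lt_iff_exists_nnreal_btwn.1 hr
  have hr1' : r < r' := by
    rw [← ENNReal.ofReal_coe_nnreal] at hr1
    by_contra! h
    exact absurd (ENNReal.ofReal_le_ofReal h) (not_le.2 hr1)
  let f : Z → ℝ := fun z => (P.rnDeriv Q z).toReal
  have hf0 : ∀ z, 0 ≤ f z := fun z => ENNReal.toReal_nonneg
  have hfm : Measurable f := (Measure.measurable_rnDeriv _ _).ennreal_toReal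
  have hfi : Integrable f Q := Measure.integrable_toReal_rnDeriv
  have hf1 : ∫ z, f z ∂Q = 1 := by
    rw [Measure.integral_toReal_rnDeriv hac]; simp
  have hgi : ∀ m : ℕ, 3 ≤ m → Integrable (fun z => clampLog m (f z)) P := by
    intro m hm
    refine Integrable.of_bound (C := Real.log m)
      ((measurable_clampLog m).comp hfm).aestronglyMeasurable (.of_forall fun z => ?_)
    exact abs_clampLog_le (by exact_mod_cast (by omega : 1 ≤ m))
  have hfgi : ∀ m : ℕ, 3 ≤ m → Integrable (fun z => f z * clampLog m (f z)) Q := by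
    intro m hm
    exact (integrable_rnDeriv_smul_iff hac).2 (hgi m hm)
  have hval : ∀ m : ℕ, 3 ≤ m → ∫⁻ z, ENNReal.ofReal (f z * clampLog m (f z) + 1 - f z) ∂Q =
      ENNReal.ofReal (∫ z, clampLog m (f z) ∂P) := by
    intro m hm
    have h1 : Integrable (fun z => f z * clampLog m (f z) + 1) Q :=
      (hfgi m hm).add (integrable_const 1)
    have h2 : Integrable (fun z => f z * clampLog m (f z) + 1 - f z) Q := h1.sub hfi
    rw [← ofReal_integral_eq_lintegral_ofReal h2 (.of_forall fun z =>
      mul_clampLog_add_nonneg (by exact_mod_cast hm) (hf0 z)), integral_sub h1 hfi,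
      integral_add (hfgi m hm) (integrable_const 1), hf1]
    congr 1
    rw [← integral_rnDeriv_smul hac]
    simp [f]
  have hfatou : InformationTheory.klDiv P Q ≤
      Filter.liminf (fun m : ℕ => ∫⁻ z, ENNReal.ofReal (f z * clampLog m (f z) + 1 - f z) ∂Q)
        Filter.atTop := by
    rw [InformationTheory.klDiv_eq_lintegral_klFun_of_ac hac]
    refine le_trans (le_of_eq ?_) (lintegral_liminf_le fun m => ?_)
    · refine lintegral_congr fun z => Eq.symm ?_
      refine Filter.Tendsto.liminf_eq (tendsto_const_nhds.congr' ?_)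
      filter_upwards [mul_clampLog_add_eventually_eq (hf0 z)] with m hm
      rw [hm]
    · have := (measurable_clampLog m).comp hfm
      exact ((hfm.mul this).add_const 1 |>.sub hfm).ennreal_ofReal
  have hev := Filter.eventually_lt_of_lt_liminf (hr2.trans_le hfatou)
  -- For `m > a` the normalising constant `log (1 + 1/m) ≤ 1/m` is smaller than the gap `r' - r`.
  obtain ⟨a, ha⟩ := exists_nat_gt ((r' - r)⁻¹)
  obtain ⟨m, hm1, hm2⟩ := (hev.and (Filter.eventually_ge_atTop (max 3 (a + 1)))).exists
  have hm3 : 3 ≤ m := (le_max_left _ _).trans hm2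
  have hma : (a : ℝ) < m := by exact_mod_cast (le_max_right 3 (a + 1)).trans hm2
  have hm0 : (0 : ℝ) < m := by positivity
  have hm1' : (1 : ℝ) ≤ m := by exact_mod_cast (by omega : 1 ≤ m)
  rw [hval m hm3, ← ENNReal.ofReal_coe_nnreal] at hm1
  have hr' : (r' : ℝ) < ∫ z, clampLog m (f z) ∂P :=
    ((ENNReal.ofReal_lt_ofReal_iff_of_nonneg r'.2).1 hm1)
  have h1m : (0 : ℝ) < 1 + (m : ℝ)⁻¹ := by positivity
  -- The exponential of the clamped logarithm is at most `f + 1/m`, of `Q`-mean `1 + 1/m`; the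
  -- subtracted constant normalises this to one.
  refine ⟨fun z => clampLog m (f z) - Real.log (1 + (m : ℝ)⁻¹),
    ((measurable_clampLog m).comp hfm).sub_const _,
    ⟨Real.log m + |Real.log (1 + (m : ℝ)⁻¹)|, fun z => ?_⟩, ?_, ?_⟩
  · exact (abs_sub _ _).trans (add_le_add (abs_clampLog_le hm1') le_rfl)
  · have hle : ∀ z, Real.exp (clampLog m (f z) - Real.log (1 + (m : ℝ)⁻¹)) ≤
        (f z + (m : ℝ)⁻¹) * (1 + (m : ℝ)⁻¹)⁻¹ := by
      intro z
      rw [Real.exp_sub, Real.exp_log h1m, div_eq_mul_inv]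
      exact mul_le_mul_of_nonneg_right (exp_clampLog_le hm1' (hf0 z)) (by positivity)
    have hi : Integrable (fun z => f z + (m : ℝ)⁻¹) Q := hfi.add (integrable_const _)
    calc _ ≤ ∫⁻ z, ENNReal.ofReal ((f z + (m : ℝ)⁻¹) * (1 + (m : ℝ)⁻¹)⁻¹) ∂Q :=
          lintegral_mono fun z => ENNReal.ofReal_le_ofReal (hle z)
      _ = 1 := by
        rw [← ofReal_integral_eq_lintegral_ofReal (hi.mul_const _)
          (.of_forall fun z => mul_nonneg (add_nonneg (hf0 z) (by positivity)) (by positivity)),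
          integral_mul_const, integral_add hfi (integrable_const _), hf1]
        simp [h1m.ne']
  · rw [integral_sub (hgi m hm3) (integrable_const _)]
    have h2 : Real.log (1 + (m : ℝ)⁻¹) ≤ (m : ℝ)⁻¹ := by
      linarith [Real.log_le_sub_one_of_pos h1m]
    have h3 : (m : ℝ)⁻¹ < r' - r := inv_lt_of_inv_lt₀ (by linarith) (ha.trans hma)
    simp only [integral_const, probReal_univ, one_smul]
    linarith

/-! ### Single-letter conditional densities -/

section glue

set_option linter.unusedSectionVars false

variable {ι : Type*} [DecidableEq ι] {𝒱 : ι → Type*} [∀ i, MeasurableSpace (𝒱 i)]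

/-- The restriction of a tuple to the coordinates other than `k`. -/
def others (k : ι) (v : ∀ i, 𝒱 i) (j : {j // j ≠ k}) : 𝒱 j := v j

/-- The tuple with coordinate `k` equal to `u` and the other coordinates given by `c`. -/
def glue (k : ι) (c : ∀ j : {j // j ≠ k}, 𝒱 j) (u : 𝒱 k) (j : ι) : 𝒱 j :=
  if h : j = k then h ▸ u else c ⟨j, h⟩

lemma glue_self (k : ι) (c : ∀ j : {j // j ≠ k}, 𝒱 j) (u : 𝒱 k) : glue k c u k = u := by
  simp [glue]

lemma glue_of_ne {k j : ι} (h : j ≠ k) (c : ∀ j : {j // j ≠ k}, 𝒱 j) (u : 𝒱 k) :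
    glue k c u j = c ⟨j, h⟩ := by
  simp [glue, h]

lemma measurable_others (k : ι) : Measurable (others (𝒱 := 𝒱) k) := by
  unfold others
  fun_prop

lemma measurable_glue (k : ι) :
    Measurable fun p : (∀ j : {j // j ≠ k}, 𝒱 j) × 𝒱 k => glue k p.1 p.2 := by
  refine measurable_pi_iff.2 fun j => ?_
  by_cases h : j = k
  · subst h
    simp only [glue_self]
    exact measurable_snd
  · simp only [glue_of_ne h]
    fun_prop

lemma glue_others (k : ι) (v : ∀ i, 𝒱 i) (u : 𝒱 k) :
    glue k (others k v) u = Function.update v k u := by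
  ext1 j
  by_cases h : j = k
  · subst h; simp [glue_self]
  · simp [glue_of_ne h, others, h]

lemma others_glue (k : ι) (c : ∀ j : {j // j ≠ k}, 𝒱 j) (u : 𝒱 k) : others k (glue k c u) = c := by
  ext1 j
  simp [others, glue_of_ne j.2]

lemma others_update (k : ι) (v : ∀ i, 𝒱 i) (u : 𝒱 k) :
    others k (Function.update v k u) = others k v := by
  ext1 j
  simp [others, j.2]

lemma pi_map_glue [Fintype ι] (Q : ∀ i, Measure (𝒱 i)) [∀ i, IsProbabilityMeasure (Q i)] (k : ι) :
    ((Measure.pi fun j : {j // j ≠ k} => Q j).prod (Q k)).map (fun p => glue k p.1 p.2) =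
      Measure.pi Q := by
  refine (Measure.pi_eq fun s hs => ?_).symm
  rw [Measure.map_apply (measurable_glue k) (.univ_pi hs)]
  have : (fun p : (∀ j : {j // j ≠ k}, 𝒱 j) × 𝒱 k => glue k p.1 p.2) ⁻¹' Set.univ.pi s =
      (Set.univ.pi fun j : {j // j ≠ k} => s j) ×ˢ s k := by
    ext p
    simp only [Set.mem_preimage, Set.mem_pi, Set.mem_univ, true_implies, Set.mem_prod]
    refine ⟨fun h => ⟨fun j => ?_, ?_⟩, fun h j => ?_⟩
    · simpa [glue_of_ne j.2] using h j
    · simpa [glue_self] using h k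
    · by_cases hj : j = k
      · subst hj; simpa [glue_self] using h.2
      · simpa [glue_of_ne hj] using h.1 ⟨j, hj⟩
  rw [this, Measure.prod_prod, Measure.pi_pi, Fintype.prod_eq_mul_prod_subtype_ne _ k, mul_comm]

lemma pi_map_split [Fintype ι] (Q : ∀ i, Measure (𝒱 i)) [∀ i, IsProbabilityMeasure (Q i)] (k : ι) :
    (Measure.pi Q).map (fun v => (others k v, v k)) =
      (Measure.pi fun j : {j // j ≠ k} => Q j).prod (Q k) := by
  rw [← pi_map_glue Q k, Measure.map_map ((measurable_others k).prodMk (measurable_pi_apply k))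
    (measurable_glue k)]
  conv_rhs => rw [← Measure.map_id (μ := (Measure.pi fun j : {j // j ≠ k} => Q j).prod (Q k))]
  congr 1
  ext1 p
  simp [others_glue, glue_self]

end glue

/-- Here `q` is the conditional law of the output given the letters of the users other than `k`, and
`f` is the likelihood ratio of `T` to `q`. The last two conclusions are the inputs to soft covering:
the mean of `log f` for the true letter of user `k`, and the mean of `f` for a fresh independent
letter in its place. -/
lemma exists_leakage_density {ι : Type*} [Fintype ι] [DecidableEq ι] {𝒱 : ι → Type*}
    [∀ i, MeasurableSpace (𝒱 i)] [∀ i, StandardBorelSpace (𝒱 i)] [∀ i, Nonempty (𝒱 i)]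
    {𝒵 : Type*} [MeasurableSpace 𝒵] [StandardBorelSpace 𝒵] [Nonempty 𝒵]
    {Ω : Type*} [MeasurableSpace Ω] {μ : Measure Ω} [IsProbabilityMeasure μ]
    {V : ∀ i, Ω → 𝒱 i} {Y : Ω → 𝒵} (hV : ∀ i, Measurable (V i)) (hY : Measurable Y)
    (Q : ∀ i, Measure (𝒱 i)) [∀ i, IsProbabilityMeasure (Q i)] (T : Kernel (∀ i, 𝒱 i) 𝒵)
    [IsMarkovKernel T] (hlaw : μ.map (fun ω => (fun i => V i ω, Y ω)) = Measure.pi Q ⊗ₘ T) (k : ι)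
    (hfin : condMutualInfo (V k) Y (fun ω (j : {j // j ≠ k}) => V j ω) μ ≠ ∞) :
    ∃ (q : Kernel (∀ i, 𝒱 i) 𝒵) (_ : IsMarkovKernel q) (f : (∀ i, 𝒱 i) × 𝒵 → ℝ≥0),
      (∀ v u, q (Function.update v k u) = q v) ∧ Measurable f ∧
      (∀ᵐ v ∂Measure.pi Q, T v = (q v).withDensity fun y => (f (v, y) : ℝ≥0∞)) ∧
      Integrable (fun p => Real.log (f p)) (Measure.pi Q ⊗ₘ T) ∧
      ∫ p, Real.log (f p) ∂(Measure.pi Q ⊗ₘ T) ≤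
        (condMutualInfo (V k) Y (fun ω (j : {j // j ≠ k}) => V j ω) μ).toReal ∧
      ∫⁻ p, ∫⁻ u, (f (Function.update p.1 k u, p.2) : ℝ≥0∞) ∂Q k ∂(Measure.pi Q ⊗ₘ T) ≤ 1 := by
  let C : Ω → ∀ j : {j // j ≠ k}, 𝒱 j := fun ω j => V j ω
  have hC : Measurable C := by fun_prop
  have hVm : Measurable fun ω i => V i ω := by fun_prop
  let PC := Measure.pi fun j : {j // j ≠ k} => Q j
  have hlawV : μ.map (fun ω i => V i ω) = Measure.pi Q := by
    have := congrArg (fun m => m.map Prod.fst) hlaw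
    rw [Measure.map_map measurable_fst (hVm.prodMk hY)] at this
    rw [← Measure.fst_compProd (Measure.pi Q) T]
    exact this
  have hCV : μ.map (fun ω => (C ω, V k ω)) = PC.prod (Q k) := by
    rw [← pi_map_split Q k, ← hlawV, Measure.map_map
      ((measurable_others k).prodMk (measurable_pi_apply k)) hVm]
    rfl
  have hPC : μ.map C = PC := by
    have := congrArg (fun m => m.map Prod.fst) hCV
    rw [Measure.map_map measurable_fst (hC.prodMk (hV k))] at this
    refine this.trans ?_
    change (PC.prod (Q k)).fst = PC
    exact Measure.fst_prod
  let qc := condDistrib Y C μ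
  -- The letter of user `k` is independent of the other letters, so conditioning does not change its
  -- law.
  have hA : condDistrib (V k) C μ =ᵐ[μ.map C] Kernel.const _ (Q k) := by
    refine condDistrib_ae_eq_of_measure_eq_compProd _ (hV k).aemeasurable ?_
    rw [hCV, hPC, Measure.compProd_const]
  let q : Kernel (∀ i, 𝒱 i) 𝒵 := qc.comap (others k) (measurable_others k)
  have hq : ∀ v, q v = qc (others k v) := fun v => rfl
  have hKL : InformationTheory.klDiv (Measure.pi Q ⊗ₘ T) (Measure.pi Q ⊗ₘ q) ≤
      condMutualInfo (V k) Y C μ := by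
    let m : (∀ j : {j // j ≠ k}, 𝒱 j) × (𝒱 k × 𝒵) → (∀ i, 𝒱 i) × 𝒵 :=
      fun p => (glue k p.1 p.2.1, p.2.2)
    have hm : Measurable m := ((measurable_glue k).comp (by fun_prop :
      Measurable fun p : (∀ j : {j // j ≠ k}, 𝒱 j) × (𝒱 k × 𝒵) => (p.1, p.2.1))).prodMk
        (by fun_prop)
    have h1 : (μ.map fun ω => (C ω, (V k ω, Y ω))).map m = Measure.pi Q ⊗ₘ T := by
      rw [Measure.map_map hm (hC.prodMk ((hV k).prodMk hY)), ← hlaw]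
      congr 1
      ext1 ω
      refine Prod.ext ?_ rfl
      change glue k (others k fun i => V i ω) (V k ω) = fun i => V i ω
      rw [glue_others, Function.update_eq_self]
    have h2 : ((μ.map C) ⊗ₘ ((condDistrib (V k) C μ) ×ₖ (condDistrib Y C μ))).map m =
        Measure.pi Q ⊗ₘ q := by
      have h3 : (condDistrib (V k) C μ) ×ₖ qc =ᵐ[μ.map C] (Kernel.const _ (Q k)) ×ₖ qc := by
        filter_upwards [hA] with c hc
        rw [Kernel.prod_apply, Kernel.prod_apply, hc]
      rw [Measure.compProd_congr h3, hPC]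
      ext E hE
      rw [Measure.map_apply hm hE, Measure.compProd_apply (hm hE), Measure.compProd_apply hE,
        ← pi_map_glue Q k, lintegral_map (Kernel.measurable_kernel_prodMk_left hE)
          (measurable_glue k), lintegral_prod]
      · refine lintegral_congr fun c => ?_
        rw [Kernel.prod_apply, Kernel.const_apply, Measure.prod_apply
          (measurable_prodMk_left (hm hE))]
        refine lintegral_congr fun u => ?_
        rw [hq, others_glue]
        rfl
      · exact ((Kernel.measurable_kernel_prodMk_left hE).comp (measurable_glue k)).aemeasurable
    rw [← h1, ← h2]
    -- Data processing under the map that reassembles the tuple; the inequality in this direction is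
    -- all that is needed.
    exact InformationTheory.klDiv_map_le _ _ hm
  have hne := ne_top_of_le_ne_top hfin hKL
  obtain ⟨hac, hint⟩ := InformationTheory.klDiv_ne_top_iff.1 hne
  let f : (∀ i, 𝒱 i) × 𝒵 → ℝ≥0 := fun p => (T.rnDeriv q p.1 p.2).toNNReal
  have hfm : Measurable f := (Kernel.measurable_rnDeriv T q).ennreal_toNNReal
  have hdens : ∀ᵐ v ∂Measure.pi Q, T v = (q v).withDensity fun y => (f (v, y) : ℝ≥0∞) := by
    filter_upwards [hac.kernel_of_compProd] with v hv
    conv_lhs => rw [← Kernel.withDensity_rnDeriv_eq hv,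
      Kernel.withDensity_apply _ (Kernel.measurable_rnDeriv T q)]
    refine withDensity_congr_ae ?_
    filter_upwards [Kernel.rnDeriv_lt_top T q (a := v)] with y hy
    exact (ENNReal.coe_toNNReal hy.ne).symm
  have hjoint : Measure.pi Q ⊗ₘ T = (Measure.pi Q ⊗ₘ q).withDensity fun p => (f p : ℝ≥0∞) := by
    ext E hE
    rw [Measure.compProd_apply hE, withDensity_apply _ hE, ← lintegral_indicator hE,
      Measure.lintegral_compProd (hfm.coe_nnreal_ennreal.indicator hE)]
    refine lintegral_congr_ae ?_
    filter_upwards [hdens] with v hv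
    rw [hv, withDensity_apply _ (measurable_prodMk_left hE), ← lintegral_indicator
      (measurable_prodMk_left hE)]
    rfl
  have hllr : llr (Measure.pi Q ⊗ₘ T) (Measure.pi Q ⊗ₘ q) =ᵐ[Measure.pi Q ⊗ₘ T]
      fun p => Real.log (f p) := by
    have h1 := Measure.rnDeriv_withDensity (Measure.pi Q ⊗ₘ q) hfm.coe_nnreal_ennreal
    rw [← hjoint] at h1
    filter_upwards [hac.ae_le h1] with p hp
    simp [llr, hp]
  refine ⟨q, inferInstance, f, fun v u => ?_, hfm, hdens, hint.congr hllr, ?_, ?_⟩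
  · rw [hq, hq, others_update]
  · rw [← integral_congr_ae hllr, ← InformationTheory.toReal_klDiv_of_measure_eq hac (by simp)]
    exact ENNReal.toReal_mono hfin hKL
  -- Once the letter of user `k` is integrated out, only the other letters and the output remain.
  -- Their joint law is `PC ⊗ₘ qc`, so the integral becomes the total mass of the measure with
  -- density `f`.
  · let H : (∀ j : {j // j ≠ k}, 𝒱 j) × 𝒵 → ℝ≥0∞ :=
      fun p => ∫⁻ u, (f (glue k p.1 u, p.2) : ℝ≥0∞) ∂Q k
    have hmeas : Measurable fun x : ((∀ j : {j // j ≠ k}, 𝒱 j) × 𝒵) × 𝒱 k =>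
        (f (glue k x.1.1 x.2, x.1.2) : ℝ≥0∞) :=
      (hfm.comp (((measurable_glue k).comp (by fun_prop : Measurable
        fun x : ((∀ j : {j // j ≠ k}, 𝒱 j) × 𝒵) × 𝒱 k => (x.1.1, x.2))).prodMk
          (by fun_prop))).coe_nnreal_ennreal
    have hH : Measurable H := hmeas.lintegral_prod_right'
    have h1 : ∫⁻ p, ∫⁻ u, (f (Function.update p.1 k u, p.2) : ℝ≥0∞) ∂Q k ∂(Measure.pi Q ⊗ₘ T) =
        ∫⁻ p, H p ∂(PC ⊗ₘ qc) := by
      rw [← hPC, compProd_map_condDistrib hY.aemeasurable, lintegral_map hH (hC.prodMk hY), ← hlaw,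
        lintegral_map _ (hVm.prodMk hY)]
      · refine lintegral_congr fun ω => lintegral_congr fun u => ?_
        simp only
        rw [← glue_others]
        rfl
      · have : (fun p : (∀ i, 𝒱 i) × 𝒵 =>
            ∫⁻ u, (f (Function.update p.1 k u, p.2) : ℝ≥0∞) ∂Q k) =
            fun p => H (others k p.1, p.2) := by
          ext1 p
          simp only [H, glue_others]
        rw [this]
        exact hH.comp (((measurable_others k).comp measurable_fst).prodMk measurable_snd)
    rw [h1, Measure.lintegral_compProd hH]
    have h2 : ∀ c, ∫⁻ y, H (c, y) ∂qc c = ∫⁻ u, ∫⁻ y, (f (glue k c u, y) : ℝ≥0∞) ∂qc c ∂Q k := by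
      intro c
      refine lintegral_lintegral_swap ?_
      exact (hmeas.comp (by fun_prop : Measurable fun x : 𝒵 × 𝒱 k => ((c, x.1), x.2))).aemeasurable
    simp_rw [h2]
    have h3 : ∫⁻ v, ∫⁻ y, (f (v, y) : ℝ≥0∞) ∂q v ∂Measure.pi Q = 1 := by
      rw [← Measure.lintegral_compProd hfm.coe_nnreal_ennreal, ← setLIntegral_univ,
        ← withDensity_apply _ .univ, ← hjoint]
      simp
    have hin : Measurable fun v => ∫⁻ y, (f (v, y) : ℝ≥0∞) ∂q v :=
      hfm.coe_nnreal_ennreal.lintegral_kernel_prod_right'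
    have hin' : Measurable fun p : (∀ j : {j // j ≠ k}, 𝒱 j) × 𝒱 k =>
        ∫⁻ y, (f (glue k p.1 p.2, y) : ℝ≥0∞) ∂q (glue k p.1 p.2) := hin.comp (measurable_glue k)
    rw [← pi_map_glue Q k, lintegral_map hin (measurable_glue k),
      lintegral_prod _ hin'.aemeasurable] at h3
    refine le_of_eq (Eq.trans (lintegral_congr fun c => lintegral_congr fun u => ?_) h3)
    simp only [hq, others_glue]

/-! ### Codes built from a codebook -/

lemma pi_sum_smul {ι : Type*} [Fintype ι] [DecidableEq ι] {L : ι → Type*} [∀ i, Fintype (L i)]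
    {X : ι → Type*} [∀ i, MeasurableSpace (X i)] (c : ι → ℝ≥0∞) (hc : ∀ i, c i ≠ ∞)
    (ν : ∀ i, L i → Measure (X i)) [∀ i l, IsProbabilityMeasure (ν i l)] :
    Measure.pi (fun i => c i • ∑ l, ν i l) =
      (∏ i, c i) • ∑ l : ∀ i, L i, Measure.pi fun i => ν i (l i) := by
  have : ∀ i, IsFiniteMeasure (c i • ∑ l, ν i l) := fun i => by
    refine ⟨?_⟩
    rw [Measure.smul_apply, smul_eq_mul]
    exact ENNReal.mul_lt_top (hc i).lt_top (measure_lt_top _ _)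
  refine Measure.pi_eq fun s hs => ?_
  simp only [Measure.smul_apply, Measure.coe_finsetSum, Finset.sum_apply, smul_eq_mul,
    Measure.pi_pi]
  rw [Finset.prod_mul_distrib, Finset.prod_univ_sum]
  simp

section code

variable {K : ℕ} {𝒳 : Fin K → Type*} [∀ i, MeasurableSpace (𝒳 i)]
  {𝒴 : Option (Fin K) → Type*} [∀ j, MeasurableSpace (𝒴 j)]
  {𝒱 : Fin K → Type*} [∀ i, MeasurableSpace (𝒱 i)] {N : ℕ} {M L : Fin K → ℕ}

/-- Codebooks, listing for each time the letters of all codewords of all transmitters. -/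
abbrev Codebook (𝒱 : Fin K → Type*) (N : ℕ) (M L : Fin K → ℕ) : Type _ :=
  Fin N → ∀ p : (Σ k : Fin K, Fin (M k) × Fin (L k)), 𝒱 p.1

/-- The letters sent at time `t` if transmitter `k` uses its codeword with index `a k`. -/
def word (c : Codebook 𝒱 N M L) (a : ∀ k, Fin (M k) × Fin (L k)) (t : Fin N) (k : Fin K) : 𝒱 k :=
  c t ⟨k, a k⟩

/-- The stochastic encoder that picks one of the codewords of the message at random and sends it
through the kernels `κ`. -/
noncomputable def randomEncoder [∀ i, NeZero (L i)] (κ : Fin N → ∀ i, Kernel (𝒱 i) (𝒳 i))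
    [∀ t i, IsMarkovKernel (κ t i)] (c : Codebook 𝒱 N M L) (i : Fin K) :
    Kernel (Fin (M i)) (Fin N → 𝒳 i) :=
  Kernel.ofFunOfCountable fun m =>
    (L i : ℝ≥0∞)⁻¹ • ∑ l : Fin (L i), Measure.pi fun t => κ t i (c t ⟨i, (m, l)⟩)

lemma randomEncoder_apply [∀ i, NeZero (L i)] (κ : Fin N → ∀ i, Kernel (𝒱 i) (𝒳 i))
    [∀ t i, IsMarkovKernel (κ t i)] (c : Codebook 𝒱 N M L) (i : Fin K) (m : Fin (M i)) :
    randomEncoder κ c i m =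
      (L i : ℝ≥0∞)⁻¹ • ∑ l : Fin (L i), Measure.pi fun t => κ t i (c t ⟨i, (m, l)⟩) := rfl

instance [∀ i, NeZero (L i)] (κ : Fin N → ∀ i, Kernel (𝒱 i) (𝒳 i))
    [∀ t i, IsMarkovKernel (κ t i)] (c : Codebook 𝒱 N M L) (i : Fin K) :
    IsMarkovKernel (randomEncoder κ c i) := by
  refine ⟨fun m => ⟨?_⟩⟩
  rw [randomEncoder_apply]
  simp only [Measure.smul_apply, Measure.coe_finsetSum, Finset.sum_apply, measure_univ,
    Finset.sum_const, Finset.card_univ, Fintype.card_fin, smul_eq_mul, nsmul_eq_mul, mul_one]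
  exact ENNReal.inv_mul_cancel (by exact_mod_cast NeZero.ne (L i)) (ENNReal.natCast_ne_top _)

/-- The code with random encoders given by a codebook. -/
noncomputable abbrev codeOfCodebook (hM : ∀ i, NeZero (M i)) [∀ i, NeZero (L i)]
    (κ : Fin N → ∀ i, Kernel (𝒱 i) (𝒳 i)) [∀ t i, IsMarkovKernel (κ t i)]
    (c : Codebook 𝒱 N M L) (dec : ∀ i, (Fin N → 𝒴 (some i)) → Fin (M i))
    (hdec : ∀ i, Measurable (dec i)) : Code 𝒳 𝒴 N where
  M := M
  M_ne_zero := hM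
  enc := randomEncoder κ c
  isMarkovKernel_enc := fun _ => inferInstance
  dec := dec
  measurable_dec := hdec

/-- The channel from the auxiliary letters at time `t` to the outputs. -/
noncomputable def auxChannel (W : Kernel (∀ i, 𝒳 i) (∀ j, 𝒴 j)) (κ : ∀ i, Kernel (𝒱 i) (𝒳 i))
    [∀ i, IsMarkovKernel (κ i)] : Kernel (∀ i, 𝒱 i) (∀ j, 𝒴 j) :=
  W ∘ₖ piKernel κ

instance (W : Kernel (∀ i, 𝒳 i) (∀ j, 𝒴 j)) [IsMarkovKernel W] (κ : ∀ i, Kernel (𝒱 i) (𝒳 i))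
    [∀ i, IsMarkovKernel (κ i)] : IsMarkovKernel (auxChannel W κ) := by
  unfold auxChannel; infer_instance

/-- The channel from the auxiliary letters to the output of receiver `j`. -/
noncomputable def auxChannelTo (W : Kernel (∀ i, 𝒳 i) (∀ j, 𝒴 j)) (κ : ∀ i, Kernel (𝒱 i) (𝒳 i))
    [∀ i, IsMarkovKernel (κ i)] (j : Option (Fin K)) : Kernel (∀ i, 𝒱 i) (𝒴 j) :=
  (auxChannel W κ).map fun y => y j

instance (W : Kernel (∀ i, 𝒳 i) (∀ j, 𝒴 j)) [IsMarkovKernel W] (κ : ∀ i, Kernel (𝒱 i) (𝒳 i))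
    [∀ i, IsMarkovKernel (κ i)] (j : Option (Fin K)) : IsMarkovKernel (auxChannelTo W κ j) := by
  unfold auxChannelTo
  exact Kernel.IsMarkovKernel.map _ (measurable_pi_apply j)

/-- For fixed auxiliary letters, the inputs are independent over users and times. Flipping these two
indices displays the block as independent channel uses, each through `auxChannelTo`. -/
lemma lintegral_blockChannel (W : Kernel (∀ i, 𝒳 i) (∀ j, 𝒴 j)) [IsMarkovKernel W]
    (κ : Fin N → ∀ i, Kernel (𝒱 i) (𝒳 i)) [∀ t i, IsMarkovKernel (κ t i)] (v : Fin N → ∀ i, 𝒱 i)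
    (j : Option (Fin K)) {g : (Fin N → 𝒴 j) → ℝ≥0∞} (hg : Measurable g) :
    ∫⁻ x, ∫⁻ y, g (fun t => y t j) ∂blockChannel W N x
        ∂(Measure.pi fun i => Measure.pi fun t => κ t i (v t i)) =
      ∫⁻ y, g y ∂(Measure.pi fun t => auxChannelTo W (κ t) j (v t)) := by
  have hgj : Measurable fun y : Fin N → ∀ j, 𝒴 j => g fun t => y t j := hg.comp (by fun_prop)
  have h1 : ∀ x : ∀ i, Fin N → 𝒳 i, blockChannel W N x =
      piKernel (fun _ : Fin N => W) fun t i => x i t := fun x => rfl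
  simp_rw [h1]
  have hm : Measurable fun x : Fin N → ∀ i, 𝒳 i =>
      ∫⁻ y, g (fun t => y t j) ∂piKernel (fun _ : Fin N => W) x := hgj.lintegral_kernel
  have hflip : Measurable fun (x : ∀ i, Fin N → 𝒳 i) t i => x i t := by fun_prop
  rw [← lintegral_map hm hflip, pi_map_flip, ← Measure.lintegral_compProd
    (f := fun p : (Fin N → ∀ i, 𝒳 i) × (Fin N → ∀ j, 𝒴 j) => g fun t => p.2 t j)
    (hgj.comp measurable_snd)]
  have h2 := pi_compProd_piKernel (fun t => Measure.pi fun i => κ t i (v t i))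
    (fun _ : Fin N => W)
  have h3 : ∀ t, ((Measure.pi fun i => κ t i (v t i)) ⊗ₘ W).map (fun p => p.2 j) =
      auxChannelTo W (κ t) j (v t) := by
    intro t
    rw [auxChannelTo, Kernel.map_apply _ (measurable_pi_apply j), auxChannel, Kernel.comp_apply,
      ← piKernel_apply, ← Measure.snd_compProd, Measure.snd, Measure.map_map
      (measurable_pi_apply j) measurable_snd]
    rfl
  have : ∀ t, IsProbabilityMeasure (((Measure.pi fun i => κ t i (v t i)) ⊗ₘ W).map
      fun p => p.2 j) := fun t => by rw [h3]; infer_instance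
  have h4 : (Measure.pi fun t => auxChannelTo W (κ t) j (v t)) =
      (Measure.pi fun t => (Measure.pi fun i => κ t i (v t i)) ⊗ₘ W).map
        fun p t => (p t).2 j := by
    rw [Measure.pi_map_pi (f := fun _ (p : (∀ i, 𝒳 i) × (∀ j, 𝒴 j)) => p.2 j)
      fun t => by fun_prop]
    simp_rw [h3]
  rw [h4, lintegral_map hg (by fun_prop), ← h2, lintegral_map (by fun_prop) (by fun_prop)]

variable (hM : ∀ i, NeZero (M i)) [∀ i, NeZero (L i)]
  (W : Kernel (∀ i, 𝒳 i) (∀ j, 𝒴 j)) [IsMarkovKernel W]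
  (κ : Fin N → ∀ i, Kernel (𝒱 i) (𝒳 i)) [∀ t i, IsMarkovKernel (κ t i)]
  (c : Codebook 𝒱 N M L) (dec : ∀ i, (Fin N → 𝒴 (some i)) → Fin (M i))
  (hdec : ∀ i, Measurable (dec i))

/-- Uniform messages and uniform choices within each message block make the pairs (message, choice)
uniform, so the law of a transmission is an equal mixture over index tuples. -/
lemma lintegral_law {h : (codeOfCodebook hM κ c dec hdec).Space → ℝ≥0∞} (hh : Measurable h) :
    ∫⁻ ω, h ω ∂(codeOfCodebook hM κ c dec hdec).law W =
      (∑ a : ∀ k, Fin (M k) × Fin (L k), ∫⁻ x, ∫⁻ y, h ((fun k => (a k).1, x), y)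
        ∂blockChannel W N x ∂(Measure.pi fun i => Measure.pi fun t => κ t i (word c a t i))) /
        Fintype.card (∀ k, Fin (M k) × Fin (L k)) := by
  let C := codeOfCodebook hM κ c dec hdec
  have hu : ∀ i, IsProbabilityMeasure (uniformOn (Set.univ : Set (Fin (C.M i)))) := fun i =>
    isProbabilityMeasure_uniformOn Set.finite_univ Set.univ_nonempty
  have hk : ∀ i, IsMarkovKernel ((C.enc i).comap (fun w : ∀ i, Fin (C.M i) => w i)
      (measurable_pi_apply i)) := fun i => inferInstance
  rw [Code.law, Measure.lintegral_compProd hh]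
  have hm1 : Measurable fun p : (∀ i, Fin (C.M i)) × (∀ i, Fin N → 𝒳 i) =>
      ∫⁻ y, h (p, y) ∂((blockChannel W N).prodMkLeft (∀ i, Fin (C.M i))) p :=
    hh.lintegral_kernel_prod_right'
  rw [Measure.lintegral_compProd hm1, lintegral_fintype]
  have hw : ∀ w : ∀ i, Fin (C.M i),
      (Measure.pi fun i => uniformOn (Set.univ : Set (Fin (C.M i)))) {w} =
        ∏ i, (M i : ℝ≥0∞)⁻¹ := by
    intro w
    rw [Measure.pi_singleton]
    refine Finset.prod_congr rfl fun i _ => ?_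
    rw [uniformOn_univ, Measure.count_singleton, Fintype.card_fin, one_div]
  have hker : ∀ w : ∀ i, Fin (C.M i), prodKernel (fun i => (C.enc i).comap
      (fun w : ∀ i, Fin (C.M i) => w i) (measurable_pi_apply i)) w =
      (∏ i, (L i : ℝ≥0∞)⁻¹) • ∑ l : ∀ i, Fin (L i), Measure.pi fun i => Measure.pi fun t =>
        κ t i (word c (fun k => (w k, l k)) t i) := by
    intro w
    rw [prodKernel_apply]
    exact pi_sum_smul (fun i => (L i : ℝ≥0∞)⁻¹)
      (fun i => ENNReal.inv_ne_top.2 (by exact_mod_cast NeZero.ne (L i)))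
      (fun i (l : Fin (L i)) => Measure.pi fun t => κ t i (c t ⟨i, (w i, l)⟩))
  have hterm : ∀ w : ∀ i, Fin (C.M i),
      (∫⁻ x, ∫⁻ y, h ((w, x), y) ∂((blockChannel W N).prodMkLeft (∀ i, Fin (C.M i))) (w, x)
        ∂prodKernel (fun i => (C.enc i).comap (fun w : ∀ i, Fin (C.M i) => w i)
          (measurable_pi_apply i)) w) *
        (Measure.pi fun i => uniformOn (Set.univ : Set (Fin (C.M i)))) {w} =
      (∏ i, (L i : ℝ≥0∞)⁻¹) * (∑ l : ∀ i, Fin (L i), ∫⁻ x, ∫⁻ y, h ((w, x), y)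
        ∂blockChannel W N x ∂(Measure.pi fun i => Measure.pi fun t =>
          κ t i (word c (fun k => (w k, l k)) t i))) * ∏ i, (M i : ℝ≥0∞)⁻¹ := by
    intro w
    rw [hw, hker, lintegral_smul_measure, lintegral_finsetSum_measure, smul_eq_mul]
    rfl
  rw [Finset.sum_congr rfl fun w _ => hterm w]
  rw [← Finset.sum_mul, ← Finset.mul_sum, mul_comm, ← mul_assoc, mul_comm _ (∑ _, _),
    ENNReal.div_eq_inv_mul, mul_comm]
  congr 1
  · rw [Fintype.card_pi, ← Finset.prod_mul_distrib]
    push_cast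
    rw [ENNReal.prod_inv_distrib]
    · refine Finset.prod_congr rfl fun i _ => ?_
      rw [Fintype.card_prod, Fintype.card_fin, Fintype.card_fin]
      push_cast
      rw [ENNReal.mul_inv (Or.inr (ENNReal.natCast_ne_top _))
        (Or.inl (ENNReal.natCast_ne_top _))]
    · intro i _ j _ _
      exact Or.inr (ENNReal.natCast_ne_top _)
  · rw [← Fintype.sum_prod_type']
    refine Fintype.sum_equiv (Equiv.arrowProdEquivProdArrow _ _ _).symm _ _ fun p => ?_
    rfl

lemma law_apply (j : Option (Fin K)) {s : Set ((∀ i, Fin (M i)) × (Fin N → 𝒴 j))}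
    (hs : MeasurableSet s) :
    (codeOfCodebook hM κ c dec hdec).law W
        {ω | ((codeOfCodebook hM κ c dec hdec).msgAll ω,
          (codeOfCodebook hM κ c dec hdec).output j ω) ∈ s} =
      (∑ a : ∀ k, Fin (M k) × Fin (L k),
        (Measure.pi fun t => auxChannelTo W (κ t) j (word c a t))
          {y | ((fun k => (a k).1), y) ∈ s}) / Fintype.card (∀ k, Fin (M k) × Fin (L k)) := by
  have hmeas : Measurable fun ω : (codeOfCodebook hM κ c dec hdec).Space =>
      ((codeOfCodebook hM κ c dec hdec).msgAll ω, (codeOfCodebook hM κ c dec hdec).output j ω) := by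
    unfold Code.msgAll Code.msg Code.output
    fun_prop
  have hset : MeasurableSet {ω | ((codeOfCodebook hM κ c dec hdec).msgAll ω,
      (codeOfCodebook hM κ c dec hdec).output j ω) ∈ s} := hmeas hs
  rw [← lintegral_indicator_one hset, lintegral_law hM W κ c dec hdec
    (measurable_one.indicator hset)]
  congr 1
  refine Finset.sum_congr rfl fun a _ => ?_
  have hsa : MeasurableSet {y | ((fun k => (a k).1), y) ∈ s} := measurable_prodMk_left hs
  rw [← lintegral_indicator_one hsa, ← lintegral_blockChannel W κ (word c a) j
    (measurable_one.indicator hsa)]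
  rfl

lemma lintegral_cost {cost : ∀ i, 𝒳 i → ℝ≥0} (hcost : ∀ i, Measurable (cost i)) (i : Fin K)
    (t : Fin N) :
    ∫⁻ ω, cost i ((codeOfCodebook hM κ c dec hdec).input i t ω)
        ∂(codeOfCodebook hM κ c dec hdec).law W =
      (∑ a : ∀ k, Fin (M k) × Fin (L k), ∫⁻ x, cost i x ∂κ t i (word c a t i)) /
        Fintype.card (∀ k, Fin (M k) × Fin (L k)) := by
  have hm : Measurable fun ω : (codeOfCodebook hM κ c dec hdec).Space =>
      (cost i ((codeOfCodebook hM κ c dec hdec).input i t ω) : ℝ≥0∞) := by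
    unfold Code.input
    exact ((hcost i).comp (by fun_prop)).coe_nnreal_ennreal
  rw [lintegral_law hM W κ c dec hdec hm]
  congr 1
  refine Finset.sum_congr rfl fun a _ => ?_
  simp only [Code.input, lintegral_const, measure_univ, mul_one]
  have h1 : (Measure.pi fun i => Measure.pi fun t => κ t i (word c a t i)).map
      (fun x : ∀ i, Fin N → 𝒳 i => x i t) = κ t i (word c a t i) := by
    rw [← (measurePreserving_eval (fun t => κ t i (word c a t i)) t).map_eq,
      ← (measurePreserving_eval (fun i => Measure.pi fun t => κ t i (word c a t i)) i).map_eq,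
      Measure.map_map (measurable_pi_apply t) (measurable_pi_apply i)]
    rfl
  rw [← h1, lintegral_map (hcost i).coe_nnreal_ennreal (by fun_prop)]

end code

/-! ### Random codebooks -/

section average

set_option linter.unusedSectionVars false

variable {K : ℕ} {𝒱 : Fin K → Type*} [∀ i, MeasurableSpace (𝒱 i)] {N : ℕ} {M L : Fin K → ℕ}
  {𝒵 : Type*} [MeasurableSpace 𝒵]

/-- The law of a codebook all of whose letters are independent, those of transmitter `i` having
law `Q i`. -/
noncomputable def codebookLaw (N : ℕ) (M L : Fin K → ℕ) (Q : ∀ i, Measure (𝒱 i)) :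
    Measure (Codebook 𝒱 N M L) :=
  Measure.pi fun _ : Fin N => Measure.pi fun p : (Σ k : Fin K, Fin (M k) × Fin (L k)) => Q p.1

instance (Q : ∀ i, Measure (𝒱 i)) [∀ i, IsProbabilityMeasure (Q i)] :
    IsProbabilityMeasure (codebookLaw N M L Q) := by
  unfold codebookLaw; infer_instance

lemma measurable_word (a : ∀ k, Fin (M k) × Fin (L k)) :
    Measurable fun c : Codebook 𝒱 N M L => word c a := by
  unfold word
  fun_prop

lemma word_update (c : Codebook 𝒱 N M L) (a : ∀ k, Fin (M k) × Fin (L k)) (k : Fin K)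
    (b : Fin (M k) × Fin (L k)) (t : Fin N) :
    word c (Function.update a k b) t = Function.update (word c a t) k (c t ⟨k, b⟩) := by
  ext1 j
  by_cases h : j = k
  · subst h
    rw [word, Function.update_self, Function.update_self]
  · rw [word, Function.update_of_ne h, Function.update_of_ne h, word]

/-- The map `π` reads the needed letters out of one time slice. Slices are independent, so averaging
over codebooks turns the letters read and the outputs into a product over time. -/
lemma lintegral_codebook {E : Type*} [MeasurableSpace E] (Q : ∀ i, Measure (𝒱 i))
    [∀ i, IsProbabilityMeasure (Q i)] {π : (∀ p : (Σ k : Fin K, Fin (M k) × Fin (L k)), 𝒱 p.1) → E}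
    (hπ : Measurable π) (T : Fin N → Kernel E 𝒵) [∀ t, IsMarkovKernel (T t)]
    {h : (Fin N → E × 𝒵) → ℝ≥0∞} (hh : Measurable h) :
    ∫⁻ c, ∫⁻ y, h (fun t => (π (c t), y t)) ∂(Measure.pi fun t => T t (π (c t)))
        ∂codebookLaw N M L Q =
      ∫⁻ z, h z ∂(Measure.pi fun t => (Measure.pi fun p : (Σ k : Fin K, Fin (M k) × Fin (L k)) =>
        Q p.1).map π ⊗ₘ T t) := by
  set Q' := (Measure.pi fun p : (Σ k : Fin K, Fin (M k) × Fin (L k)) => Q p.1).map π with hQ'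
  have hQp : IsProbabilityMeasure Q' := Measure.isProbabilityMeasure_map hπ.aemeasurable
  have hzip : Measurable fun (p : (Fin N → E) × (Fin N → 𝒵)) t => (p.1 t, p.2 t) := by fun_prop
  have hhz : Measurable fun p : (Fin N → E) × (Fin N → 𝒵) => h fun t => (p.1 t, p.2 t) :=
    hh.comp hzip
  rw [← pi_compProd_piKernel, lintegral_map hh hzip, Measure.lintegral_compProd hhz]
  have hmap : (codebookLaw N M L Q).map (fun c t => π (c t)) = Measure.pi fun _ : Fin N => Q' :=
    Measure.pi_map_pi fun _ => hπ.aemeasurable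
  rw [← hmap, lintegral_map _ (by fun_prop)]
  · rfl
  · exact hhz.lintegral_kernel_prod_right'

lemma codebook_letter_map_word (Q : ∀ i, Measure (𝒱 i)) [∀ i, IsProbabilityMeasure (Q i)]
    (a : ∀ k, Fin (M k) × Fin (L k)) :
    (Measure.pi fun p : (Σ k : Fin K, Fin (M k) × Fin (L k)) => Q p.1).map
      (fun x k => x ⟨k, a k⟩) = Measure.pi Q :=
  pi_map_comp_injective (fun p : (Σ k : Fin K, Fin (M k) × Fin (L k)) => Q p.1)
    (e := fun k => ⟨k, a k⟩) fun _ _ h => congrArg Sigma.fst h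

/-- A codeword of user `k` that is not sent is independent of everything sent, whether its message
or only its local randomness differs. -/
lemma codebook_letter_map_word_prod (Q : ∀ i, Measure (𝒱 i)) [∀ i, IsProbabilityMeasure (Q i)]
    (a : ∀ k, Fin (M k) × Fin (L k)) (k : Fin K) {b : Fin (M k) × Fin (L k)} (hb : b ≠ a k) :
    (Measure.pi fun p : (Σ k : Fin K, Fin (M k) × Fin (L k)) => Q p.1).map
      (fun x => ((fun k => x ⟨k, a k⟩ : ∀ k, 𝒱 k), x ⟨k, b⟩)) = (Measure.pi Q).prod (Q k) := by
  -- The unsent codeword sits at `none` and the sent ones at `some j`; injectivity is where `b ≠ a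
  -- k` enters.
  let e : Option (Fin K) → Σ k : Fin K, Fin (M k) × Fin (L k) := fun o => o.elim ⟨k, b⟩
    fun j => ⟨j, a j⟩
  have he : Function.Injective e := by
    rintro (_ | j) (_ | j') h
    · rfl
    · simp only [e, Option.elim, Sigma.mk.injEq] at h
      obtain ⟨rfl, h⟩ := h
      exact absurd (eq_of_heq h) hb
    · simp only [e, Option.elim, Sigma.mk.injEq] at h
      obtain ⟨rfl, h⟩ := h
      exact absurd (eq_of_heq h).symm hb
    · exact congrArg some (congrArg Sigma.fst h)
  have h1 := pi_map_comp_injective (fun p : (Σ k : Fin K, Fin (M k) × Fin (L k)) => Q p.1) he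
  have h2 := Measure.pi_map_piOptionEquivProd (β := fun o => 𝒱 (e o).1) fun o => Q (e o).1
  rw [← h1] at h2
  have h3 := congrArg (fun m => m.map (MeasurableEquiv.piOptionEquivProd fun o => 𝒱 (e o).1)) h2
  rw [Measure.map_map (MeasurableEquiv.measurable _) (MeasurableEquiv.measurable _),
    Measure.map_map (MeasurableEquiv.measurable _) (by fun_prop)] at h3
  simp only [MeasurableEquiv.self_comp_symm, Measure.map_id] at h3
  exact h3.symm

lemma lintegral_codebook_word (Q : ∀ i, Measure (𝒱 i)) [∀ i, IsProbabilityMeasure (Q i)]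
    (a : ∀ k, Fin (M k) × Fin (L k)) (T : Fin N → Kernel (∀ i, 𝒱 i) 𝒵) [∀ t, IsMarkovKernel (T t)]
    {h : (Fin N → (∀ i, 𝒱 i) × 𝒵) → ℝ≥0∞} (hh : Measurable h) :
    ∫⁻ c, ∫⁻ y, h (fun t => (word c a t, y t)) ∂(Measure.pi fun t => T t (word c a t))
        ∂codebookLaw N M L Q =
      ∫⁻ z, h z ∂(Measure.pi fun t => Measure.pi Q ⊗ₘ T t) := by
  have h1 := lintegral_codebook Q (π := fun x k => x ⟨k, a k⟩) (by fun_prop) T hh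
  rw [codebook_letter_map_word] at h1
  exact h1

/-- Used for both kinds of competing codewords: those that could mislead the decoder, and those that
help to hide the message. -/
lemma lintegral_codebook_word_prod (Q : ∀ i, Measure (𝒱 i)) [∀ i, IsProbabilityMeasure (Q i)]
    (a : ∀ k, Fin (M k) × Fin (L k)) (k : Fin K) {b : Fin (M k) × Fin (L k)} (hb : b ≠ a k)
    (T : Fin N → Kernel (∀ i, 𝒱 i) 𝒵) [∀ t, IsMarkovKernel (T t)]
    {h : Fin N → ((∀ i, 𝒱 i) × 𝒵) × 𝒱 k → ℝ≥0∞} (hh : ∀ t, Measurable (h t)) :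
    ∫⁻ c, ∫⁻ y, ∏ t, h t ((word c a t, y t), c t ⟨k, b⟩)
        ∂(Measure.pi fun t => T t (word c a t)) ∂codebookLaw N M L Q =
      ∏ t, ∫⁻ p, ∫⁻ u, h t (p, u) ∂Q k ∂(Measure.pi Q ⊗ₘ T t) := by
  let T' : Fin N → Kernel ((∀ i, 𝒱 i) × 𝒱 k) 𝒵 := fun t => (T t).comap Prod.fst measurable_fst
  have hswap : Measurable fun p : ((∀ i, 𝒱 i) × 𝒱 k) × 𝒵 => ((p.1.1, p.2), p.1.2) := by fun_prop
  have hs : ∀ t, Measurable fun p : ((∀ i, 𝒱 i) × 𝒱 k) × 𝒵 => h t ((p.1.1, p.2), p.1.2) :=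
    fun t => (hh t).comp hswap
  have hh' : Measurable fun z : Fin N → ((∀ i, 𝒱 i) × 𝒱 k) × 𝒵 =>
      ∏ t, h t (((z t).1.1, (z t).2), (z t).1.2) :=
    Finset.measurable_prod _ fun t _ => (hs t).comp (measurable_pi_apply t)
  have h1 := lintegral_codebook Q (π := fun x => ((fun k => x ⟨k, a k⟩ : ∀ k, 𝒱 k), x ⟨k, b⟩))
    (by fun_prop) T' hh'
  rw [codebook_letter_map_word_prod Q a k hb] at h1
  refine Eq.trans h1 ?_
  rw [lintegral_pi_prod _ hs]
  refine Finset.prod_congr rfl fun t _ => ?_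
  rw [Measure.lintegral_compProd (hs t), lintegral_prod _
      (hs t).lintegral_kernel_prod_right'.aemeasurable,
    Measure.lintegral_compProd (hh t).lintegral_prod_right']
  refine lintegral_congr fun v => ?_
  refine lintegral_lintegral_swap (μ := Q k) (ν := T t v) ?_
  exact ((hh t).comp (by fun_prop : Measurable fun x : 𝒱 k × 𝒵 => ((v, x.2), x.1))).aemeasurable

end average

/-! ### The law of the auxiliary letters and an output -/

/-- Independence of the pairs makes the joint law of auxiliary variables and inputs a product
kernel, and the channel hypothesis adds the outputs. This ties the given random variables to the
kernels from which codes are built. -/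
lemma map_aux_output {K : ℕ} {𝒳 : Fin K → Type*} [∀ i, MeasurableSpace (𝒳 i)]
    [∀ i, StandardBorelSpace (𝒳 i)] [∀ i, Nonempty (𝒳 i)]
    {𝒴 : Option (Fin K) → Type*} [∀ j, MeasurableSpace (𝒴 j)]
    (W : Kernel (∀ i, 𝒳 i) (∀ j, 𝒴 j)) [IsMarkovKernel W]
    {𝒱 : Fin K → Type*} [∀ i, MeasurableSpace (𝒱 i)]
    {Ω : Type*} [MeasurableSpace Ω] (μ : Measure Ω) [IsProbabilityMeasure μ]
    {V : ∀ i, Ω → 𝒱 i} {X : ∀ i, Ω → 𝒳 i} {Y : ∀ j, Ω → 𝒴 j}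
    (hV : ∀ i, Measurable (V i)) (hX : ∀ i, Measurable (X i)) (hY : ∀ j, Measurable (Y j))
    (hVX : iIndepFun (fun i ω => (V i ω, X i ω)) μ)
    (hchan : HasCondDistrib (fun ω j => Y j ω) (fun ω => (fun i => V i ω, fun i => X i ω))
      (W.prodMkLeft (∀ i, 𝒱 i)) μ) (j : Option (Fin K)) :
    μ.map (fun ω => ((fun i => V i ω), Y j ω)) =
      Measure.pi (fun i => μ.map (V i)) ⊗ₘ
        auxChannelTo W (fun i => condDistrib (X i) (V i) μ) j := by
  have hQ : ∀ i, IsProbabilityMeasure (μ.map (V i)) := fun i =>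
    Measure.isProbabilityMeasure_map (hV i).aemeasurable
  let κ : ∀ i, Kernel (𝒱 i) (𝒳 i) := fun i => condDistrib (X i) (V i) μ
  have hpair : μ.map (fun ω => (fun i => V i ω, fun i => X i ω)) =
      Measure.pi (fun i => μ.map (V i)) ⊗ₘ piKernel κ := by
    have h1 := (iIndepFun_iff_map_fun_eq_pi_map
      fun i => ((hV i).prodMk (hX i)).aemeasurable).1 hVX
    have h2 : (fun i => μ.map fun ω => (V i ω, X i ω)) = fun i => μ.map (V i) ⊗ₘ κ i :=
      funext fun i => (compProd_map_condDistrib (hX i).aemeasurable).symm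
    rw [h2, ← pi_compProd_piKernel] at h1
    have h3 := congrArg (fun m => m.map fun z : ∀ i, 𝒱 i × 𝒳 i =>
      ((fun i => (z i).1, fun i => (z i).2) : (∀ i, 𝒱 i) × (∀ i, 𝒳 i))) h1
    rw [Measure.map_map (by fun_prop) (by fun_prop), Measure.map_map (by fun_prop)
      (by fun_prop)] at h3
    exact h3.trans Measure.map_id
  have hj : Measurable fun p : ((∀ i, 𝒱 i) × (∀ i, 𝒳 i)) × (∀ j, 𝒴 j) => (p.1.1, p.2 j) := by
    fun_prop
  have h4 := congrArg (fun m => m.map fun p : ((∀ i, 𝒱 i) × (∀ i, 𝒳 i)) × (∀ j, 𝒴 j) =>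
    (p.1.1, p.2 j)) hchan.map_eq
  rw [hpair, Measure.map_map hj (by fun_prop)] at h4
  refine Eq.trans h4 (Measure.ext_of_lintegral _ fun f hf => ?_)
  have hfj : Measurable fun p : ((∀ i, 𝒱 i) × (∀ i, 𝒳 i)) × (∀ j, 𝒴 j) =>
      f (p.1.1, p.2 j) := hf.comp hj
  have hfj' : Measurable fun p : (∀ i, 𝒱 i) × (∀ j, 𝒴 j) => f (p.1, p.2 j) :=
    hf.comp (by fun_prop)
  rw [lintegral_map hf hj, Measure.lintegral_compProd hfj, Measure.lintegral_compProd
    hfj.lintegral_kernel_prod_right', Measure.lintegral_compProd hf]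
  refine lintegral_congr fun v => ?_
  have hfv : Measurable fun z => f (v, z) := hf.comp measurable_prodMk_left
  have hfvj : Measurable fun y : ∀ j, 𝒴 j => f (v, y j) := hfv.comp (measurable_pi_apply j)
  rw [auxChannelTo, Kernel.lintegral_map _ (measurable_pi_apply j) _ hfv, auxChannel,
    Kernel.lintegral_comp _ _ _ hfvj]
  rfl

/-! ### Averages over the index tuples -/

lemma sum_div_card_le {α : Type*} [Fintype α] {f : α → ℝ≥0∞} {C : ℝ≥0∞} (h : ∀ a, f a ≤ C) :
    (∑ a, f a) / Fintype.card α ≤ C := by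
  refine ENNReal.div_le_of_le_mul ?_
  refine (Finset.sum_le_card_nsmul _ _ C fun a _ => h a).trans ?_
  rw [nsmul_eq_mul, mul_comm, Finset.card_univ]

section decoding

set_option linter.unusedSectionVars false

variable {K : ℕ} {𝒱 : Fin K → Type*} [∀ i, MeasurableSpace (𝒱 i)] {𝒵 : Type*} [MeasurableSpace 𝒵]

lemma measurable_lintegral_word {N : ℕ} {M L : Fin K → ℕ} (T : Fin N → Kernel (∀ i, 𝒱 i) 𝒵)
    [∀ t, IsMarkovKernel (T t)] (a : ∀ k, Fin (M k) × Fin (L k))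
    {f : Codebook 𝒱 N M L × (Fin N → 𝒵) → ℝ≥0∞} (hf : Measurable f) :
    Measurable fun c => ∫⁻ y, f (c, y) ∂Measure.pi fun t => T t (word c a t) :=
  (hf.lintegral_kernel_prod_right' (κ := (piKernel T).comap (fun c => word c a)
    (measurable_word a)))

/-- The threshold decoder of transmitter `i`: it looks for a message one of whose codewords has a
score above the threshold `θ`. -/
noncomputable def thresholdDecoder {N : ℕ} {M L : Fin K → ℕ} (i : Fin K) [NeZero (M i)]
    (g : 𝒱 i × 𝒵 → ℝ) (S : Finset (Fin N)) (θ : ℝ) (c : Codebook 𝒱 N M L) (y : Fin N → 𝒵) :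
    Fin (M i) :=
  -- An arbitrary message is returned if no score exceeds the threshold. The choice depends only on
  -- which of finitely many messages qualify, hence is measurable.
  Classical.epsilon fun m => ∃ l, θ < ∑ t ∈ S, g (c t ⟨i, (m, l)⟩, y t)

lemma measurable_thresholdDecoder {N : ℕ} {M L : Fin K → ℕ} (i : Fin K) [NeZero (M i)]
    {g : 𝒱 i × 𝒵 → ℝ} (hg : Measurable g) (S : Finset (Fin N)) (θ : ℝ) (c : Codebook 𝒱 N M L) :
    Measurable (thresholdDecoder i g S θ c) := by
  have h1 : Measurable fun y : Fin N → 𝒵 => fun m => ∃ l,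
      θ < ∑ t ∈ S, g (c t ⟨i, (m, l)⟩, y t) := by
    refine measurable_pi_iff.2 fun m => Measurable.exists fun l => ?_
    refine measurableSet_setOfPred.1 (measurableSet_lt measurable_const ?_)
    fun_prop
  have h2 : Measurable fun p : Fin (M i) → Prop => Classical.epsilon p :=
    .of_discrete
  exact h2.comp h1

lemma thresholdDecoder_ne {N : ℕ} {M L : Fin K → ℕ} (i : Fin K) [NeZero (M i)]
    {g : 𝒱 i × 𝒵 → ℝ} {S : Finset (Fin N)} {θ : ℝ} {c : Codebook 𝒱 N M L} {y : Fin N → 𝒵}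
    {b : Fin (M i) × Fin (L i)} (h : thresholdDecoder i g S θ c y ≠ b.1) :
    ∑ t ∈ S, g (c t ⟨i, b⟩, y t) ≤ θ ∨ ∃ b', b' ≠ b ∧ θ < ∑ t ∈ S, g (c t ⟨i, b'⟩, y t) := by
  by_contra! hc
  obtain ⟨l, hl⟩ := Classical.epsilon_spec
    (p := fun m => ∃ l, θ < ∑ t ∈ S, g (c t ⟨i, (m, l)⟩, y t)) ⟨b.1, b.2, hc.1⟩
  rw [thresholdDecoder] at h
  refine absurd hl (not_lt.2 (hc.2 _ fun hb => h ?_))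
  rw [← hb]

/-- The error indicator is bounded pointwise: a Markov term if the sent codeword scores low, and a
Chernoff term for each other codeword that scores high. Both have computable averages over
codebooks. -/
lemma measure_thresholdDecoder_ne_le {N : ℕ} {M L : Fin K → ℕ} (i : Fin K) [NeZero (M i)]
    {g : 𝒱 i × 𝒵 → ℝ} (hg : Measurable g) (S : Finset (Fin N)) {θ u δ : ℝ} (hδ : 0 < δ)
    (hS : 0 < S.card) (hθ : θ ≤ S.card * (u - δ)) (c : Codebook 𝒱 N M L)
    (b : Fin (M i) × Fin (L i)) (ν : Measure (Fin N → 𝒵)) :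
    ν {y | thresholdDecoder i g S θ c y ≠ b.1} ≤
      ∫⁻ y, (ENNReal.ofReal |∑ t ∈ S, g (c t ⟨i, b⟩, y t) - S.card * u| /
          ENNReal.ofReal (S.card * δ) +
        ∑ b' ∈ Finset.univ.erase b, ENNReal.ofReal (Real.exp (-θ)) *
          ∏ t, if t ∈ S then ENNReal.ofReal (Real.exp (g (c t ⟨i, b'⟩, y t))) else 1) ∂ν := by
  have hms : MeasurableSet {y | thresholdDecoder i g S θ c y ≠ b.1} :=
    measurable_thresholdDecoder i hg S θ c (.of_discrete (s := {b.1}ᶜ))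
  rw [← lintegral_indicator_one hms]
  refine lintegral_mono fun y => ?_
  by_cases hy : y ∈ {y | thresholdDecoder i g S θ c y ≠ b.1}
  swap
  · rw [Set.indicator_of_notMem hy]; exact zero_le
  rw [Set.indicator_of_mem hy, Pi.one_apply]
  have hn : (0 : ℝ) < S.card := by exact_mod_cast hS
  rcases thresholdDecoder_ne i hy with h | ⟨b', hb', h⟩
  · refine le_trans ?_ le_self_add
    rw [ENNReal.le_div_iff_mul_le (by simp [hS.ne', hδ]) (by simp), one_mul]
    refine ENNReal.ofReal_le_ofReal ?_
    rw [abs_sub_comm]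
    refine le_trans ?_ (le_abs_self _)
    nlinarith
  · refine le_trans ?_ le_add_self
    refine le_trans ?_ (Finset.single_le_sum (fun _ _ => zero_le)
      (Finset.mem_erase.2 ⟨hb', Finset.mem_univ _⟩))
    rw [Finset.prod_ite_mem, Finset.univ_inter, ← ENNReal.ofReal_prod_of_nonneg
      fun _ _ => (Real.exp_pos _).le, ← Real.exp_sum, ← ENNReal.ofReal_mul (Real.exp_pos _).le,
      ← Real.exp_add]
    rw [← ENNReal.ofReal_one]
    refine ENNReal.ofReal_le_ofReal (Real.one_le_exp ?_)
    linarith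

/-- Reliability of the threshold decoder for random codebooks: its average error probability tends
to zero at rates below the divergence. -/
lemma exists_decoder_of_lt (Q : ∀ i, Measure (𝒱 i)) [∀ i, IsProbabilityMeasure (Q i)]
    (T : Kernel (∀ i, 𝒱 i) 𝒵) [IsMarkovKernel T] (i : Fin K) {R₀ : ℝ}
    (hR : ENNReal.ofReal R₀ < InformationTheory.klDiv
      ((Measure.pi Q ⊗ₘ T).map fun p => (p.1 i, p.2))
      ((Q i).prod ((Measure.pi Q ⊗ₘ T).map Prod.snd))) :
    ∃ η : ℕ → ℝ≥0∞, Filter.Tendsto η Filter.atTop (nhds 0) ∧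
      ∀ (N : ℕ) (M L : Fin K → ℕ) [NeZero (M i)] (S : Finset (Fin N))
        (T' : Fin N → Kernel (∀ i, 𝒱 i) 𝒵) [∀ t, IsMarkovKernel (T' t)],
        (∀ t ∈ S, T' t = T) → 0 < S.card →
        (M i * L i : ℝ) ≤ 4 * Real.exp (S.card * R₀) →
        ∃ dec : Codebook 𝒱 N M L → (Fin N → 𝒵) → Fin (M i), (∀ c, Measurable (dec c)) ∧
          ∃ err : Codebook 𝒱 N M L → ℝ≥0∞, Measurable err ∧
            (∀ c, (∑ a : ∀ k, Fin (M k) × Fin (L k),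
              (Measure.pi fun t => T' t (word c a t)) {y | dec c y ≠ (a i).1}) /
                Fintype.card (∀ k, Fin (M k) × Fin (L k)) ≤ err c) ∧
            ∫⁻ c, err c ∂codebookLaw N M L Q ≤ η S.card := by
  have hmi : Measurable fun p : (∀ i, 𝒱 i) × 𝒵 => (p.1 i, p.2) := by fun_prop
  have := Measure.isProbabilityMeasure_map (μ := Measure.pi Q ⊗ₘ T) hmi.aemeasurable
  have := Measure.isProbabilityMeasure_map (μ := Measure.pi Q ⊗ₘ T) measurable_snd.aemeasurable
  obtain ⟨g, hg, ⟨C, hC⟩, hg1, hgR⟩ := exists_bounded_test hR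
  set u := ∫ z, g z ∂((Measure.pi Q ⊗ₘ T).map fun p => (p.1 i, p.2)) with hu
  -- Half of the gap goes to the deviation of the sent codeword's score, half to the union bound.
  set δ := (u - R₀) / 2 with hδ
  have hδ0 : 0 < δ := by linarith
  have hgi : Measurable fun p : (∀ i, 𝒱 i) × 𝒵 => g (p.1 i, p.2) := hg.comp hmi
  have hint : Integrable (fun p : (∀ i, 𝒱 i) × 𝒵 => g (p.1 i, p.2)) (Measure.pi Q ⊗ₘ T) :=
    Integrable.of_bound hgi.aestronglyMeasurable C (.of_forall fun p => by simpa using hC _)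
  obtain ⟨η, hη, hηb⟩ := exists_l1_rate (Measure.pi Q ⊗ₘ T) hgi hint
  have hmean : ∫ p, g (p.1 i, p.2) ∂(Measure.pi Q ⊗ₘ T) = u := by
    rw [hu, integral_map hmi.aemeasurable hg.aestronglyMeasurable]
  rw [hmean] at hηb
  -- The second summand counts at most `4 * exp (n * R₀)` competitors, each with Chernoff weight
  -- `exp (-θ)`, where `θ = n * (R₀ + δ)`.
  refine ⟨fun n => η n / ENNReal.ofReal δ + ENNReal.ofReal (4 * Real.exp (-(n * δ))), ?_, ?_⟩
  · rw [← add_zero (0 : ℝ≥0∞)]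
    refine Filter.Tendsto.add ?_ ?_
    · have := ENNReal.Tendsto.div_const (b := ENNReal.ofReal δ) hη (Or.inr (by simpa using hδ0))
      simpa using this
    · rw [← ENNReal.ofReal_zero]
      refine ENNReal.tendsto_ofReal ?_
      have h1 : Filter.Tendsto (fun n : ℕ => (n : ℝ) * δ) Filter.atTop Filter.atTop :=
        tendsto_natCast_atTop_atTop.atTop_mul_const hδ0
      simpa using (Real.tendsto_exp_neg_atTop_nhds_zero.comp h1).const_mul 4
  intro N M L _ S T' _ hT' hS hML
  set θ := S.card * (u - δ) with hθ
  refine ⟨thresholdDecoder i g S θ, fun c => measurable_thresholdDecoder i hg S θ c, ?_⟩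
  let F : ∀ a : ∀ k, Fin (M k) × Fin (L k), Codebook 𝒱 N M L × (Fin N → 𝒵) → ℝ≥0∞ := fun a p =>
    ENNReal.ofReal |∑ t ∈ S, g (p.1 t ⟨i, a i⟩, p.2 t) - S.card * u| /
        ENNReal.ofReal (S.card * δ)
  let G : ∀ b : Fin (M i) × Fin (L i), Codebook 𝒱 N M L × (Fin N → 𝒵) → ℝ≥0∞ := fun b p =>
    ∏ t, if t ∈ S then ENNReal.ofReal (Real.exp (g (p.1 t ⟨i, b⟩, p.2 t))) else 1
  have hF : ∀ a, Measurable (F a) := fun a => by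
    refine Measurable.div_const ?_ _
    fun_prop
  have hG : ∀ b, Measurable (G b) := fun b => by
    refine Finset.measurable_prod _ fun t _ => ?_
    split_ifs
    · fun_prop
    · exact measurable_const
  have hFG : ∀ a, Measurable fun p => F a p + ∑ b ∈ Finset.univ.erase (a i),
      ENNReal.ofReal (Real.exp (-θ)) * G b p := fun a => by fun_prop
  refine ⟨fun c => (∑ a : ∀ k, Fin (M k) × Fin (L k),
    ∫⁻ y, (F a (c, y) + ∑ b ∈ Finset.univ.erase (a i),
      ENNReal.ofReal (Real.exp (-θ)) * G b (c, y)) ∂Measure.pi fun t => T' t (word c a t)) /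
        Fintype.card (∀ k, Fin (M k) × Fin (L k)), ?_, ?_, ?_⟩
  · refine Measurable.div_const (Finset.measurable_sum _ fun a _ => ?_) _
    exact measurable_lintegral_word T' a (hFG a)
  · intro c
    refine ENNReal.div_le_div_right (Finset.sum_le_sum fun a _ => ?_) _
    exact measure_thresholdDecoder_ne_le i hg S hδ0 hS hθ.le c (a i) _
  simp_rw [div_eq_mul_inv]
  rw [lintegral_mul_const _ (Finset.measurable_sum _ fun a _ =>
    measurable_lintegral_word T' a (hFG a)), lintegral_finsetSum _ fun a _ =>
    measurable_lintegral_word T' a (hFG a), ← div_eq_mul_inv]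
  refine sum_div_card_le fun a => ?_
  have h1 : ∀ c : Codebook 𝒱 N M L, ∫⁻ y, (F a (c, y) + ∑ b ∈ Finset.univ.erase (a i),
      ENNReal.ofReal (Real.exp (-θ)) * G b (c, y)) ∂(Measure.pi fun t => T' t (word c a t)) =
      ∫⁻ y, F a (c, y) ∂(Measure.pi fun t => T' t (word c a t)) +
      ∑ b ∈ Finset.univ.erase (a i), ENNReal.ofReal (Real.exp (-θ)) *
        ∫⁻ y, G b (c, y) ∂(Measure.pi fun t => T' t (word c a t)) := by
    intro c
    have hGc : ∀ b, Measurable fun y => G b (c, y) := fun b => (hG b).comp measurable_prodMk_left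
    have hFc : Measurable fun y => F a (c, y) := (hF a).comp measurable_prodMk_left
    rw [lintegral_add_left hFc,
      lintegral_finsetSum _ fun b _ => (hGc b).const_mul _]
    simp_rw [lintegral_const_mul _ (hGc _)]
  simp_rw [h1]
  rw [lintegral_add_left (measurable_lintegral_word T' a (hF a)), lintegral_finsetSum _
    fun b _ => (measurable_lintegral_word T' a (hG b)).const_mul _]
  simp_rw [lintegral_const_mul _ (measurable_lintegral_word T' a (hG _))]
  refine add_le_add ?_ ?_
  · have h2 := lintegral_codebook_word Q a T' (h := fun z =>
      ENNReal.ofReal |∑ t ∈ S, g ((z t).1 i, (z t).2) - S.card * u| /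
        ENNReal.ofReal (S.card * δ)) (by refine Measurable.div_const ?_ _; fun_prop)
    refine (le_of_eq h2).trans ?_
    simp_rw [div_eq_mul_inv]
    rw [lintegral_mul_const _ (by fun_prop)]
    have h3 := hηb N S (fun t => Measure.pi Q ⊗ₘ T' t) fun t ht => by rw [hT' t ht]
    refine (mul_le_mul_left h3 _).trans ?_
    rw [ENNReal.ofReal_mul (by positivity), ENNReal.ofReal_natCast,
      ENNReal.mul_inv (by simp [hS.ne']) (by simp), ← mul_assoc, mul_right_comm (S.card : ℝ≥0∞),
      ENNReal.mul_inv_cancel (by simpa using hS.ne') (by simp), one_mul]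
  -- A competing codeword is independent of the output, so the mean of its exponential score is a
  -- product of single-letter means, each at most one.
  · have h4 : ∀ b ∈ Finset.univ.erase (a i), ENNReal.ofReal (Real.exp (-θ)) *
        ∫⁻ c, ∫⁻ y, G b (c, y) ∂(Measure.pi fun t => T' t (word c a t)) ∂codebookLaw N M L Q ≤
        ENNReal.ofReal (Real.exp (-θ)) := by
      intro b hb
      refine mul_le_of_le_one_right zero_le ?_
      have h5 := lintegral_codebook_word_prod Q a i (Finset.ne_of_mem_erase hb) T'
        (h := fun t p => if t ∈ S then ENNReal.ofReal (Real.exp (g (p.2, p.1.2))) else 1)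
        (fun t => by split_ifs <;> fun_prop)
      refine (le_of_eq h5).trans (Finset.prod_le_one' fun t _ => ?_)
      split_ifs with ht
      · rw [hT' t ht]
        refine le_trans (le_of_eq ?_) hg1
        have hge : Measurable fun z => ENNReal.ofReal (Real.exp (g z)) := by fun_prop
        rw [lintegral_prod_symm _ hge.aemeasurable, lintegral_map
          hge.lintegral_prod_left' measurable_snd]
      · simp
    refine (Finset.sum_le_card_nsmul _ _ _ h4).trans ?_
    rw [nsmul_eq_mul]
    have h6 : ((Finset.univ.erase (a i)).card : ℝ≥0∞) ≤ ENNReal.ofReal (M i * L i) := by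
      rw [← Nat.cast_mul, ENNReal.ofReal_natCast]
      have := Finset.card_le_univ (Finset.univ.erase (a i))
      rw [Fintype.card_prod, Fintype.card_fin, Fintype.card_fin] at this
      exact_mod_cast this
    refine (mul_le_mul_left h6 _).trans ?_
    rw [← ENNReal.ofReal_mul (by positivity)]
    refine ENNReal.ofReal_le_ofReal ?_
    refine (mul_le_mul_of_nonneg_right hML (Real.exp_pos _).le).trans ?_
    rw [mul_assoc, ← Real.exp_add]
    refine le_of_eq ?_
    congr 2
    rw [hθ, hδ]; ring

end decoding

/-! ### Leakage of random codebooks -/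

section leakage

set_option linter.unusedSectionVars false

variable {K : ℕ} {𝒱 : Fin K → Type*} [∀ i, MeasurableSpace (𝒱 i)] {𝒵 : Type*} [MeasurableSpace 𝒵]

lemma log_one_add_add_le {x y : ℝ} (hx : 0 ≤ x) (hy : 0 ≤ y) :
    Real.log (1 + (x + y)) ≤ Real.log (1 + x) + y := by
  have h1 : 1 + (x + y) ≤ (1 + x) * Real.exp y := by
    have := Real.add_one_le_exp y
    nlinarith [Real.one_le_exp hy]
  calc Real.log (1 + (x + y)) ≤ Real.log ((1 + x) * Real.exp y) :=
        Real.log_le_log (by positivity) h1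
    _ = _ := by rw [Real.log_mul (by positivity) (Real.exp_pos _).ne', Real.log_exp]

lemma log_one_add_prod_div_le {ι : Type*} (S : Finset ι) (x : ι → ℝ≥0) {m l : ℝ}
    (hl : Real.exp m ≤ l) :
    Real.log (1 + (∏ t ∈ S, (x t : ℝ)) / l) ≤ 1 + |∑ t ∈ S, Real.log (x t) - m| := by
  have hl0 : 0 < l := (Real.exp_pos m).trans_le hl
  -- Since `Real.log 0 = 0`, a vanishing factor would not show in the sum of logarithms; in that
  -- case the left side is zero.
  by_cases h0 : ∃ t ∈ S, x t = 0
  · obtain ⟨t, ht, h⟩ := h0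
    rw [Finset.prod_eq_zero ht (by simp [h]), zero_div, add_zero, Real.log_one]
    positivity
  · push Not at h0
    set d := ∑ t ∈ S, Real.log (x t) - m with hd
    have h1 : (∏ t ∈ S, (x t : ℝ)) / l ≤ Real.exp |d| := by
      rw [div_le_iff₀ hl0]
      calc (∏ t ∈ S, (x t : ℝ)) = Real.exp (∑ t ∈ S, Real.log (x t)) := by
            rw [Real.exp_sum]
            refine Finset.prod_congr rfl fun t ht => (Real.exp_log ?_).symm
            exact_mod_cast pos_iff_ne_zero.2 (h0 t ht)
        _ = Real.exp d * Real.exp m := by rw [← Real.exp_add, hd]; ring_nf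
        _ ≤ Real.exp |d| * l := by
            gcongr
            exact le_abs_self d
    have h2 : (1 : ℝ) ≤ Real.exp |d| := Real.one_le_exp (abs_nonneg d)
    -- The additive constant `1` of the bound comes from `2 ≤ exp 1`.
    have h3 : 2 * Real.exp |d| ≤ Real.exp (1 + |d|) := by
      rw [Real.exp_add]
      have := Real.add_one_le_exp (1 : ℝ)
      gcongr
      linarith
    rw [Real.log_le_iff_le_exp (by positivity)]
    linarith

/-- The likelihood ratio of the output block for the codewords with index `a`, counting only the
times in `S`. -/
noncomputable def blockDensity {N : ℕ} {M L : Fin K → ℕ} (f : (∀ i, 𝒱 i) × 𝒵 → ℝ≥0)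
    (S : Finset (Fin N)) (c : Codebook 𝒱 N M L) (a : ∀ k, Fin (M k) × Fin (L k))
    (y : Fin N → 𝒵) : ℝ≥0 :=
  ∏ t ∈ S, f (word c a t, y t)

lemma measurable_blockDensity {N : ℕ} {M L : Fin K → ℕ} {f : (∀ i, 𝒱 i) × 𝒵 → ℝ≥0}
    (hf : Measurable f) (S : Finset (Fin N)) (a : ∀ k, Fin (M k) × Fin (L k)) :
    Measurable fun p : Codebook 𝒱 N M L × (Fin N → 𝒵) => blockDensity f S p.1 a p.2 := by
  refine Finset.measurable_prod _ fun t _ => hf.comp ?_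
  exact ((measurable_pi_apply t).comp ((measurable_word a).comp measurable_fst)).prodMk
    ((measurable_pi_apply t).comp measurable_snd)

/-- The sent codeword is split off from the average and stays under the logarithm, where its
likelihood ratio is typically about `exp m`, no more than `L k`. The other codewords are taken out
linearly, because only their means are controlled. -/
lemma log_avgDensity_blockDensity_le {N : ℕ} {M L : Fin K → ℕ} (f : (∀ i, 𝒱 i) × 𝒵 → ℝ≥0)
    (S : Finset (Fin N)) (c : Codebook 𝒱 N M L) (k : Fin K) (a : ∀ k, Fin (M k) × Fin (L k))
    (y : Fin N → 𝒵) {m : ℝ} (hL : Real.exp m ≤ L k) :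
    ENNReal.ofReal (Real.log (1 + avgDensity (blockDensity f S c) k a y)) ≤
      1 + ENNReal.ofReal |∑ t ∈ S, Real.log (f (word c a t, y t)) - m| +
        (∑ l ∈ Finset.univ.erase (a k).2,
          (blockDensity f S c (Function.update a k ((a k).1, l)) y : ℝ≥0∞)) / L k := by
  have hl0 : (0 : ℝ) < L k := (Real.exp_pos m).trans_le hL
  have hl0' : (L k : ℝ≥0) ≠ 0 := by exact_mod_cast hl0.ne'
  set B : ℝ≥0 := (∑ l ∈ Finset.univ.erase (a k).2,
    blockDensity f S c (Function.update a k ((a k).1, l)) y) / L k with hB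
  have hsplit : avgDensity (blockDensity f S c) k a y = blockDensity f S c a y / L k + B := by
    rw [avgDensity, ← Finset.add_sum_erase _ _ (Finset.mem_univ (a k).2), add_div,
      Fintype.card_fin, hB]
    congr 3
    exact Function.update_eq_self k a
  have hBE : (B : ℝ≥0∞) = (∑ l ∈ Finset.univ.erase (a k).2,
      (blockDensity f S c (Function.update a k ((a k).1, l)) y : ℝ≥0∞)) / L k := by
    rw [hB, ENNReal.coe_div hl0']
    push_cast
    rfl
  rw [← hBE, hsplit]
  push_cast
  have h1 := log_one_add_add_le (x := (blockDensity f S c a y : ℝ) / L k) (by positivity)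
    B.coe_nonneg
  have h2 := log_one_add_prod_div_le S (fun t => f (word c a t, y t)) hL
  have h3 : ((blockDensity f S c a y : ℝ≥0) : ℝ) = ∏ t ∈ S, (f (word c a t, y t) : ℝ) := by
    rw [blockDensity]; push_cast; rfl
  rw [← h3] at h2
  refine (ENNReal.ofReal_le_ofReal (h1.trans (add_le_add_left h2 _))).trans ?_
  rw [ENNReal.ofReal_add (by positivity) B.coe_nonneg, ENNReal.ofReal_add zero_le_one
    (abs_nonneg _), ENNReal.ofReal_one, ENNReal.ofReal_coe_nnreal]

/-- Outside `S` the two kernels coincide, so those letters contribute the density one. -/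
lemma pi_word_eq_withDensity {N : ℕ} {M L : Fin K → ℕ} {T' q' : Fin N → Kernel (∀ i, 𝒱 i) 𝒵}
    [∀ t, IsMarkovKernel (T' t)] [∀ t, IsMarkovKernel (q' t)] {f : (∀ i, 𝒱 i) × 𝒵 → ℝ≥0}
    (hf : Measurable f) (S : Finset (Fin N)) (c : Codebook 𝒱 N M L)
    (a : ∀ k, Fin (M k) × Fin (L k))
    (hS : ∀ t ∈ S, T' t (word c a t) =
      (q' t (word c a t)).withDensity fun y => (f (word c a t, y) : ℝ≥0∞))
    (hSc : ∀ t ∉ S, T' t = q' t) :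
    (Measure.pi fun t => T' t (word c a t)) =
      (Measure.pi fun t => q' t (word c a t)).withDensity fun y =>
        (blockDensity f S c a y : ℝ≥0∞) := by
  classical
  let φ : ∀ t : Fin N, 𝒵 → ℝ≥0∞ := fun t z => if t ∈ S then (f (word c a t, z) : ℝ≥0∞) else 1
  have hφ : ∀ t, Measurable (φ t) := fun t => by
    by_cases ht : t ∈ S
    · simp only [φ, ht, if_true]
      exact (hf.comp measurable_prodMk_left).coe_nnreal_ennreal
    · simp only [φ, ht, if_false]
      exact measurable_const
  have h1 : ∀ t, T' t (word c a t) = (q' t (word c a t)).withDensity (φ t) := fun t => by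
    by_cases ht : t ∈ S
    · rw [hS t ht]
      simp only [φ, ht, if_true]
    · rw [hSc t ht]
      simp only [φ, ht, if_false]
      exact withDensity_one.symm
  have : ∀ t, SigmaFinite ((q' t (word c a t)).withDensity (φ t)) := fun t => by
    rw [← h1]; infer_instance
  simp_rw [h1]
  rw [pi_withDensity _ hφ]
  congr 1
  funext y
  simp only [φ, blockDensity, Finset.prod_ite_mem, Finset.univ_inter]
  push_cast
  rfl

lemma ae_codebook_word {N : ℕ} {M L : Fin K → ℕ} (Q : ∀ i, Measure (𝒱 i))
    [∀ i, IsProbabilityMeasure (Q i)] {p : (∀ i, 𝒱 i) → Prop} (hp : ∀ᵐ v ∂Measure.pi Q, p v) :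
    ∀ᵐ c ∂codebookLaw N M L Q, ∀ a t, p (word c a t) := by
  refine ae_all_iff.2 fun a => ae_all_iff.2 fun t => ?_
  have h1 : (codebookLaw N M L Q).map (fun c => word c a t) = Measure.pi Q := by
    rw [← codebook_letter_map_word (M := M) (L := L) Q a, ← (measurePreserving_eval (fun _ : Fin N =>
      Measure.pi fun p : (Σ k : Fin K, Fin (M k) × Fin (L k)) => Q p.1) t).map_eq,
      Measure.map_map (by fun_prop) (by fun_prop)]
    rfl
  rw [← h1] at hp
  exact ae_of_ae_map ((measurable_pi_apply t).comp (measurable_word a)).aemeasurable hp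

/-- The expected leakage about the message of transmitter `k` grows sublinearly if the number of
codewords per message exceeds the conditional mutual information. -/
lemma exists_leakage_bound [∀ i, StandardBorelSpace (𝒱 i)] [∀ i, Nonempty (𝒱 i)]
    [StandardBorelSpace 𝒵] [Nonempty 𝒵]
    {Ω : Type*} [MeasurableSpace Ω] {μ : Measure Ω} [IsProbabilityMeasure μ]
    {V : ∀ i, Ω → 𝒱 i} {Y : Ω → 𝒵} (hV : ∀ i, Measurable (V i)) (hY : Measurable Y)
    (Q : ∀ i, Measure (𝒱 i)) [∀ i, IsProbabilityMeasure (Q i)] (T : Kernel (∀ i, 𝒱 i) 𝒵)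
    [IsMarkovKernel T] (hlaw : μ.map (fun ω => (fun i => V i ω, Y ω)) = Measure.pi Q ⊗ₘ T)
    (k : Fin K) {s : ℝ} (hs : 0 ≤ s)
    (hfin : condMutualInfo (V k) Y (fun ω (j : {j // j ≠ k}) => V j ω) μ ≤ ENNReal.ofReal s) :
    ∃ η : ℕ → ℝ≥0∞, Filter.Tendsto η Filter.atTop (nhds 0) ∧
      ∀ (N : ℕ) (M L : Fin K → ℕ) (S : Finset (Fin N))
        (T' : Fin N → Kernel (∀ i, 𝒱 i) 𝒵) [∀ t, IsMarkovKernel (T' t)],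
        (∀ t ∈ S, T' t = T) → (∀ t ∉ S, ∀ v v', T' t v = T' t v') →
        Real.exp (S.card * s) ≤ L k →
        ∃ leak : Codebook 𝒱 N M L → ℝ≥0∞, Measurable leak ∧
          ∫⁻ c, leak c ∂codebookLaw N M L Q ≤ 2 + S.card * η S.card ∧
          ∀ᵐ c ∂codebookLaw N M L Q,
            ∃ (q : (∀ k, Fin (M k) × Fin (L k)) → Measure (Fin N → 𝒵))
              (F : (∀ k, Fin (M k) × Fin (L k)) → (Fin N → 𝒵) → ℝ≥0),
              (∀ a, IsProbabilityMeasure (q a)) ∧ (∀ a, Measurable (F a)) ∧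
              (∀ a, (Measure.pi fun t => T' t (word c a t)) =
                (q a).withDensity fun y => (F a y : ℝ≥0∞)) ∧
              (∀ a b, q (Function.update a k b) = q a) ∧
              (∑ a, ∫⁻ y, ENNReal.ofReal (Real.log (1 + avgDensity F k a y))
                ∂(Measure.pi fun t => T' t (word c a t))) /
                Fintype.card (∀ k, Fin (M k) × Fin (L k)) ≤ leak c := by
  classical
  obtain ⟨q, _, f, hqk, hf, hqf, hint, hmean, hcross⟩ := exists_leakage_density hV hY Q T hlaw k
    (ne_top_of_le_ne_top ENNReal.ofReal_ne_top hfin)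
  have hlogf : Measurable fun p => Real.log (f p) := Real.measurable_log.comp hf.coe_nnreal_real
  obtain ⟨η, hη, hηb⟩ := exists_l1_rate (Measure.pi Q ⊗ₘ T) hlogf hint
  set u := ∫ p, Real.log (f p) ∂(Measure.pi Q ⊗ₘ T) with hu
  have hus : u ≤ s := hmean.trans (ENNReal.toReal_le_of_le_ofReal hs hfin)
  refine ⟨η, hη, fun N M L S T' _ hT' hT'c hL => ?_⟩
  -- No slack between `s` and `u` is required: deviations enter through their absolute mean, which
  -- is `o(n)`.
  have hL' : Real.exp (S.card * u) ≤ L k := by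
    refine le_trans ?_ hL
    gcongr
  have hL0 : (0 : ℝ) < L k := (Real.exp_pos _).trans_le hL
  let G : (∀ k, Fin (M k) × Fin (L k)) → Codebook 𝒱 N M L × (Fin N → 𝒵) → ℝ≥0∞ :=
    fun a p => ENNReal.ofReal |∑ t ∈ S, Real.log (f (word p.1 a t, p.2 t)) - S.card * u|
  let H : (∀ k, Fin (M k) × Fin (L k)) → Codebook 𝒱 N M L × (Fin N → 𝒵) → ℝ≥0∞ :=
    fun b p => (blockDensity f S p.1 b p.2 : ℝ≥0∞)
  have hword : ∀ (a : ∀ k, Fin (M k) × Fin (L k)) t, Measurable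
      fun p : Codebook 𝒱 N M L × (Fin N → 𝒵) => (word p.1 a t, p.2 t) := fun a t =>
    ((measurable_pi_apply t).comp ((measurable_word a).comp measurable_fst)).prodMk
      ((measurable_pi_apply t).comp measurable_snd)
  have hG : ∀ a, Measurable (G a) := fun a => by
    have : ∀ t, Measurable fun p : Codebook 𝒱 N M L × (Fin N → 𝒵) =>
        Real.log (f (word p.1 a t, p.2 t)) := fun t => hlogf.comp (hword a t)
    fun_prop
  have hH : ∀ b, Measurable (H b) := fun b => (measurable_blockDensity hf S b).coe_nnreal_ennreal
  have hGH : ∀ a : ∀ k, Fin (M k) × Fin (L k), Measurable fun p => 1 + G a p +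
      (∑ l ∈ Finset.univ.erase (a k).2, H (Function.update a k ((a k).1, l)) p) / L k :=
    fun a => (measurable_const.add (hG a)).add
      ((Finset.measurable_sum _ fun l _ => hH _).div_const _)
  refine ⟨fun c => (∑ a : ∀ k, Fin (M k) × Fin (L k), ∫⁻ y, (1 + G a (c, y) +
      (∑ l ∈ Finset.univ.erase (a k).2, H (Function.update a k ((a k).1, l)) (c, y)) / L k)
        ∂Measure.pi fun t => T' t (word c a t)) / Fintype.card (∀ k, Fin (M k) × Fin (L k)),
    ?_, ?_, ?_⟩
  · refine Measurable.div_const (Finset.measurable_sum _ fun a _ => ?_) _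
    exact measurable_lintegral_word T' a (hGH a)
  · simp_rw [div_eq_mul_inv _ (Fintype.card _ : ℝ≥0∞)]
    rw [lintegral_mul_const _ (Finset.measurable_sum _ fun a _ =>
      measurable_lintegral_word T' a (hGH a)), lintegral_finsetSum _ fun a _ =>
      measurable_lintegral_word T' a (hGH a), ← div_eq_mul_inv]
    refine sum_div_card_le fun a => ?_
    have h1 : ∀ c : Codebook 𝒱 N M L, ∫⁻ y, (1 + G a (c, y) +
        (∑ l ∈ Finset.univ.erase (a k).2, H (Function.update a k ((a k).1, l)) (c, y)) / L k)
          ∂(Measure.pi fun t => T' t (word c a t)) =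
        1 + ∫⁻ y, G a (c, y) ∂(Measure.pi fun t => T' t (word c a t)) +
        (∑ l ∈ Finset.univ.erase (a k).2, ∫⁻ y, H (Function.update a k ((a k).1, l)) (c, y)
          ∂(Measure.pi fun t => T' t (word c a t))) * (L k : ℝ≥0∞)⁻¹ := by
      intro c
      have hGc : Measurable fun y => G a (c, y) := (hG a).comp measurable_prodMk_left
      have hHc : ∀ b, Measurable fun y => H b (c, y) := fun b =>
        (hH b).comp measurable_prodMk_left
      have h1Gc : Measurable fun y => 1 + G a (c, y) := measurable_const.add hGc
      rw [lintegral_add_left h1Gc, lintegral_add_left measurable_const,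
        lintegral_const, measure_univ, mul_one]
      simp_rw [div_eq_mul_inv]
      rw [lintegral_mul_const _ (Finset.measurable_sum _ fun b _ => hHc _),
        lintegral_finsetSum _ fun b _ => hHc _]
    simp_rw [h1]
    have hHm : ∀ l, Measurable fun c : Codebook 𝒱 N M L =>
        ∫⁻ y, H (Function.update a k ((a k).1, l)) (c, y)
          ∂(Measure.pi fun t => T' t (word c a t)) := fun l =>
      measurable_lintegral_word T' a (hH _)
    have h1G : Measurable fun c : Codebook 𝒱 N M L =>
        1 + ∫⁻ y, G a (c, y) ∂(Measure.pi fun t => T' t (word c a t)) :=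
      measurable_const.add (measurable_lintegral_word T' a (hG a))
    rw [lintegral_add_left h1G,
      lintegral_add_left measurable_const, lintegral_const, measure_univ, mul_one,
      lintegral_mul_const _ (Finset.measurable_sum _ fun l _ => hHm l),
      lintegral_finsetSum _ fun l _ => hHm l]
    have h2 : ∫⁻ c, ∫⁻ y, G a (c, y) ∂(Measure.pi fun t => T' t (word c a t))
        ∂codebookLaw N M L Q ≤ S.card * η S.card := by
      have h3 := lintegral_codebook_word Q a T' (h := fun z =>
        ENNReal.ofReal |∑ t ∈ S, Real.log (f (z t)) - S.card * u|) (by fun_prop)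
      refine (le_of_eq h3).trans ?_
      exact hηb N S (fun t => Measure.pi Q ⊗ₘ T' t) fun t ht => by rw [hT' t ht]
    -- An unsent codeword of the same message acts as a fresh independent letter at each time, so
    -- the mean of its likelihood ratio is a product of factors at most one.
    have h4 : ∀ l ∈ Finset.univ.erase (a k).2,
        ∫⁻ c, ∫⁻ y, H (Function.update a k ((a k).1, l)) (c, y)
          ∂(Measure.pi fun t => T' t (word c a t)) ∂codebookLaw N M L Q ≤ 1 := by
      intro l hl
      have hne : ((a k).1, l) ≠ a k := fun h => Finset.ne_of_mem_erase hl (congrArg Prod.snd h)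
      have hfu : Measurable fun p : ((∀ i, 𝒱 i) × 𝒵) × 𝒱 k =>
          (f (Function.update p.1.1 k p.2, p.1.2) : ℝ≥0∞) := by
        refine (hf.comp (Measurable.prodMk ?_ (by fun_prop))).coe_nnreal_ennreal
        exact measurable_update'.comp (by fun_prop : Measurable fun p : ((∀ i, 𝒱 i) × 𝒵) × 𝒱 k =>
          (p.1.1, p.2))
      have h5 := lintegral_codebook_word_prod Q a k hne T'
        (h := fun t p => if t ∈ S then (f (Function.update p.1.1 k p.2, p.1.2) : ℝ≥0∞) else 1)
        (fun t => by
          by_cases ht : t ∈ S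
          · simpa only [ht, if_true] using hfu
          · simp only [ht, if_false]; exact measurable_const)
      refine le_trans (le_of_eq (Eq.trans ?_ h5)) (Finset.prod_le_one' fun t _ => ?_)
      · refine lintegral_congr fun c => lintegral_congr fun y => ?_
        simp only [H, blockDensity, word_update, Finset.prod_ite_mem, Finset.univ_inter]
        push_cast
        rfl
      · split_ifs with ht
        · rw [hT' t ht]
          exact hcross
        · simp
    have h6 : (∑ l ∈ Finset.univ.erase (a k).2,
        ∫⁻ c, ∫⁻ y, H (Function.update a k ((a k).1, l)) (c, y)
          ∂(Measure.pi fun t => T' t (word c a t)) ∂codebookLaw N M L Q) * (L k : ℝ≥0∞)⁻¹ ≤ 1 := by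
      rw [← div_eq_mul_inv]
      refine ENNReal.div_le_of_le_mul ?_
      refine (Finset.sum_le_card_nsmul _ _ _ h4).trans ?_
      rw [nsmul_eq_mul, mul_one, one_mul]
      have := Finset.card_le_univ (Finset.univ.erase (a k).2)
      rw [Fintype.card_fin] at this
      exact_mod_cast this
    -- One unit comes from the logarithmic bound for the sent codeword, the other from the average
    -- over the unsent ones.
    calc _ ≤ 1 + S.card * η S.card + 1 := add_le_add (add_le_add le_rfl h2) h6
      _ = 2 + S.card * η S.card := by rw [add_right_comm, one_add_one_eq_two]
  -- At padding times the output law ignores the auxiliary letters, so it can serve as its own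
  -- reference law.
  · let q' : Fin N → Kernel (∀ i, 𝒱 i) 𝒵 := fun t => if t ∈ S then q else T' t
    have hq'S : ∀ t ∈ S, q' t = q := fun t ht => if_pos ht
    have hq'Sc : ∀ t ∉ S, q' t = T' t := fun t ht => if_neg ht
    have hq'm : ∀ t, IsMarkovKernel (q' t) := fun t => by
      by_cases ht : t ∈ S
      · rw [hq'S t ht]; infer_instance
      · rw [hq'Sc t ht]; infer_instance
    filter_upwards [ae_codebook_word (N := N) (M := M) (L := L) Q hqf] with c hc
    refine ⟨fun a => Measure.pi fun t => q' t (word c a t), blockDensity f S c,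
      fun a => inferInstance, fun a => (measurable_blockDensity hf S a).comp
        measurable_prodMk_left, fun a => ?_, fun a b => ?_, ?_⟩
    · refine pi_word_eq_withDensity hf S c a (fun t ht => ?_) fun t ht => (hq'Sc t ht).symm
      rw [hT' t ht, hq'S t ht]
      exact hc a t
    · have hqt : ∀ t, q' t (word c (Function.update a k b) t) = q' t (word c a t) := by
        intro t
        rw [word_update]
        by_cases ht : t ∈ S
        · rw [hq'S t ht, hqk]
        · rw [hq'Sc t ht]
          exact hT'c t ht _ _
      simp only [hqt]
    · refine ENNReal.div_le_div_right (Finset.sum_le_sum fun a _ => lintegral_mono fun y => ?_) _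
      exact log_avgDensity_blockDensity_le f S c k a y hL'

end leakage

/-! ### The cost of random codebooks -/

/-- If some letter is strictly cheaper than the budget, the excess is bounded by the law of large
numbers, and the factor `P - cost x₀` can be extracted. Otherwise every letter costs at least `P`,
so the mean constraint forces conditional cost `P` almost surely and the excess vanishes, as it must
since then `cost x₀ = P`. -/
lemma exists_letter_cost_excess {𝒱 𝒳 : Type*} [MeasurableSpace 𝒱] [MeasurableSpace 𝒳]
    (Q : Measure 𝒱) [IsProbabilityMeasure Q] (κ : Kernel 𝒱 𝒳) [IsMarkovKernel κ]
    {cost : 𝒳 → ℝ≥0} (hcost : Measurable cost) {P : ℝ≥0}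
    (hP : ∫⁻ v, ∫⁻ x, cost x ∂κ v ∂Q ≤ P) :
    ∃ x₀, cost x₀ ≤ P ∧ ∃ η : ℕ → ℝ≥0∞, Filter.Tendsto η Filter.atTop (nhds 0) ∧
      ∀ (N : ℕ) (S : Finset (Fin N)),
        ∫⁻ z, (∑ t ∈ S, ∫⁻ x, cost x ∂κ (z t) - S.card * P) ∂Measure.pi (fun _ : Fin N => Q) ≤
          ((P - cost x₀ : ℝ≥0) : ℝ≥0∞) * (S.card * η S.card) := by
  have hcost' : Measurable fun x => (cost x : ℝ≥0∞) := hcost.coe_nnreal_ennreal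
  have hc : Measurable fun v => ∫⁻ x, cost x ∂κ v := hcost'.lintegral_kernel
  have hae : ∀ N : ℕ, ∀ {p : 𝒱 → Prop}, (∀ᵐ v ∂Q, p v) →
      ∀ᵐ z ∂Measure.pi (fun _ : Fin N => Q), ∀ t, p (z t) := fun N p hp =>
    ae_all_iff.2 fun t => (measurePreserving_eval (fun _ : Fin N => Q) t).quasiMeasurePreserving.ae hp
  by_cases hx : ∃ x, cost x < P
  · obtain ⟨x₀, hx₀⟩ := hx
    have hd : ((P - cost x₀ : ℝ≥0) : ℝ≥0∞) ≠ 0 := by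
      simpa [tsub_eq_zero_iff_le] using hx₀
    have hfin : ∫⁻ v, ∫⁻ x, cost x ∂κ v ∂Q ≠ ∞ := ne_top_of_le_ne_top ENNReal.coe_ne_top hP
    have hlt : ∀ᵐ v ∂Q, ∫⁻ x, cost x ∂κ v < ∞ := ae_lt_top hc hfin
    obtain ⟨η, hη, hηb⟩ := exists_l1_rate Q hc.ennreal_toReal
      (integrable_toReal_of_lintegral_ne_top hc.aemeasurable hfin)
    refine ⟨x₀, hx₀.le, fun n => η n / (P - cost x₀ : ℝ≥0), ?_, fun N S => ?_⟩
    · simpa using ENNReal.Tendsto.div_const hη (Or.inr hd)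
    · have h1 : ((P - cost x₀ : ℝ≥0) : ℝ≥0∞) * (S.card * (η S.card / (P - cost x₀ : ℝ≥0))) =
          S.card * η S.card := by
        rw [mul_left_comm, ENNReal.mul_div_cancel hd ENNReal.coe_ne_top]
      rw [h1]
      refine le_trans (lintegral_mono_ae ?_) (hηb N S (fun _ => Q) fun _ _ => rfl)
      filter_upwards [hae N hlt] with z hz
      have hm : ∫ v, (∫⁻ x, cost x ∂κ v).toReal ∂Q ≤ P := by
        rw [integral_toReal hc.aemeasurable hlt]
        exact ENNReal.toReal_le_coe_of_le_coe hP
      have h2 : ∑ t ∈ S, ∫⁻ x, cost x ∂κ (z t) =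
          ENNReal.ofReal (∑ t ∈ S, (∫⁻ x, cost x ∂κ (z t)).toReal) := by
        rw [ENNReal.ofReal_sum_of_nonneg fun _ _ => ENNReal.toReal_nonneg]
        exact Finset.sum_congr rfl fun t _ => (ENNReal.ofReal_toReal (hz t).ne).symm
      have h3 : (S.card : ℝ≥0∞) * P = ENNReal.ofReal (S.card * P) := by
        rw [ENNReal.ofReal_mul (by positivity), ENNReal.ofReal_natCast,
          ENNReal.ofReal_coe_nnreal]
      rw [h2, h3, ← ENNReal.ofReal_sub _ (by positivity)]
      refine ENNReal.ofReal_le_ofReal (le_trans ?_ (le_abs_self _))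
      gcongr
  · push Not at hx
    obtain ⟨v, hv⟩ := exists_le_lintegral (μ := Q) hc.aemeasurable
    obtain ⟨x₀, hx₀⟩ := exists_le_lintegral (μ := κ v) hcost'.aemeasurable
    refine ⟨x₀, by exact_mod_cast hx₀.trans (hv.trans hP), 0, tendsto_const_nhds, fun N S => ?_⟩
    have hge : ∀ v, (P : ℝ≥0∞) ≤ ∫⁻ x, cost x ∂κ v := fun v => by
      calc (P : ℝ≥0∞) = ∫⁻ _, P ∂κ v := by simp
        _ ≤ _ := lintegral_mono fun x => ENNReal.coe_le_coe.2 (hx x)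
    have heq : ∀ᵐ v ∂Q, ∫⁻ x, cost x ∂κ v = P := by
      have := ae_eq_of_ae_le_of_lintegral_le (μ := Q) (f := fun _ => (P : ℝ≥0∞))
        (g := fun v => ∫⁻ x, cost x ∂κ v) (.of_forall hge) (by simp) hc.aemeasurable
        (by simpa using hP)
      exact this.mono fun v hv => hv.symm
    refine le_of_eq_of_le (lintegral_eq_zero_of_ae_eq_zero ?_) zero_le
    filter_upwards [hae N heq] with z hz
    simp [hz]

/-- The `m` padding letters save `m * (P - cost x₀)`. The excess of the coded letters is measured in
units of this saving, so a value at most one means that the whole block meets the budget. -/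
lemma exists_codebook_cost {K : ℕ} {𝒱 : Fin K → Type*} [∀ i, MeasurableSpace (𝒱 i)]
    (Q : ∀ i, Measure (𝒱 i)) [∀ i, IsProbabilityMeasure (Q i)] (i : Fin K) {𝒳 : Type*}
    [MeasurableSpace 𝒳] (κ : Kernel (𝒱 i) 𝒳) [IsMarkovKernel κ]
    {cost : 𝒳 → ℝ≥0} (hcost : Measurable cost) {P : ℝ≥0}
    (hP : ∫⁻ v, ∫⁻ x, cost x ∂κ v ∂Q i ≤ P) :
    ∃ x₀ : 𝒳, ∃ η : ℕ → ℝ≥0∞, Filter.Tendsto η Filter.atTop (nhds 0) ∧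
      ∀ (N : ℕ) (M L : Fin K → ℕ) (S : Finset (Fin N)) (m : ℕ), S.card + m = N → 0 < m →
        ∃ exc : Codebook 𝒱 N M L → ℝ≥0∞, Measurable exc ∧
          ∫⁻ c, exc c ∂codebookLaw N M L Q ≤ S.card / m * η S.card ∧
          ∀ c, exc c ≤ 1 → ∑ t, (∑ a : ∀ k, Fin (M k) × Fin (L k),
            if t ∈ S then ∫⁻ x, cost x ∂κ (word c a t i) else cost x₀) /
              Fintype.card (∀ k, Fin (M k) × Fin (L k)) ≤ N * P := by
  obtain ⟨x₀, hx₀, η, hη, hηb⟩ := exists_letter_cost_excess (Q i) κ hcost hP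
  refine ⟨x₀, η, hη, fun N M L S m hN hm => ?_⟩
  have hc : Measurable fun v => ∫⁻ x, cost x ∂κ v := hcost.coe_nnreal_ennreal.lintegral_kernel
  have hcS : Measurable fun z : Fin N → 𝒱 i => ∑ t ∈ S, ∫⁻ x, cost x ∂κ (z t) - S.card * P :=
    (Finset.measurable_sum _ fun t _ => hc.comp (measurable_pi_apply t)).sub_const _
  let e : (∀ k, Fin (M k) × Fin (L k)) → Codebook 𝒱 N M L → ℝ≥0∞ := fun a c =>
    ∑ t ∈ S, ∫⁻ x, cost x ∂κ (word c a t i) - S.card * P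
  have he : ∀ a, Measurable (e a) := fun a =>
    hcS.comp (measurable_pi_iff.2 fun t => (measurable_pi_apply i).comp
      ((measurable_pi_apply t).comp (measurable_word a)))
  have hea : ∀ a, ∫⁻ c, e a c ∂codebookLaw N M L Q ≤
      ((P - cost x₀ : ℝ≥0) : ℝ≥0∞) * (S.card * η S.card) := by
    intro a
    refine le_trans (le_of_eq ?_) (hηb N S)
    have hmap : (codebookLaw N M L Q).map (fun c t => c t ⟨i, a i⟩) =
        Measure.pi fun _ : Fin N => Q i := by
      have hev := (measurePreserving_eval
        (fun p : (Σ k : Fin K, Fin (M k) × Fin (L k)) => Q p.1) ⟨i, a i⟩).map_eq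
      have : IsProbabilityMeasure ((Measure.pi fun p : (Σ k : Fin K, Fin (M k) × Fin (L k)) =>
          Q p.1).map (Function.eval ⟨i, a i⟩)) := by rw [hev]; infer_instance
      refine Eq.trans (Measure.pi_map_pi (f := fun _ => Function.eval
        (⟨i, a i⟩ : Σ k : Fin K, Fin (M k) × Fin (L k))) fun _ => (measurable_pi_apply _).aemeasurable) ?_
      simp_rw [hev]
    rw [← hmap, lintegral_map hcS (by fun_prop)]
    rfl
  set D : ℝ≥0∞ := m * ((P - cost x₀ : ℝ≥0) : ℝ≥0∞) with hD
  have hm0 : (m : ℝ≥0∞) ≠ 0 := by exact_mod_cast hm.ne'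
  refine ⟨fun c => (∑ a, e a c) / Fintype.card (∀ k, Fin (M k) × Fin (L k)) / D,
    ((Finset.measurable_sum _ fun a _ => he a).div_const _).div_const _, ?_, fun c hle => ?_⟩
  · simp_rw [div_eq_mul_inv]
    rw [lintegral_mul_const _ ((Finset.measurable_sum _ fun a _ => he a).mul_const _),
      lintegral_mul_const _ (Finset.measurable_sum _ fun a _ => he a),
      lintegral_finsetSum _ fun a _ => he a, ← div_eq_mul_inv]
    refine (mul_le_mul_left (sum_div_card_le hea) _).trans ?_
    rw [hD, ENNReal.mul_inv (Or.inl hm0) (Or.inl (ENNReal.natCast_ne_top m))]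
    by_cases h0 : ((P - cost x₀ : ℝ≥0) : ℝ≥0∞) = 0
    · simp [h0]
    · refine le_of_eq ?_
      calc ((P - cost x₀ : ℝ≥0) : ℝ≥0∞) * (S.card * η S.card) *
            ((m : ℝ≥0∞)⁻¹ * ((P - cost x₀ : ℝ≥0) : ℝ≥0∞)⁻¹)
          = ((P - cost x₀ : ℝ≥0) : ℝ≥0∞) * ((P - cost x₀ : ℝ≥0) : ℝ≥0∞)⁻¹ *
            (S.card * (m : ℝ≥0∞)⁻¹ * η S.card) := by ring
        _ = S.card * (m : ℝ≥0∞)⁻¹ * η S.card := by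
          rw [ENNReal.mul_inv_cancel h0 ENNReal.coe_ne_top, one_mul]
  · replace hle : (∑ a, e a c) / Fintype.card (∀ k, Fin (M k) × Fin (L k)) / D ≤ 1 := hle
    have hexc : (∑ a, e a c) / Fintype.card (∀ k, Fin (M k) × Fin (L k)) ≤ D := by
      -- If the padding saves nothing, a positive excess divided by zero would be `∞`; a value at
      -- most one therefore forces the excess to vanish.
      by_cases hD0 : D = 0
      · rw [hD0] at hle ⊢
        by_contra! hpos
        rw [ENNReal.div_zero hpos.ne'] at hle
        simp at hle
      · have := (ENNReal.div_le_iff_le_mul (Or.inl hD0) (Or.inl (ENNReal.mul_ne_top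
          (ENNReal.natCast_ne_top m) ENNReal.coe_ne_top))).1 hle
        rwa [one_mul] at this
    simp_rw [div_eq_mul_inv]
    rw [← Finset.sum_mul, Finset.sum_comm, ← div_eq_mul_inv]
    have hterm : ∀ a : ∀ k, Fin (M k) × Fin (L k),
        (∑ t, if t ∈ S then ∫⁻ x, cost x ∂κ (word c a t i) else (cost x₀ : ℝ≥0∞)) ≤
          e a c + (S.card * P + m * cost x₀) := by
      intro a
      rw [Finset.sum_ite, Finset.filter_mem_eq_inter, Finset.univ_inter, Finset.sum_const,
        ← add_assoc]
      refine add_le_add le_tsub_add (le_of_eq ?_)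
      rw [nsmul_eq_mul]
      congr 2
      rw [Finset.filter_not, Finset.filter_mem_eq_inter, Finset.univ_inter,
        ← Finset.compl_eq_univ_sdiff, Finset.card_compl, Fintype.card_fin]
      omega
    calc _ ≤ (∑ a : ∀ k, Fin (M k) × Fin (L k), (e a c + (S.card * P + m * cost x₀))) /
          Fintype.card (∀ k, Fin (M k) × Fin (L k)) :=
          ENNReal.div_le_div_right (Finset.sum_le_sum fun a _ => hterm a) _
      _ ≤ D + (S.card * P + m * cost x₀) := by
          rw [Finset.sum_add_distrib, ENNReal.add_div]
          exact add_le_add hexc (sum_div_card_le fun _ => le_rfl)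
      _ = N * P := by
          have h1 : ((P - cost x₀ : ℝ≥0) : ℝ≥0∞) + cost x₀ = P := by
            exact_mod_cast tsub_add_cancel_of_le hx₀
          have h2 : (N : ℝ≥0∞) = S.card + m := by exact_mod_cast hN.symm
          rw [hD, add_left_comm, ← mul_add, h1, ← add_mul, h2]

/-! ### Existence of good codes -/

section

variable {K : ℕ} {𝒱 : Fin K → Type*} [∀ i, MeasurableSpace (𝒱 i)]

/-- At rate zero there is a single message and nothing to decode. The case is needed because the
local randomness alone may exceed what the receiver can decode. -/
lemma exists_decoder {𝒵 : Type*} [MeasurableSpace 𝒵] (Q : ∀ i, Measure (𝒱 i))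
    [∀ i, IsProbabilityMeasure (Q i)]
    (T : Kernel (∀ i, 𝒱 i) 𝒵) [IsMarkovKernel T] (i : Fin K) {r s : ℝ}
    (hR : r = 0 ∨ ENNReal.ofReal (r + s) < InformationTheory.klDiv
      ((Measure.pi Q ⊗ₘ T).map fun p => (p.1 i, p.2))
      ((Q i).prod ((Measure.pi Q ⊗ₘ T).map Prod.snd))) :
    ∃ η : ℕ → ℝ≥0∞, Filter.Tendsto η Filter.atTop (nhds 0) ∧
      ∀ (N : ℕ) (M L : Fin K → ℕ) [NeZero (M i)] (S : Finset (Fin N))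
        (T' : Fin N → Kernel (∀ i, 𝒱 i) 𝒵) [∀ t, IsMarkovKernel (T' t)],
        (∀ t ∈ S, T' t = T) → 0 < S.card → (r = 0 → M i = 1) →
        (M i * L i : ℝ) ≤ 4 * Real.exp (S.card * (r + s)) →
        ∃ dec : Codebook 𝒱 N M L → (Fin N → 𝒵) → Fin (M i), (∀ c, Measurable (dec c)) ∧
          ∃ err : Codebook 𝒱 N M L → ℝ≥0∞, Measurable err ∧
            (∀ c, (∑ a : ∀ k, Fin (M k) × Fin (L k),
              (Measure.pi fun t => T' t (word c a t)) {y | dec c y ≠ (a i).1}) /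
                Fintype.card (∀ k, Fin (M k) × Fin (L k)) ≤ err c) ∧
            ∫⁻ c, err c ∂codebookLaw N M L Q ≤ η S.card := by
  rcases hR with h0 | hR
  · refine ⟨0, tendsto_const_nhds, fun N M L _ S T' _ _ _ hM _ => ?_⟩
    have : Subsingleton (Fin (M i)) := by rw [hM h0]; infer_instance
    refine ⟨fun _ _ => 0, fun _ => measurable_const, 0, measurable_zero, fun c => ?_, by simp⟩
    refine sum_div_card_le fun a => le_of_eq ?_
    have : {y : Fin N → 𝒵 | (0 : Fin (M i)) ≠ (a i).1} = ∅ :=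
      Set.eq_empty_of_forall_notMem fun y hy => hy (Subsingleton.elim _ _)
    rw [this, measure_empty]
    rfl
  · obtain ⟨η, hη, h⟩ := exists_decoder_of_lt Q T i hR
    exact ⟨η, hη, fun N M L _ S T' _ hT' hS _ hML => h N M L S T' hT' hS hML⟩

variable {𝒳 : Fin K → Type*} [∀ i, MeasurableSpace (𝒳 i)]
  {𝒴 : Option (Fin K) → Type*} [∀ j, MeasurableSpace (𝒴 j)]

lemma auxChannelTo_congr (W : Kernel (∀ i, 𝒳 i) (∀ j, 𝒴 j)) {κ κ' : ∀ i, Kernel (𝒱 i) (𝒳 i)}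
    [∀ i, IsMarkovKernel (κ i)] [∀ i, IsMarkovKernel (κ' i)] (h : κ = κ') (j : Option (Fin K)) :
    auxChannelTo W κ j = auxChannelTo W κ' j := by
  subst h; rfl

lemma auxChannelTo_apply_congr (W : Kernel (∀ i, 𝒳 i) (∀ j, 𝒴 j)) (κ : ∀ i, Kernel (𝒱 i) (𝒳 i))
    [∀ i, IsMarkovKernel (κ i)] (j : Option (Fin K)) {v v' : ∀ i, 𝒱 i}
    (h : ∀ i, κ i (v i) = κ i (v' i)) : auxChannelTo W κ j v = auxChannelTo W κ j v' := by
  simp_rw [auxChannelTo, auxChannel, Kernel.map_apply _ (measurable_pi_apply j),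
    Kernel.comp_apply, piKernel_apply, h]

lemma entropy_sub_condEntropy_le_of_leakage {N : ℕ} {M L : Fin K → ℕ} (hM : ∀ i, NeZero (M i))
    [∀ i, NeZero (L i)] (W : Kernel (∀ i, 𝒳 i) (∀ j, 𝒴 j)) [IsMarkovKernel W]
    (κ : Fin N → ∀ i, Kernel (𝒱 i) (𝒳 i)) [∀ t i, IsMarkovKernel (κ t i)]
    (c : Codebook 𝒱 N M L) (dec : ∀ i, (Fin N → 𝒴 (some i)) → Fin (M i))
    (hdec : ∀ i, Measurable (dec i)) (j : Option (Fin K)) (S : Finset (Fin K))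
    {U : Type*} [MeasurableSpace U] [MeasurableSingletonClass U] [StandardBorelSpace U]
    [Fintype U] [Nonempty U] (G : (∀ k, Fin (M k)) → U)
    (hG : ∀ w w', G w = G w' ↔ ∀ k ∈ S, w k = w' k)
    (hcard : Fintype.card U = ∏ k ∈ S, M k) {δ : ℝ} (hδ : 0 ≤ δ)
    (hleak : ∀ k ∈ S, ∃ (q : (∀ k, Fin (M k) × Fin (L k)) → Measure (Fin N → 𝒴 j))
      (F : (∀ k, Fin (M k) × Fin (L k)) → (Fin N → 𝒴 j) → ℝ≥0),
      (∀ a, IsProbabilityMeasure (q a)) ∧ (∀ a, Measurable (F a)) ∧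
      (∀ a, (Measure.pi fun t => auxChannelTo W (κ t) j (word c a t)) =
        (q a).withDensity fun y => (F a y : ℝ≥0∞)) ∧
      (∀ a b, q (Function.update a k b) = q a) ∧
      (∑ a, ∫⁻ y, ENNReal.ofReal (Real.log (1 + avgDensity F k a y))
        ∂(Measure.pi fun t => auxChannelTo W (κ t) j (word c a t))) /
        Fintype.card (∀ k, Fin (M k) × Fin (L k)) ≤ ENNReal.ofReal δ) :
    entropy (fun ω => G ((codeOfCodebook hM κ c dec hdec).msgAll ω))
        ((codeOfCodebook hM κ c dec hdec).law W) -
      condEntropy (fun ω => G ((codeOfCodebook hM κ c dec hdec).msgAll ω))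
        ((codeOfCodebook hM κ c dec hdec).output j) ((codeOfCodebook hM κ c dec hdec).law W) ≤
      S.card * δ := by
  classical
  set C := codeOfCodebook hM κ c dec hdec with hC
  let lam : (∀ k, Fin (M k) × Fin (L k)) → Measure (Fin N → 𝒴 j) := fun a =>
    Measure.pi fun t => auxChannelTo W (κ t) j (word c a t)
  have hleak' : ∀ k, ∃ (q : (∀ k, Fin (M k) × Fin (L k)) → Measure (Fin N → 𝒴 j))
      (F : (∀ k, Fin (M k) × Fin (L k)) → (Fin N → 𝒴 j) → ℝ≥0),
      (∀ a, IsProbabilityMeasure (q a)) ∧ (∀ a, Measurable (F a)) ∧ (k ∈ S →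
      (∀ a, lam a = (q a).withDensity fun y => (F a y : ℝ≥0∞)) ∧
      (∀ a b, q (Function.update a k b) = q a) ∧
      (∑ a, ∫⁻ y, ENNReal.ofReal (Real.log (1 + avgDensity F k a y)) ∂lam a) /
        Fintype.card (∀ k, Fin (M k) × Fin (L k)) ≤ ENNReal.ofReal δ) := by
    intro k
    by_cases hk : k ∈ S
    · obtain ⟨q, F, h1, h2, h3⟩ := hleak k hk
      exact ⟨q, F, h1, h2, fun _ => h3⟩
    · exact ⟨lam, fun _ _ => 0, fun a => inferInstanceAs (IsProbabilityMeasure (Measure.pi _)),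
        fun _ => measurable_const, fun h => absurd h hk⟩
  choose q F hq hF h using hleak'
  have hmsg : Measurable C.msgAll := by unfold Code.msgAll Code.msg; fun_prop
  have hout : Measurable (C.output j) := by unfold Code.output; fun_prop
  have hGm : Measurable G := .of_discrete
  have := ofReal_entropy_sub_condEntropy_le (lam := lam) (C.law W) (X := fun ω => G (C.msgAll ω))
    (hGm.comp hmsg) hout G S hG (by simpa using hcard) (fun u E hE => ?_) hF
    (fun k hk => (h k hk).1) fun k hk => (h k hk).2.1
  · replace this := this.trans (Finset.sum_le_card_nsmul _ _ _ fun k hk => (h k hk).2.2)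
    rw [nsmul_eq_mul, ← ENNReal.ofReal_natCast, ← ENNReal.ofReal_mul (by positivity),
      ENNReal.ofReal_le_ofReal_iff (by positivity)] at this
    exact this
  · have hs : MeasurableSet {p : (∀ i, Fin (M i)) × (Fin N → 𝒴 j) | G p.1 = u ∧ p.2 ∈ E} :=
      ((hGm.comp measurable_fst) (measurableSet_singleton u)).inter (measurable_snd hE)
    refine (law_apply hM W κ c dec hdec j hs).trans ?_
    congr 1
    refine Finset.sum_congr rfl fun a _ => ?_
    split_ifs with hu
    · simp [hu, lam]
    · simp [hu]

end

lemma tendsto_two_add_div {η : ℕ → ℝ≥0∞} (hη : Filter.Tendsto η Filter.atTop (nhds 0)) {b : ℝ}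
    (hb : 0 < b) :
    Filter.Tendsto (fun n : ℕ => (2 + n * η n) / ENNReal.ofReal (n * b)) Filter.atTop (nhds 0) := by
  have hb' : ENNReal.ofReal b ≠ 0 := by simpa using hb
  have h1 : Filter.Tendsto (fun n : ℕ => (2 * (n : ℝ≥0∞)⁻¹ + η n) / ENNReal.ofReal b)
      Filter.atTop (nhds 0) := by
    have h2 := (ENNReal.Tendsto.const_mul (a := 2) ENNReal.tendsto_inv_nat_nhds_zero
      (Or.inr (by simp))).add hη
    have h3 := ENNReal.Tendsto.div_const h2 (b := ENNReal.ofReal b) (Or.inr hb')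
    simpa using h3
  refine h1.congr' ?_
  filter_upwards [Filter.eventually_gt_atTop 0] with n hn
  have hn0 : (n : ℝ≥0∞) ≠ 0 := by exact_mod_cast hn.ne'
  have hnt : (n : ℝ≥0∞) ≠ ∞ := ENNReal.natCast_ne_top n
  rw [ENNReal.ofReal_mul (by positivity), ENNReal.ofReal_natCast, div_eq_mul_inv, div_eq_mul_inv,
    ENNReal.mul_inv (Or.inl hn0) (Or.inl hnt), ← mul_assoc, add_mul 2 (n * η n),
    mul_right_comm (n : ℝ≥0∞), ENNReal.mul_inv_cancel hn0 hnt, one_mul]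

lemma tendsto_sum_zero {ι : Type*} [Fintype ι] {f : ι → ℕ → ℝ≥0∞}
    (hf : ∀ i, Filter.Tendsto (f i) Filter.atTop (nhds 0)) :
    Filter.Tendsto (fun n => ∑ i, f i n) Filter.atTop (nhds 0) := by
  simpa using tendsto_finsetSum Finset.univ fun i _ => hf i

lemma natCeil_exp_le (x : ℝ) (hx : 0 ≤ x) : (⌈Real.exp x⌉₊ : ℝ) ≤ 2 * Real.exp x := by
  have := Nat.ceil_lt_add_one (Real.exp_pos x).le
  have := Real.one_le_exp hx
  linarith

/-! ### Selection of one good code from the random ensemble -/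

section

variable {K : ℕ} {𝒳 : Fin K → Type*} [∀ i, MeasurableSpace (𝒳 i)]
  {𝒴 : Option (Fin K) → Type*} [∀ j, MeasurableSpace (𝒴 j)] [∀ j, StandardBorelSpace (𝒴 j)]
  [∀ j, Nonempty (𝒴 j)]
  {𝒱 : Fin K → Type*} [∀ i, MeasurableSpace (𝒱 i)] [∀ i, StandardBorelSpace (𝒱 i)]
  [∀ i, Nonempty (𝒱 i)]

/-- Random coding: `r i` are message rates and `s i` rates of local randomness. -/
lemma exists_code (W : Kernel (∀ i, 𝒳 i) (∀ j, 𝒴 j)) [IsMarkovKernel W]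
    (cost : ∀ i, 𝒳 i → ℝ≥0) (hcost : ∀ i, Measurable (cost i)) (P : Fin K → ℝ≥0)
    {Ω : Type*} [MeasurableSpace Ω] (μ : Measure Ω) [IsProbabilityMeasure μ]
    {V : ∀ i, Ω → 𝒱 i} {Y : ∀ j, Ω → 𝒴 j}
    (hV : ∀ i, Measurable (V i)) (hY : ∀ j, Measurable (Y j))
    (κ : ∀ i, Kernel (𝒱 i) (𝒳 i)) [∀ i, IsMarkovKernel (κ i)]
    (hlaw : ∀ j, μ.map (fun ω => (fun i => V i ω, Y j ω)) =
      Measure.pi (fun i => μ.map (V i)) ⊗ₘ auxChannelTo W κ j)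
    (hP : ∀ i, ∫⁻ v, ∫⁻ x, cost i x ∂κ i v ∂(μ.map (V i)) ≤ P i)
    {r s : Fin K → ℝ} (hr : ∀ i, 0 ≤ r i) (hs : ∀ i, 0 ≤ s i)
    (hMI : ∀ i, r i = 0 ∨ ENNReal.ofReal (r i + s i) < mutualInfo (V i) (Y (some i)) μ)
    (hcond : ∀ i j, j ≠ some i →
      condMutualInfo (V i) (Y j) (fun ω (k : {k // k ≠ i}) => V k ω) μ ≤ ENNReal.ofReal (s i))
    {ε : ℝ} (hε : 0 < ε) :
    ∃ n : ℕ, 0 < n ∧ ∃ C : Code 𝒳 𝒴 n,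
      (∀ i, r i - ε ≤ C.rate i) ∧
      (∀ i, ∑ t, ∫⁻ ω, cost i (C.input i t ω) ∂(C.law W) ≤ n * P i) ∧
      (∀ i, (C.law W).real {ω | C.dec i (C.output (some i) ω) ≠ C.msg i ω} ≤ ε) ∧
      (∀ i, entropy (C.msgExcept i) (C.law W) - n * ε ≤
        condEntropy (C.msgExcept i) (C.output (some i)) (C.law W)) ∧
      entropy C.msgAll (C.law W) - n * ε ≤ condEntropy C.msgAll (C.output none) (C.law W) := by
  classical
  let Q : ∀ i, Measure (𝒱 i) := fun i => μ.map (V i)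
  have hQ : ∀ i, IsProbabilityMeasure (Q i) := fun i =>
    Measure.isProbabilityMeasure_map (hV i).aemeasurable
  have hVm : Measurable fun ω i => V i ω := measurable_pi_iff.2 hV
  let T : ∀ j, Kernel (∀ i, 𝒱 i) (𝒴 j) := fun j => auxChannelTo W κ j
  have hdecR : ∀ i, r i = 0 ∨ ENNReal.ofReal (r i + s i) < InformationTheory.klDiv
      ((Measure.pi Q ⊗ₘ T (some i)).map fun p => (p.1 i, p.2))
      ((Q i).prod ((Measure.pi Q ⊗ₘ T (some i)).map Prod.snd)) := by
    intro i
    refine (hMI i).imp_right fun h => ?_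
    rw [← hlaw (some i), Measure.map_map (by fun_prop) (hVm.prodMk (hY _)),
      Measure.map_map measurable_snd (hVm.prodMk (hY _))]
    exact h
  choose ηd hηd hd using fun i => exists_decoder Q (T (some i)) i (hdecR i)
  choose ηl hηl hl using fun x : {x : Fin K × Option (Fin K) // x.2 ≠ some x.1} =>
    exists_leakage_bound hV (hY x.1.2) Q (T x.1.2) (hlaw x.1.2) x.1.1 (hs x.1.1)
      (hcond x.1.1 x.1.2 x.2)
  choose x₀ ηc hηc hc using fun i => exists_codebook_cost Q i (κ i) (hcost i) (hP i)
  -- With `p` coded letters per padding letter, rates shrink by the factor `p / (p + 1)`; the loss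
  -- `r i / (p + 1)` is at most `ε`.
  obtain ⟨p, hp⟩ := exists_nat_gt ((∑ i, r i) / ε)
  have hrp : ∀ i, r i ≤ p * ε := fun i => by
    have h1 := Finset.single_le_sum (fun i _ => hr i) (Finset.mem_univ i)
    rw [div_lt_iff₀ hε] at hp
    linarith
  have hp0 : 0 < p := by
    have : (0 : ℝ) ≤ (∑ i, r i) / ε := div_nonneg (Finset.sum_nonneg fun i _ => hr i) hε.le
    exact_mod_cast this.trans_lt hp
  -- A leakage is a sum over at most `K` users; `K + 1` also covers `K = 0`.
  set ε' : ℝ := ε / (K + 1) with hε'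
  have hε'0 : 0 < ε' := by positivity
  -- Each summand bounds the expectation of an undesired quantity divided by its tolerance, so a
  -- total at most one guarantees all the requirements.
  let B : ℕ → ℝ≥0∞ := fun n => ∑ i, ηd i n / ENNReal.ofReal ε +
    ∑ x, (2 + n * ηl x n) / ENNReal.ofReal (n * ε') + ∑ i, p * ηc i n
  have hB : Filter.Tendsto B Filter.atTop (nhds 0) := by
    rw [show (0 : ℝ≥0∞) = 0 + 0 + 0 by simp]
    refine ((tendsto_sum_zero fun i => ?_).add (tendsto_sum_zero fun x => ?_)).add
      (tendsto_sum_zero fun i => ?_)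
    · simpa using ENNReal.Tendsto.div_const (hηd i) (b := ENNReal.ofReal ε)
        (Or.inr (by simpa using hε))
    · exact tendsto_two_add_div (hηl x) hε'0
    · simpa using ENNReal.Tendsto.const_mul (a := (p : ℝ≥0∞)) (hηc i) (Or.inr (by simp))
  obtain ⟨m, hm, hm0⟩ := (((hB.comp (Filter.tendsto_id.const_mul_atTop' hp0)).eventually_le_const
    (zero_lt_one)).and (Filter.eventually_gt_atTop 0)).exists
  set n := p * m with hn
  have hn0 : 0 < n := Nat.mul_pos hp0 hm0
  replace hm : B n ≤ 1 := hm
  let N := n + m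
  let S : Finset (Fin N) := Finset.univ.map (Fin.castAddEmb m)
  have hS : S.card = n := by simp [S]
  let M : Fin K → ℕ := fun i => ⌈Real.exp (n * r i)⌉₊
  let L : Fin K → ℕ := fun i => ⌈Real.exp (n * s i)⌉₊
  have hM : ∀ i, NeZero (M i) := fun i => ⟨(Nat.ceil_pos.2 (Real.exp_pos _)).ne'⟩
  have hL : ∀ i, NeZero (L i) := fun i => ⟨(Nat.ceil_pos.2 (Real.exp_pos _)).ne'⟩
  -- Padding letters are deterministic and carry no information.
  let κ' : Fin N → ∀ i, Kernel (𝒱 i) (𝒳 i) := fun t i =>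
    if t ∈ S then κ i else Kernel.const _ (Measure.dirac (x₀ i))
  have hκ'S : ∀ t ∈ S, κ' t = κ := fun t ht => funext fun i => if_pos ht
  have hκ'Sc : ∀ t ∉ S, ∀ i, κ' t i = Kernel.const _ (Measure.dirac (x₀ i)) :=
    fun t ht i => if_neg ht
  have hκ' : ∀ t i, IsMarkovKernel (κ' t i) := fun t i => by
    by_cases ht : t ∈ S
    · rw [hκ'S t ht]; infer_instance
    · rw [hκ'Sc t ht]; infer_instance
  have hTS : ∀ j, ∀ t ∈ S, auxChannelTo W (κ' t) j = T j := fun j t ht =>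
    auxChannelTo_congr W (hκ'S t ht) j
  have hTSc : ∀ j, ∀ t ∉ S, ∀ v v', auxChannelTo W (κ' t) j v = auxChannelTo W (κ' t) j v' :=
    fun j t ht v v' => auxChannelTo_apply_congr W (κ' t) j fun i => by
      rw [hκ'Sc t ht, Kernel.const_apply, Kernel.const_apply]
  -- Each of the two ceilings costs at most a factor `2`.
  have hML : ∀ i, (M i * L i : ℝ) ≤ 4 * Real.exp (S.card * (r i + s i)) := fun i => by
    have h1 := natCeil_exp_le (n * r i) (mul_nonneg n.cast_nonneg (hr i))
    have h2 := natCeil_exp_le (n * s i) (mul_nonneg n.cast_nonneg (hs i))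
    calc (M i * L i : ℝ) ≤ (2 * Real.exp (n * r i)) * (2 * Real.exp (n * s i)) :=
          mul_le_mul h1 h2 (Nat.cast_nonneg _) (by positivity)
      _ = _ := by rw [hS, mul_add, Real.exp_add]; ring
  have hM1 : ∀ i, r i = 0 → M i = 1 := fun i h => by simp [M, h]
  choose dec hdecm err herrm herr herrI using fun i => hd i N M L S
    (fun t => auxChannelTo W (κ' t) (some i)) (hTS (some i)) (hS.symm ▸ hn0) (hM1 i) (hML i)
  choose leak hleakm hleakI hleak using fun x => hl x N M L S
    (fun t => auxChannelTo W (κ' t) x.1.2) (hTS x.1.2) (hTSc x.1.2)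
    (by rw [hS]; exact Nat.le_ceil _)
  choose exc hexcm hexcI hexc using fun i => hc i N M L S m (by rw [hS]) hm0
  let tot : Codebook 𝒱 N M L → ℝ≥0∞ := fun c => ∑ i, err i c / ENNReal.ofReal ε +
    ∑ x, leak x c / ENNReal.ofReal (n * ε') + ∑ i, exc i c
  have htotm1 : Measurable fun c => ∑ i, err i c / ENNReal.ofReal ε :=
    Finset.measurable_sum _ fun i _ => (herrm i).div_const _
  have htotm2 : Measurable fun c => ∑ x, leak x c / ENNReal.ofReal (n * ε') :=
    Finset.measurable_sum _ fun x _ => (hleakm x).div_const _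
  have htotm3 : Measurable fun c => ∑ i, exc i c := Finset.measurable_sum _ fun i _ => hexcm i
  have htotm12 : Measurable fun c => ∑ i, err i c / ENNReal.ofReal ε +
    ∑ x, leak x c / ENNReal.ofReal (n * ε') := htotm1.add htotm2
  have htot : ∫⁻ c, tot c ∂codebookLaw N M L Q ≤ 1 := by
    refine le_trans ?_ hm
    rw [lintegral_add_left htotm12, lintegral_add_left htotm1,
      lintegral_finsetSum _ fun i _ => (herrm i).div_const _,
      lintegral_finsetSum _ fun x _ => (hleakm x).div_const _,
      lintegral_finsetSum _ fun i _ => hexcm i]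
    simp_rw [div_eq_mul_inv, lintegral_mul_const _ (herrm _), lintegral_mul_const _ (hleakm _),
      ← div_eq_mul_inv]
    rw [hS] at herrI hleakI hexcI
    refine add_le_add (add_le_add ?_ ?_) ?_
    · exact Finset.sum_le_sum fun i _ => ENNReal.div_le_div_right (herrI i) _
    · exact Finset.sum_le_sum fun x _ => ENNReal.div_le_div_right (hleakI x) _
    · refine Finset.sum_le_sum fun i _ => (hexcI i).trans (le_of_eq ?_)
      congr 1
      rw [hn, Nat.cast_mul, mul_div_assoc, ENNReal.div_self (by exact_mod_cast hm0.ne')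
        (ENNReal.natCast_ne_top m), mul_one]
  -- First-moment method: some codebook outside the exceptional null set has a total no larger than
  -- its mean.
  obtain ⟨c, hcN, hc1⟩ := exists_notMem_null_le_lintegral (μ := codebookLaw N M L Q)
    (htotm12.add htotm3).aemeasurable (ae_all_iff.2 hleak)
  replace hcN := not_not.1 hcN
  replace hc1 : tot c ≤ 1 := hc1.trans htot
  have hle : ∀ {a b : ℝ≥0∞}, b ≠ 0 → b ≠ ∞ → a / b ≤ 1 → a ≤ b := fun hb hb' h => by
    rwa [ENNReal.div_le_iff_le_mul (Or.inl hb) (Or.inl hb'), one_mul] at h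
  have hnε : 0 < n * ε' := by positivity
  have herrc : ∀ i, err i c ≤ ENNReal.ofReal ε := fun i =>
    hle (by simpa using hε) ENNReal.ofReal_ne_top ((Finset.single_le_sum
      (f := fun i => err i c / ENNReal.ofReal ε) (fun _ _ => zero_le)
      (Finset.mem_univ i)).trans ((le_self_add.trans le_self_add).trans hc1))
  have hleakc : ∀ x, leak x c ≤ ENNReal.ofReal (n * ε') := fun x =>
    hle (ENNReal.ofReal_pos.2 hnε).ne' ENNReal.ofReal_ne_top ((Finset.single_le_sum
      (f := fun x => leak x c / ENNReal.ofReal (n * ε')) (fun _ _ => zero_le)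
      (Finset.mem_univ x)).trans ((le_add_self.trans le_self_add).trans hc1))
  have hexcc : ∀ i, exc i c ≤ 1 := fun i => (Finset.single_le_sum (f := fun i => exc i c)
    (fun _ _ => zero_le) (Finset.mem_univ i)).trans (le_add_self.trans hc1)
  have hNn : (n : ℝ) ≤ N := by exact_mod_cast Nat.le_add_right n m
  have hcard : ∀ S' : Finset (Fin K), S'.card * (n * ε') ≤ N * ε := fun S' => by
    have h1 : (S'.card : ℝ) ≤ K + 1 := by
      have := Finset.card_le_univ S'
      rw [Fintype.card_fin] at this
      have : (S'.card : ℝ) ≤ K := by exact_mod_cast this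
      linarith
    calc S'.card * (n * ε') ≤ (K + 1) * (n * ε') := by gcongr
      _ = n * ε := by rw [hε']; field_simp
      _ ≤ N * ε := by gcongr
  refine ⟨N, by omega, codeOfCodebook hM κ' c (fun i => dec i c) (fun i => hdecm i c),
    fun i => ?_, fun i => ?_, fun i => ?_, fun i => ?_, ?_⟩
  · have hm' : (0 : ℝ) < m := by exact_mod_cast hm0
    have h1 : n * r i ≤ Real.log (M i) := by
      rw [Real.le_log_iff_exp_le (by exact_mod_cast Nat.ceil_pos.2 (Real.exp_pos _))]
      exact Nat.le_ceil _
    have h2 : (N : ℝ) = p * m + m := by simp [N, hn]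
    have h3 : (n : ℝ) = p * m := by simp [hn]
    rw [Code.rate, le_div_iff₀ (by rw [h2]; positivity)]
    refine le_trans ?_ h1
    rw [h2, h3]
    have := hrp i
    nlinarith [mul_nonneg hm'.le (sub_nonneg.2 this), mul_pos hm' hε]
  · refine le_trans (le_of_eq (Finset.sum_congr rfl fun t _ => ?_)) (hexc i c (hexcc i))
    rw [lintegral_cost hM W κ' c (fun i => dec i c) (fun i => hdecm i c) hcost i t]
    congr 1
    refine Finset.sum_congr rfl fun a _ => ?_
    split_ifs with ht
    · rw [hκ'S t ht]
    · rw [hκ'Sc t ht, Kernel.const_apply, lintegral_dirac' _ (hcost i).coe_nnreal_ennreal]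
  · have hs : MeasurableSet {x : (∀ i, Fin (M i)) × (Fin N → 𝒴 (some i)) |
        dec i c x.2 ≠ x.1 i} :=
      (measurableSet_eq_fun ((hdecm i c).comp measurable_snd)
        ((measurable_pi_apply i).comp measurable_fst)).compl
    refine ENNReal.toReal_le_of_le_ofReal hε.le (le_trans (le_of_eq
      (law_apply hM W κ' c (fun i => dec i c) (fun i => hdecm i c) (some i) hs)) ?_)
    exact (herr i c).trans (herrc i)
  · have h1 := entropy_sub_condEntropy_le_of_leakage hM W κ' c (fun i => dec i c)
      (fun i => hdecm i c) (some i) (Finset.univ.erase i)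
      (fun w (k : {k : Fin K // k ≠ i}) => w k)
      (fun w w' => by
        simp only [funext_iff, Subtype.forall, Finset.mem_erase, Finset.mem_univ, and_true])
      (by
        rw [Fintype.card_pi]
        simp only [Fintype.card_fin]
        exact (Finset.prod_subtype _ (by simp) M).symm) hnε.le
      (fun k hk => by
        obtain ⟨q, F, h2, h3, h4, h5, h6⟩ := hcN ⟨(k, some i), by
          simpa using (Finset.ne_of_mem_erase hk).symm⟩
        exact ⟨q, F, h2, h3, h4, h5, h6.trans (hleakc _)⟩)
    have h2 := h1.trans (hcard _)
    rw [sub_le_comm] at h2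
    exact h2
  · have h1 := entropy_sub_condEntropy_le_of_leakage hM W κ' c (fun i => dec i c)
      (fun i => hdecm i c) none Finset.univ (fun w => w)
      (fun w w' => by simp only [funext_iff, Finset.mem_univ, true_implies])
      (by
        rw [Fintype.card_pi]
        simp only [Fintype.card_fin]) hnε.le
      (fun k _ => by
        obtain ⟨q, F, h2, h3, h4, h5, h6⟩ := hcN ⟨(k, none), by simp⟩
        exact ⟨q, F, h2, h3, h4, h5, h6.trans (hleakc _)⟩)
    have h2 := h1.trans (hcard _)
    rw [sub_le_comm] at h2
    exact h2

end

end InterferenceSecrecy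

/-! ### Choice of the rates from the single-letter bounds -/

theorem theorem2 {K : ℕ}
    -- the memoryless interference channel with input cost constraints
    {𝒳 : Fin K → Type*} [∀ i, MeasurableSpace (𝒳 i)] [∀ i, StandardBorelSpace (𝒳 i)]
    {𝒴 : Option (Fin K) → Type*} [∀ j, MeasurableSpace (𝒴 j)] [∀ j, StandardBorelSpace (𝒴 j)]
    [∀ j, Nonempty (𝒴 j)]
    (W : Kernel (∀ i, 𝒳 i) (∀ j, 𝒴 j)) [IsMarkovKernel W]
    (cost : ∀ i, 𝒳 i → ℝ≥0) (hcost : ∀ i, Measurable (cost i)) (P : Fin K → ℝ≥0)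
    -- the auxiliary variables, inputs and outputs of a single channel use
    {𝒱 : Fin K → Type*} [∀ i, MeasurableSpace (𝒱 i)] [∀ i, StandardBorelSpace (𝒱 i)]
    [∀ i, Nonempty (𝒱 i)]
    {Ω : Type*} [MeasurableSpace Ω] (μ : Measure Ω) [IsProbabilityMeasure μ]
    (V : ∀ i, Ω → 𝒱 i) (X : ∀ i, Ω → 𝒳 i) (Y : ∀ j, Ω → 𝒴 j)
    (hV : ∀ i, Measurable (V i)) (hX : ∀ i, Measurable (X i)) (hY : ∀ j, Measurable (Y j))
    -- the pairs `(V i, X i)` are independent, and `Y` depends on `(V, X)` through `X` by `W`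
    (hVX : iIndepFun (fun i ω => (V i ω, X i ω)) μ)
    (hchan : HasCondDistrib (fun ω j => Y j ω) (fun ω => (fun i => V i ω, fun i => X i ω))
      (W.prodMkLeft (∀ i, 𝒱 i)) μ)
    (hpower : ∀ i, ∫⁻ ω, cost i (X i ω) ∂μ ≤ P i)
    (R : Fin K → ℝ)
    (hR : ∀ i, (R i : EReal) ≤ (InterferenceSecrecy.mutualInfo (V i) (Y (some i)) μ : EReal) -
      ((⨆ j : {j : Option (Fin K) // j ≠ some i},
        InterferenceSecrecy.condMutualInfo (V i) (Y j) (fun ω (k : {k : Fin K // k ≠ i}) => V k ω) μ : ℝ≥0∞) :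
          EReal)) :
    InterferenceSecrecy.Achievable W cost P R := by
  open InterferenceSecrecy in
  have hΩ : Nonempty Ω := nonempty_of_isProbabilityMeasure μ
  have h𝒳 : ∀ i, Nonempty (𝒳 i) := fun i => hΩ.map (X i)
  set σ : Fin K → ℝ≥0∞ := fun i => ⨆ j : {j : Option (Fin K) // j ≠ some i},
    condMutualInfo (V i) (Y j) (fun ω (k : {k : Fin K // k ≠ i}) => V k ω) μ with hσ
  -- An infinite subtracted term gives `⊥` in `EReal`, even when the first mutual information is
  -- infinite; no real rate lies below it.
  have hσtop : ∀ i, σ i ≠ ∞ := fun i h => by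
    have h1 : (R i : EReal) ≤ (mutualInfo (V i) (Y (some i)) μ : EReal) - (σ i : EReal) := hR i
    rw [h, EReal.coe_ennreal_top, EReal.sub_top] at h1
    exact absurd h1 (not_le.2 (EReal.bot_lt_coe _))
  intro ε hε
  -- Lowering the rate by `ε / 2` makes the decoding inequality strict and leaves `ε / 2` as
  -- tolerance for the code; targets that become nonpositive are served by a single message.
  have hMI : ∀ i, max 0 (R i - ε / 2) = 0 ∨ ENNReal.ofReal (max 0 (R i - ε / 2) + (σ i).toReal) <
      mutualInfo (V i) (Y (some i)) μ := by
    intro i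
    rcases le_or_gt (R i - ε / 2) 0 with h | h
    · exact Or.inl (max_eq_left h)
    · right
      rw [max_eq_right h.le]
      by_cases hI : mutualInfo (V i) (Y (some i)) μ = ∞
      · rw [hI]; exact ENNReal.ofReal_lt_top
      · rw [ENNReal.ofReal_lt_iff_lt_toReal (by positivity) hI]
        have h1 : (R i : EReal) ≤ (mutualInfo (V i) (Y (some i)) μ : EReal) - (σ i : EReal) := hR i
        rw [← EReal.coe_ennreal_toReal hI, ← EReal.coe_ennreal_toReal (hσtop i),
          ← EReal.coe_sub, EReal.coe_le_coe_iff] at h1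
        linarith
  obtain ⟨n, hn, C, hrate, hC⟩ := exists_code W cost hcost P μ hV hY
    (fun i => condDistrib (X i) (V i) μ) (fun j => map_aux_output W μ hV hX hY hVX hchan j)
    (fun i => by
      refine le_trans (le_of_eq ?_) (hpower i)
      have hc : Measurable fun p : 𝒱 i × 𝒳 i => (cost i p.2 : ℝ≥0∞) :=
        ((hcost i).comp measurable_snd).coe_nnreal_ennreal
      rw [← Measure.lintegral_compProd (f := fun p => (cost i p.2 : ℝ≥0∞)) hc,
        compProd_map_condDistrib (hX i).aemeasurable, lintegral_map hc ((hV i).prodMk (hX i))])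
    (fun i => le_max_left _ _) (fun i => ENNReal.toReal_nonneg) hMI
    (fun i j hj => by
      rw [ENNReal.ofReal_toReal (hσtop i)]
      exact le_iSup (fun j : {j : Option (Fin K) // j ≠ some i} => condMutualInfo (V i) (Y j)
        (fun ω (k : {k : Fin K // k ≠ i}) => V k ω) μ) ⟨j, hj⟩)
    (half_pos hε)
  have hmono : (n : ℝ) * (ε / 2) ≤ n * ε := by gcongr; linarith
  refine ⟨n, hn, C, fun i => ?_, hC.1, fun i => (hC.2.1 i).trans (half_le_self hε.le),
    fun i => (sub_le_sub_left hmono _).trans (hC.2.2.1 i),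
    (sub_le_sub_left hmono _).trans hC.2.2.2⟩
  have := hrate i
  have := le_max_right 0 (R i - ε / 2)
  linarith
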